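/- Theorem. Let $n\ge 0$, let $P_0,P_1$ be symmetric positive definite real $n\times n$ matrices, and let $g_P(x)=\det(2\pi P)^{-1/2}e^{-\frac12 x'P^{-1}x}$ denote the zero-mean Gaussian density on $\mathbb R^n$ with covariance $P$. Put $$P_t^{\rm info}=P_0^{1/2}\big(P_0^{-1/2}P_1P_0^{-1/2}\big)^tP_0^{1/2},\qquad A^{\rm info}=\tfrac12 P_0^{1/2}\log\big(P_0^{-1/2}P_1P_0^{-1/2}\big)P_0^{-1/2},$$ $$d_{\rm info}(P_0,P_1)=\big\|\log\big(P_0^{-1/2}P_1P_0^{-1/2}\big)\big\|_{\rm F}$$ (so $P_t^{\rm info}$ is the Fisher–Rao geodesic from $P_0$ to $P_1$ and $d_{\rm info}$ is the Fisher–Rao distance). Consider the problem $$\inf_{p_t,v_t}\Big\{4\int_0^1\mathcal E_{p_t}\big(\|v_t(x)\|^2_{P_t^{-1}}\big)\,dt\ :\ \dot p_t+\nabla_x\cdot(p_tv_t)=0\Big\},\qquad P_t=\mathcal E_{p_t}(xx'),\quad \|y\|_W^2=y'Wy,$$ over all pairs such that: $(p_t)_{t\in[0,1]}$ is a jointly (Lebesgue)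 measurable, narrowly continuous family of probability densities on $\mathbb R^n$ with $\int_0^1\mathcal E_{p_t}(\|x\|^2)\,dt<\infty$, with $p_0=g_{P_0}$ and $p_1=g_{P_1}$ almost everywhere; $v_t(x)$ is a (Lebesgue) measurable velocity field on $[0,1]\times\mathbb R^n$ with $p_tv_t$ integrable on compact subsets of $[0,1]\times\mathbb R^n$; and the continuity equation holds on $(0,1)\times\mathbb R^n$ in the sense of distributions. The cost may be $+\infty$. Then the pair $p_t=g_{P_t^{\rm info}}$, $v_t(x)=A^{\rm info}x$ is a minimizer. It is the only one: for every minimizer $(p_t,v_t)$, $p_t=g_{P_t^{\rm info}}$ almost everywhere for every $t\in[0,1]$, that is, $p_t$ is the zero-mean Gaussian density with covariance $P_t^{\rm info}$, and, for almost every $t\in[0,1]$, $v_t(x)=A^{\rm info}x$ for $p_t$-almost every $x$. The optimal value is $d_{\rm info}(P_0,P_1)^2$. -/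

import Mathlib

open MeasureTheory Set
open scoped ENNReal Matrix ContDiff BoundedContinuousFunction

noncomputable section

namespace InfoOMT

/-- Euclidean space of dimension `n`. -/
abbrev Vec (n : ℕ) := EuclideanSpace ℝ (Fin n)

/-- Real square matrices of size `n`. -/
abbrev Mat (n : ℕ) := Matrix (Fin n) (Fin n) ℝ

/-- Real power `M ^ s` of a symmetric positive definite matrix (functional calculus). -/
def matPow {n : ℕ} (M : Mat n) (s : ℝ) : Mat n := cfc (fun x : ℝ => x ^ s) M

/-- Logarithm of a symmetric positive definite matrix (functional calculus). -/
def matLog {n : ℕ} (M : Mat n) : Mat n := cfc Real.log M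

/-- The Frobenius norm of a matrix. -/
def frobenius {n : ℕ} (M : Mat n) : ℝ := √(∑ i, ∑ j, M i j ^ 2)

/-- The quadratic form `y' W y`. -/
def weightedSq {n : ℕ} (W : Mat n) (y : Vec n) : ℝ := y.ofLp ⬝ᵥ (W *ᵥ y.ofLp)

/-- The linear vector field `x ↦ A x`. -/
def linField {n : ℕ} (A : Mat n) (x : Vec n) : Vec n := WithLp.toLp 2 (A *ᵥ x.ofLp)

/-- The matrix `P₀^(-1/2) P₁ P₀^(-1/2)`. -/
def relMat {n : ℕ} (P₀ P₁ : Mat n) : Mat n :=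
  matPow P₀ (-(1 / 2)) * P₁ * matPow P₀ (-(1 / 2))

/-- The Fisher-Rao geodesic `P₀^(1/2) (P₀^(-1/2) P₁ P₀^(-1/2))^t P₀^(1/2)`. -/
def pathInfo {n : ℕ} (P₀ P₁ : Mat n) (t : ℝ) : Mat n :=
  matPow P₀ (1 / 2) * matPow (relMat P₀ P₁) t * matPow P₀ (1 / 2)

/-- The matrix `(1/2) P₀^(1/2) log(P₀^(-1/2) P₁ P₀^(-1/2)) P₀^(-1/2)`. -/
def matAInfo {n : ℕ} (P₀ P₁ : Mat n) : Mat n :=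
  (1 / 2 : ℝ) • (matPow P₀ (1 / 2) * matLog (relMat P₀ P₁) * matPow P₀ (-(1 / 2)))

/-- The Fisher-Rao distance `‖log(P₀^(-1/2) P₁ P₀^(-1/2))‖_F`. -/
def distInfo {n : ℕ} (P₀ P₁ : Mat n) : ℝ := frobenius (matLog (relMat P₀ P₁))

/-- The zero-mean Gaussian density with covariance `P`,
`det(2πP)^(-1/2) exp(-(1/2) x' P⁻¹ x)`. -/
def gaussianDensity {n : ℕ} (P : Mat n) (x : Vec n) : ℝ :=
  ((2 * Real.pi) • P).det ^ (-(1 / 2) : ℝ) * Real.exp (-(1 / 2) * weightedSq P⁻¹ x)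

/-- `f` is a probability density on `ℝⁿ` with respect to Lebesgue measure. -/
structure IsProbDensity {n : ℕ} (f : Vec n → ℝ) : Prop where
  nonneg : ∀ x, 0 ≤ f x
  integrable : Integrable f
  integral_eq_one : ∫ x, f x = 1

/-- The probability law with density `f`. -/
def law {n : ℕ} (f : Vec n → ℝ) : Measure (Vec n) :=
  volume.withDensity fun x => ENNReal.ofReal (f x)

/-- The matrix `E_f(x x')` of second moments of the density `f`. -/
def secondMoment {n : ℕ} (f : Vec n → ℝ) : Mat n :=
  Matrix.of fun i j => ∫ x, x i * x j * f x

/-- Distributional form of `∂ₜ p + ∇ₓ · (p v) = 0` on `(0,1) × ℝⁿ`: the flux `p v` is locally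
integrable, and `∫∫ p (∂ₜ φ + ⟨∇ₓ φ, v⟩) dx dt = 0` for all smooth `φ` with compact support in
`(0,1) × ℝⁿ`.  The derivative of `φ` at `(t, x)` in the direction `(1, v)` is
`∂ₜ φ + ⟨∇ₓ φ, v⟩`. -/
structure ContinuityEquation {n : ℕ} (p : ℝ → Vec n → ℝ) (v : ℝ → Vec n → Vec n) : Prop where
  locallyIntegrable : ∀ K : Set (ℝ × Vec n), IsCompact K → K ⊆ Icc 0 1 ×ˢ univ →
    IntegrableOn (fun z => p z.1 z.2 * ‖v z.1 z.2‖) K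
  weak : ∀ φ : ℝ × Vec n → ℝ, ContDiff ℝ ∞ φ → HasCompactSupport φ →
    tsupport φ ⊆ Ioo 0 1 ×ˢ univ →
    ∫ z in Icc (0 : ℝ) 1 ×ˢ (univ : Set (Vec n)),
      p z.1 z.2 * fderiv ℝ φ z (1, v z.1 z.2) = 0

/-- Feasible pairs of the transport problem: a narrowly continuous path of probability densities
on `[0,1]`, with time-integrable second moment, that joins the zero-mean Gaussian densities with
covariances `P₀` and `P₁`, and a measurable velocity field, related by the continuity equation.
Nothing outside the time interval `[0,1]` matters. -/
structure Feasible {n : ℕ} (P₀ P₁ : Mat n) (p : ℝ → Vec n → ℝ) (v : ℝ → Vec n → Vec n) :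
    Prop where
  density : ∀ t ∈ Icc (0 : ℝ) 1, IsProbDensity (p t)
  aemeasurable_density : AEMeasurable (fun z : ℝ × Vec n => p z.1 z.2)
    (volume.restrict (Icc (0 : ℝ) 1 ×ˢ (univ : Set (Vec n))))
  aemeasurable_velocity : AEMeasurable (fun z : ℝ × Vec n => v z.1 z.2)
    (volume.restrict (Icc (0 : ℝ) 1 ×ˢ (univ : Set (Vec n))))
  narrow : ∀ f : Vec n →ᵇ ℝ, ContinuousOn (fun t => ∫ x, f x * p t x) (Icc 0 1)
  secondMoment_integrable : IntegrableOn (fun z : ℝ × Vec n => ‖z.2‖ ^ 2 * p z.1 z.2)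
    (Icc (0 : ℝ) 1 ×ˢ (univ : Set (Vec n)))
  initial : p 0 =ᵐ[volume] gaussianDensity P₀
  final : p 1 =ᵐ[volume] gaussianDensity P₁
  continuity : ContinuityEquation p v

/-- The cost `4 ∫₀¹ E_{p_t} ‖v_t(x)‖²_{P_t⁻¹} dt`, with `P_t` the second-moment matrix of `p_t`,
as an element of `[0, ∞]`. -/
def cost {n : ℕ} (p : ℝ → Vec n → ℝ) (v : ℝ → Vec n → Vec n) : ℝ≥0∞ :=
  4 * ∫⁻ t in Icc (0 : ℝ) 1, ∫⁻ x,
    ENNReal.ofReal (weightedSq (secondMoment (p t))⁻¹ (v t x)) ∂(law (p t))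

/-- The optimal value of the weighted mass-transport problem. -/
def optimalValue {n : ℕ} (P₀ P₁ : Mat n) : ℝ≥0∞ :=
  sInf {c | ∃ p v, Feasible P₀ P₁ p v ∧ cost p v = c}

/-- `(p, v)` is a minimizer of the weighted mass-transport problem. -/
def IsMinimizer {n : ℕ} (P₀ P₁ : Mat n) (p : ℝ → Vec n → ℝ) (v : ℝ → Vec n → Vec n) : Prop :=
  Feasible P₀ P₁ p v ∧ ∀ q w, Feasible P₀ P₁ q w → cost p v ≤ cost q w

end InfoOMT

end

noncomputable section

namespace InfoOMT

variable {n : ℕ}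

/-! ### Functional calculus and simultaneous diagonalisation -/

/-! The proof is a calibration argument on the cone of covariance matrices. If `P` is the
second-moment matrix of a feasible path with velocity `v`, then `P' = E(v x' + x v')`, and
completing the square with a symmetric matrix `G` gives `E ‖v‖² = E ‖v - (1/2) P G x‖² + (1/2) tr (G
P') - (1/4) tr (G P G P)`, with all norms taken in the weight `P⁻¹` (`RegularAt.energy_eq`). The
bound is sharp if `G` is the gradient of a function whose gradient has constant Fisher-Rao norm:
then `tr (G P')` integrates to a boundary term and `tr (G P G P)` is constant.

Such a function is obtained in a frame where `P₀` becomes the identity and `P₁` becomes `diag (exp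
l)` (`exists_geodesicFrame`). It is `∑ i, l i * log d i`, where `d i` is the quotient of consecutive
leading minors, i.e. the Cholesky diagonal. Its gradient is a combination of inverses of leading
blocks; multiplied by the matrix these are projections onto a flag of coordinate subspaces, so the
squared gradient norm is `∑ i, l i ^ 2` everywhere (`trace_cholGrad_sq`). The boundary term is also
`L = ∑ i, l i ^ 2`, the squared distance. Hence the cost is `2 L - L = L` plus four times the
integral of a nonnegative defect (`Feasible.cost_eq`). No Gaussianity of the path is needed.

For a minimizer the defect vanishes, so `v = (1/2) P G x` and, in the frame, `Q' = Q G(Q) Q`. Along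
this flow the flag of projections is frozen, hence `G(Q) Q = diag l` and `v` is the linear field of
the geodesic (`cholGrad_mul_eq_diagonal`, `Feasible.velocity_eq`). Testing the continuity equation
with functions carried along by the linear flow then identifies the density as the transported
Gaussian (`Feasible.density_eq`).

The analytic work lies in showing that finite cost forces bounded second moments
(`Feasible.exists_moment_bound`) and that these moments are absolutely continuous with the expected
derivative (`Feasible.secondMoment_sub`). -/

theorem exists_spectral {M : Mat n} (hM : M.PosDef) :
    ∃ (U : Mat n) (d : Fin n → ℝ), U * Uᵀ = 1 ∧ Uᵀ * U = 1 ∧ (∀ i, 0 < d i) ∧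
      ∀ f : ℝ → ℝ, cfc f M = U * Matrix.diagonal (fun i => f (d i)) * Uᵀ := by
  have hU : (hM.isHermitian.eigenvectorUnitary : Mat n)ᵀ
      = star (hM.isHermitian.eigenvectorUnitary : Mat n) := by
    rw [Matrix.star_eq_conjTranspose, Matrix.conjTranspose_eq_transpose_of_trivial]
  refine ⟨hM.isHermitian.eigenvectorUnitary, hM.isHermitian.eigenvalues, ?_, ?_,
    hM.eigenvalues_pos, fun f => ?_⟩
  · rw [hU]; exact Unitary.coe_mul_star_self _
  · rw [hU]; exact Unitary.coe_star_mul_self _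
  · rw [hM.isHermitian.cfc_eq, Matrix.IsHermitian.cfc, Unitary.conjStarAlgAut_apply, hU]
    rfl

theorem matPow_one {M : Mat n} (hM : M.PosDef) : matPow M 1 = M := by
  simp only [matPow, Real.rpow_one]
  exact cfc_id' ℝ M hM.isHermitian

theorem matPow_zero {M : Mat n} (hM : M.PosDef) : matPow M 0 = 1 := by
  simp only [matPow, Real.rpow_zero]
  exact cfc_const_one ℝ M hM.isHermitian

theorem conj_diagonal_mul {U V : Mat n} (h : V * U = 1) (d e : Fin n → ℝ) :
    U * Matrix.diagonal d * V * (U * Matrix.diagonal e * V)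
      = U * Matrix.diagonal (fun i => d i * e i) * V := by
  calc _ = U * Matrix.diagonal d * (V * U) * Matrix.diagonal e * V := by
        simp only [Matrix.mul_assoc]
    _ = U * (Matrix.diagonal d * Matrix.diagonal e) * V := by
        rw [h, Matrix.mul_one]; simp only [Matrix.mul_assoc]
    _ = _ := by rw [Matrix.diagonal_mul_diagonal]

theorem matPow_mul {M : Mat n} (hM : M.PosDef) (s t : ℝ) :
    matPow M s * matPow M t = matPow M (s + t) := by
  obtain ⟨U, d, -, h2, hd, hf⟩ := exists_spectral hM
  simp only [matPow, hf]
  rw [conj_diagonal_mul h2]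
  simp only [Real.rpow_add (hd _)]

theorem matPow_transpose {M : Mat n} (hM : M.PosDef) (s : ℝ) : (matPow M s)ᵀ = matPow M s := by
  obtain ⟨U, d, -, h2, hd, hf⟩ := exists_spectral hM
  simp only [matPow, hf, Matrix.transpose_mul, Matrix.transpose_transpose,
    Matrix.diagonal_transpose, Matrix.mul_assoc]

theorem relMat_posDef {P₀ P₁ : Mat n} (h₀ : P₀.PosDef) (h₁ : P₁.PosDef) :
    (relMat P₀ P₁).PosDef := by
  have hinv : matPow P₀ (-(1 / 2)) * matPow P₀ (1 / 2) = 1 := by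
    rw [matPow_mul h₀, neg_add_cancel, matPow_zero h₀]
  have hu : IsUnit (matPow P₀ (-(1 / 2))) := by
    rw [Matrix.isUnit_iff_isUnit_det]
    exact IsUnit.of_mul_eq_one (matPow P₀ (1 / 2)).det (by rw [← Matrix.det_mul, hinv, Matrix.det_one])
  have := (Matrix.IsUnit.posDef_star_right_conjugate_iff hu (x := P₁)).2 h₁
  rwa [Matrix.star_eq_conjTranspose, Matrix.conjTranspose_eq_transpose_of_trivial,
    matPow_transpose h₀] at this

theorem frobenius_conj_diagonal_sq {U : Mat n} (h : Uᵀ * U = 1) (d : Fin n → ℝ) :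
    frobenius (U * Matrix.diagonal d * Uᵀ) ^ 2 = ∑ i, d i ^ 2 := by
  have key : ∀ M : Mat n, frobenius M ^ 2 = (M * Mᵀ).trace := by
    intro M
    rw [frobenius, Real.sq_sqrt (by positivity)]
    simp [Matrix.trace, Matrix.mul_apply, sq]
  rw [key]
  have : (U * Matrix.diagonal d * Uᵀ)ᵀ = U * Matrix.diagonal d * Uᵀ := by
    simp [Matrix.mul_assoc]
  rw [this, conj_diagonal_mul h, Matrix.mul_assoc, Matrix.trace_mul_comm, Matrix.mul_assoc, h]
  simp [Matrix.trace, sq]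

/-- A frame in which `P₀` is the identity and `P₁` is diagonal; the geodesic between them is then
diagonal as well. -/
structure GeodesicFrame (P₀ P₁ T S : Mat n) (l : Fin n → ℝ) : Prop where
  mul_eq_one : T * S = 1
  mul_eq_one' : S * T = 1
  left : T * P₀ * Tᵀ = 1
  right : T * P₁ * Tᵀ = Matrix.diagonal fun i => Real.exp (l i)
  path : ∀ t, pathInfo P₀ P₁ t = S * Matrix.diagonal (fun i => Real.exp (t * l i)) * Sᵀ
  field : matAInfo P₀ P₁ = (1 / 2 : ℝ) • (S * Matrix.diagonal l * T)
  dist : distInfo P₀ P₁ ^ 2 = ∑ i, l i ^ 2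

theorem exists_geodesicFrame {P₀ P₁ : Mat n} (h₀ : P₀.PosDef) (h₁ : P₁.PosDef) :
    ∃ T S l, GeodesicFrame P₀ P₁ T S l := by
  have hrel := relMat_posDef h₀ h₁
  obtain ⟨U, d, hU, hU', hd, hf⟩ := exists_spectral hrel
  set A := matPow P₀ (1 / 2) with hA
  set B := matPow P₀ (-(1 / 2)) with hB
  have hAB : A * B = 1 := by rw [hA, hB, matPow_mul h₀, add_neg_cancel, matPow_zero h₀]
  have hBA : B * A = 1 := by rw [hA, hB, matPow_mul h₀, neg_add_cancel, matPow_zero h₀]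
  have hAA : A * A = P₀ := by
    rw [hA, matPow_mul h₀, add_halves, matPow_one h₀]
  have hAt : Aᵀ = A := matPow_transpose h₀ _
  have hBt : Bᵀ = B := matPow_transpose h₀ _
  have hR : relMat P₀ P₁ = U * Matrix.diagonal d * Uᵀ := by
    have := hf fun x => x
    exact (cfc_id' ℝ _ hrel.isHermitian).symm.trans this
  have hR' : B * P₁ * B = U * Matrix.diagonal d * Uᵀ := hR
  -- `B` whitens `P₀`, and `Uᵀ` then rotates to the eigenbasis of the relative matrix; `l` collects
  -- the logarithms of its eigenvalues.
  refine ⟨Uᵀ * B, A * U, fun i => Real.log (d i), ?_, ?_, ?_, ?_, ?_, ?_, ?_⟩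
  · rw [Matrix.mul_assoc, ← Matrix.mul_assoc B, hBA, Matrix.one_mul, hU']
  · rw [Matrix.mul_assoc, ← Matrix.mul_assoc U, hU, Matrix.one_mul, hAB]
  · rw [Matrix.transpose_mul, Matrix.transpose_transpose, hBt, ← hAA]
    calc Uᵀ * B * (A * A) * (B * U) = Uᵀ * (B * A) * (A * B) * U := by
          simp only [Matrix.mul_assoc]
      _ = 1 := by rw [hBA, hAB, Matrix.mul_one, Matrix.mul_one, hU']
  · rw [Matrix.transpose_mul, Matrix.transpose_transpose, hBt]
    calc Uᵀ * B * P₁ * (B * U) = Uᵀ * (B * P₁ * B) * U := by simp only [Matrix.mul_assoc]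
      _ = Uᵀ * U * Matrix.diagonal d * (Uᵀ * U) := by
          rw [hR']; simp only [Matrix.mul_assoc]
      _ = _ := by
          rw [hU', Matrix.one_mul, Matrix.mul_one]
          simp only [Real.exp_log (hd _)]
  · intro t
    rw [pathInfo, ← hA]
    simp only [matPow, hf]
    rw [Matrix.transpose_mul, hAt]
    simp only [Real.rpow_def_of_pos (hd _), Matrix.mul_assoc, mul_comm]
  · rw [matAInfo, ← hA, ← hB]
    simp only [matLog, hf, Matrix.mul_assoc]
  · rw [distInfo, matLog, hf, frobenius_conj_diagonal_sq hU']

/-! ### Inverses of leading principal minors -/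

/-- The coordinate projection onto the first `k` coordinates. -/
def minorProj (n k : ℕ) : Mat n := Matrix.diagonal fun i => if i.val < k then 1 else 0

/-- The leading `k × k` block of `Q`, completed by the identity. -/
def minorReg (Q : Mat n) (k : ℕ) : Mat n :=
  minorProj n k * Q * minorProj n k + (1 - minorProj n k)

/-- The inverse of the leading `k × k` block of `Q`, extended by zero. -/
def minorInv (Q : Mat n) (k : ℕ) : Mat n :=
  minorProj n k * (minorReg Q k)⁻¹ * minorProj n k

theorem minorProj_mul {k m : ℕ} (h : k ≤ m) : minorProj n k * minorProj n m = minorProj n k := by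
  rw [minorProj, minorProj, Matrix.diagonal_mul_diagonal]
  congr 1
  ext i
  split_ifs <;> first | omega | simp

theorem minorProj_mul' {k m : ℕ} (h : k ≤ m) : minorProj n m * minorProj n k = minorProj n k := by
  rw [minorProj, minorProj, Matrix.diagonal_mul_diagonal]
  congr 1
  ext i
  split_ifs <;> first | omega | simp

theorem minorProj_transpose (k : ℕ) : (minorProj n k)ᵀ = minorProj n k := by
  simp [minorProj]

/-- Both summands are positive semidefinite. A vector on which both forms vanish has zero first `k`
coordinates because `Q` is definite, and zero remaining ones because of the identity block. -/
theorem minorReg_posDef {Q : Mat n} (hQ : Q.PosDef) (k : ℕ) : (minorReg Q k).PosDef := by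
  have hD : (minorProj n k)ᴴ = minorProj n k := by
    rw [Matrix.conjTranspose_eq_transpose_of_trivial, minorProj_transpose]
  have h1 : (minorProj n k * Q * minorProj n k).PosSemidef := by
    have := hQ.posSemidef.conjTranspose_mul_mul_same (minorProj n k)
    rwa [hD] at this
  have hE : (1 - minorProj n k) = Matrix.diagonal fun i => if i.val < k then (0 : ℝ) else 1 := by
    rw [minorProj, ← Matrix.diagonal_one, Matrix.diagonal_sub]
    congr 1
    ext i
    split_ifs <;> simp
  have h2 : (1 - minorProj n k).PosSemidef := by
    rw [hE, Matrix.posSemidef_diagonal_iff]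
    intro i
    split_ifs <;> simp
  refine Matrix.PosDef.of_dotProduct_mulVec_pos (h1.isHermitian.add h2.isHermitian) fun x hx => ?_
  rw [minorReg, Matrix.add_mulVec, dotProduct_add]
  have a1 := h1.dotProduct_mulVec_nonneg x
  have a2 := h2.dotProduct_mulVec_nonneg x
  refine lt_of_le_of_ne (add_nonneg a1 a2) fun h0 => hx ?_
  have z1 : star x ⬝ᵥ (minorProj n k * Q * minorProj n k) *ᵥ x = 0 := by linarith
  have z2 : star x ⬝ᵥ (1 - minorProj n k) *ᵥ x = 0 := by linarith
  have y1 : minorProj n k *ᵥ x = 0 := by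
    by_contra hne
    have := hQ.dotProduct_mulVec_pos hne
    have e : star (minorProj n k *ᵥ x) ⬝ᵥ Q *ᵥ (minorProj n k *ᵥ x)
        = star x ⬝ᵥ (minorProj n k * Q * minorProj n k) *ᵥ x := by
      rw [Matrix.star_mulVec, hD, ← Matrix.dotProduct_mulVec, Matrix.mulVec_mulVec,
        Matrix.mulVec_mulVec, Matrix.mul_assoc]
    rw [e, z1] at this
    exact lt_irrefl _ this
  rw [hE] at z2
  ext i
  by_cases hi : i.val < k
  · have := congrFun y1 i
    simpa [minorProj, Matrix.mulVec_diagonal, hi] using this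
  · simp only [dotProduct, Matrix.mulVec_diagonal, Pi.star_apply, star_trivial] at z2
    have := (Finset.sum_eq_zero_iff_of_nonneg (fun j _ => by
      split_ifs <;> simp [mul_self_nonneg])).1 z2 i (Finset.mem_univ _)
    simpa [hi] using this

theorem minorReg_mul_inv {Q : Mat n} (hQ : Q.PosDef) (k : ℕ) :
    minorReg Q k * (minorReg Q k)⁻¹ = 1 :=
  Matrix.mul_nonsing_inv _ ((Matrix.isUnit_iff_isUnit_det _).1 (minorReg_posDef hQ k).isUnit)

theorem minorReg_inv_mul {Q : Mat n} (hQ : Q.PosDef) (k : ℕ) :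
    (minorReg Q k)⁻¹ * minorReg Q k = 1 :=
  Matrix.nonsing_inv_mul _ ((Matrix.isUnit_iff_isUnit_det _).1 (minorReg_posDef hQ k).isUnit)

theorem minorProj_idem (k : ℕ) : minorProj n k * minorProj n k = minorProj n k :=
  minorProj_mul le_rfl

theorem minorReg_mul_minorProj (Q : Mat n) (k : ℕ) :
    minorReg Q k * minorProj n k = minorProj n k * Q * minorProj n k := by
  rw [minorReg, Matrix.add_mul, Matrix.sub_mul, Matrix.one_mul, minorProj_idem, sub_self, add_zero,
    Matrix.mul_assoc, minorProj_idem]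

theorem minorProj_mul_minorReg (Q : Mat n) (k : ℕ) :
    minorProj n k * minorReg Q k = minorProj n k * Q * minorProj n k := by
  rw [minorReg, Matrix.mul_add, Matrix.mul_sub, Matrix.mul_one, minorProj_idem, sub_self, add_zero,
    ← Matrix.mul_assoc, ← Matrix.mul_assoc, minorProj_idem]

theorem minorInv_transpose {Q : Mat n} (hQ : Q.PosDef) (k : ℕ) :
    (minorInv Q k)ᵀ = minorInv Q k := by
  have : (minorReg Q k)ᵀ = minorReg Q k := by
    have := (minorReg_posDef hQ k).isHermitian.eq
    rwa [Matrix.conjTranspose_eq_transpose_of_trivial] at this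
  rw [minorInv, Matrix.transpose_mul, Matrix.transpose_mul, minorProj_transpose,
    Matrix.transpose_nonsing_inv, this, Matrix.mul_assoc]

theorem minorProj_mul_minorInv (Q : Mat n) {k m : ℕ} (h : m ≤ k) :
    minorProj n k * minorInv Q m = minorInv Q m := by
  rw [minorInv, ← Matrix.mul_assoc, ← Matrix.mul_assoc, minorProj_mul' h]

theorem minorInv_mul_minorProj (Q : Mat n) {k m : ℕ} (h : m ≤ k) :
    minorInv Q m * minorProj n k = minorInv Q m := by
  rw [minorInv, Matrix.mul_assoc, minorProj_mul h]

theorem minorInv_mul_mul_minorProj {Q : Mat n} (hQ : Q.PosDef) (k : ℕ) :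
    minorInv Q k * Q * minorProj n k = minorProj n k := by
  calc minorInv Q k * Q * minorProj n k
      = minorProj n k * (minorReg Q k)⁻¹ * (minorProj n k * Q * minorProj n k) := by
        simp only [minorInv, Matrix.mul_assoc]
    _ = minorProj n k * ((minorReg Q k)⁻¹ * minorReg Q k) * minorProj n k := by
        rw [← minorReg_mul_minorProj]; simp only [Matrix.mul_assoc]
    _ = _ := by rw [minorReg_inv_mul hQ, Matrix.mul_one, minorProj_idem]

theorem minorProj_mul_mul_minorInv {Q : Mat n} (hQ : Q.PosDef) (k : ℕ) :
    minorProj n k * Q * minorInv Q k = minorProj n k := by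
  calc minorProj n k * Q * minorInv Q k
      = (minorProj n k * Q * minorProj n k) * ((minorReg Q k)⁻¹ * minorProj n k) := by
        simp only [minorInv, Matrix.mul_assoc]
    _ = minorProj n k * (minorReg Q k * (minorReg Q k)⁻¹) * minorProj n k := by
        rw [← minorProj_mul_minorReg]; simp only [Matrix.mul_assoc]
    _ = _ := by rw [minorReg_mul_inv hQ, Matrix.mul_one, minorProj_idem]

/-- `minorInv Q k * Q` is a projection onto the span of the first `k` basis vectors. These ranges
form a flag, and the product of two of the projections is the smaller one. -/
theorem minorInv_mul_mul_minorInv {Q : Mat n} (hQ : Q.PosDef) (k m : ℕ) :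
    minorInv Q k * Q * minorInv Q m = minorInv Q (min k m) := by
  rcases le_total k m with h | h
  · rw [min_eq_left h]
    calc minorInv Q k * Q * minorInv Q m
        = minorInv Q k * (minorProj n m * Q * minorInv Q m) := by
          rw [← Matrix.mul_assoc, ← Matrix.mul_assoc, minorInv_mul_minorProj Q h]
      _ = _ := by rw [minorProj_mul_mul_minorInv hQ, minorInv_mul_minorProj Q h]
  · rw [min_eq_right h]
    calc minorInv Q k * Q * minorInv Q m
        = minorInv Q k * Q * minorProj n k * minorInv Q m := by
          rw [Matrix.mul_assoc _ (minorProj n k), minorProj_mul_minorInv Q h]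
      _ = _ := by rw [minorInv_mul_mul_minorProj hQ, minorProj_mul_minorInv Q h]

theorem trace_minorProj {k : ℕ} (h : k ≤ n) : (minorProj n k).trace = k := by
  rw [minorProj, Matrix.trace_diagonal, Finset.sum_boole]
  congr 1
  have : (Finset.univ.filter fun i : Fin n => i.val < k)
      = (Finset.univ : Finset (Fin k)).map (Fin.castLEEmb h) := by
    ext i
    simp only [Finset.mem_filter, Finset.mem_univ, true_and, Finset.mem_map]
    constructor
    · intro hi; exact ⟨⟨i.val, hi⟩, by ext; simp⟩
    · rintro ⟨j, rfl⟩; simp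
  rw [this]; simp

theorem trace_minorInv_mul {Q : Mat n} (hQ : Q.PosDef) {k : ℕ} (h : k ≤ n) :
    (minorInv Q k * Q).trace = k := by
  rw [← trace_minorProj h, ← minorInv_mul_mul_minorProj hQ k, Matrix.trace_mul_comm _ (minorProj n k),
    ← Matrix.mul_assoc, minorProj_mul_minorInv Q le_rfl]

/-- The gradient of `Q ↦ ∑ i, l i * log (d i)`, where `d` is the diagonal of the Cholesky
decomposition of `Q`. -/
def cholGrad (l : Fin n → ℝ) (Q : Mat n) : Mat n :=
  ∑ i : Fin n, l i • (minorInv Q (i.val + 1) - minorInv Q i.val)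

theorem cholGrad_transpose {Q : Mat n} (hQ : Q.PosDef) (l : Fin n → ℝ) :
    (cholGrad l Q)ᵀ = cholGrad l Q := by
  simp [cholGrad, Matrix.transpose_sum, minorInv_transpose hQ]

/-- Consecutive differences of the flag projections are idempotents of trace one that annihilate
each other, so only the diagonal terms survive. The value does not depend on `Q`: this is the
constant gradient norm behind the calibration. -/
theorem trace_cholGrad_sq {Q : Mat n} (hQ : Q.PosDef) (l : Fin n → ℝ) :
    (cholGrad l Q * Q * (cholGrad l Q * Q)).trace = ∑ i, l i ^ 2 := by
  have hH : ∀ i j : Fin n, ((minorInv Q (i.val + 1) - minorInv Q i.val) * Q *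
      ((minorInv Q (j.val + 1) - minorInv Q j.val) * Q)).trace = if i = j then 1 else 0 := by
    intro i j
    rw [← Matrix.mul_assoc]
    simp only [Matrix.sub_mul, Matrix.mul_sub, minorInv_mul_mul_minorInv hQ]
    rcases lt_trichotomy i j with h | h | h
    · have h' : i.val < j.val := h
      rw [min_eq_left (by omega), min_eq_left (by omega), min_eq_left (by omega),
        min_eq_left (by omega)]
      simp [h.ne]
    · subst h
      rw [min_eq_left (by omega), min_eq_left (by omega), min_eq_right (by omega),
        min_eq_left (by omega)]
      simp only [Matrix.trace_sub]
      rw [trace_minorInv_mul hQ (by omega), trace_minorInv_mul hQ (by omega)]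
      simp
    · have h' : j.val < i.val := h
      rw [min_eq_right (by omega), min_eq_right (by omega), min_eq_right (by omega),
        min_eq_right (by omega)]
      simp [h.ne']
  simp only [cholGrad, Finset.sum_mul, Finset.mul_sum, Matrix.trace_sum, Matrix.smul_mul,
    Matrix.mul_smul, Matrix.trace_smul, hH]
  simp [sq]

/-- The velocity of the leading blocks along `Q' = Q * G * Q` preserves `minorInv Q k * Q`. -/
theorem minorInv_mul_cholGrad {Q : Mat n} (hQ : Q.PosDef) (l : Fin n → ℝ) (k : ℕ) :
    minorInv Q k * (Q * cholGrad l Q * Q) * minorInv Q k * Q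
      = minorInv Q k * (Q * cholGrad l Q * Q) := by
  -- The flag relation: `min (min k m) k = min k m`, so the last projection acts trivially.
  have h : ∀ m, minorInv Q k * Q * minorInv Q m * Q * minorInv Q k
      = minorInv Q k * Q * minorInv Q m := by
    intro m
    rw [minorInv_mul_mul_minorInv hQ, minorInv_mul_mul_minorInv hQ]
    congr 1; omega
  have : minorInv Q k * Q * cholGrad l Q * Q * minorInv Q k
      = minorInv Q k * Q * cholGrad l Q := by
    simp only [cholGrad, Finset.mul_sum, Finset.sum_mul, Matrix.mul_smul, Matrix.smul_mul,
      Matrix.mul_sub, Matrix.sub_mul, h]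
  simp only [← Matrix.mul_assoc]
  rw [this]

theorem sum_smul_minorProj (l : Fin n → ℝ) :
    ∑ i : Fin n, l i • (minorProj n (i.val + 1) - minorProj n i.val) = Matrix.diagonal l := by
  ext a b
  simp only [Matrix.sum_apply, Matrix.smul_apply, Matrix.sub_apply, minorProj,
    Matrix.diagonal_apply, smul_eq_mul]
  split_ifs with hab
  · rw [Finset.sum_eq_single a]
    · simp
    · intro i _ hi
      have : a.val ≠ i.val := fun h => hi (Fin.ext h.symm)
      have e : (a.val < i.val + 1) ↔ a.val < i.val := by omega
      simp [e]
    · simp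
  · simp

theorem minorReg_diagonal (d : Fin n → ℝ) (k : ℕ) :
    minorReg (Matrix.diagonal d) k
      = Matrix.diagonal fun i : Fin n => if i.val < k then d i else 1 := by
  rw [minorReg, minorProj, Matrix.diagonal_mul_diagonal, Matrix.diagonal_mul_diagonal,
    ← Matrix.diagonal_one, Matrix.diagonal_sub, Matrix.diagonal_add]
  congr 1
  ext i
  split_ifs <;> simp

theorem minorInv_one (k : ℕ) : minorInv (1 : Mat n) k = minorProj n k := by
  have : minorReg (1 : Mat n) k = 1 := by
    rw [← Matrix.diagonal_one, minorReg_diagonal]; simp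
  rw [minorInv, this, inv_one, Matrix.mul_one, minorProj_idem]

/-! ### Absolutely continuous matrix paths -/

theorem absolutelyContinuousOnInterval_const (c a b : ℝ) :
    AbsolutelyContinuousOnInterval (fun _ : ℝ => c) a b :=
  (LipschitzWith.const c).lipschitzOnWith.absolutelyContinuousOnInterval

theorem _root_.AbsolutelyContinuousOnInterval.lipschitzOnWith_comp {f g : ℝ → ℝ} {a b : ℝ}
    {K : NNReal} (hf : AbsolutelyContinuousOnInterval f a b)
    (hg : LipschitzOnWith K g (f '' uIcc a b)) :
    AbsolutelyContinuousOnInterval (fun t => g (f t)) a b := by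
  rw [absolutelyContinuousOnInterval_iff] at hf ⊢
  intro ε hε
  -- Dividing by `K + 1` covers `K = 0` and yields a strict inequality at the end.
  obtain ⟨δ, hδ, h⟩ := hf (ε / (K + 1)) (by positivity)
  refine ⟨δ, hδ, fun E hE hlt => ?_⟩
  have h1 := h E hE hlt
  calc ∑ i ∈ Finset.range E.1, dist (g (f (E.2 i).1)) (g (f (E.2 i).2))
      ≤ ∑ i ∈ Finset.range E.1, K * dist (f (E.2 i).1) (f (E.2 i).2) := by
        refine Finset.sum_le_sum fun i hi => hg.dist_le_mul _ ?_ _ ?_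
        · exact mem_image_of_mem _ (hE.1 i hi).1
        · exact mem_image_of_mem _ (hE.1 i hi).2
    _ = K * ∑ i ∈ Finset.range E.1, dist (f (E.2 i).1) (f (E.2 i).2) := by rw [Finset.mul_sum]
    _ ≤ K * (ε / (K + 1)) := by gcongr
    _ < (K + 1) * (ε / (K + 1)) := by gcongr; linarith
    _ = ε := by field_simp

theorem absolutelyContinuousOnInterval_sum {ι : Type*} (s : Finset ι) {f : ι → ℝ → ℝ} {a b : ℝ}
    (hf : ∀ i ∈ s, AbsolutelyContinuousOnInterval (f i) a b) :
    AbsolutelyContinuousOnInterval (fun t => ∑ i ∈ s, f i t) a b := by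
  classical
  induction s using Finset.induction_on with
  | empty => simpa using absolutelyContinuousOnInterval_const 0 a b
  | insert i s hi ih =>
    simp only [Finset.sum_insert hi]
    exact (hf i (Finset.mem_insert_self i s)).fun_add
      (ih fun j hj => hf j (Finset.mem_insert_of_mem hj))

theorem absolutelyContinuousOnInterval_prod {ι : Type*} (s : Finset ι) {f : ι → ℝ → ℝ} {a b : ℝ}
    (hf : ∀ i ∈ s, AbsolutelyContinuousOnInterval (f i) a b) :
    AbsolutelyContinuousOnInterval (fun t => ∏ i ∈ s, f i t) a b := by
  classical
  induction s using Finset.induction_on with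
  | empty => simpa using absolutelyContinuousOnInterval_const 1 a b
  | insert i s hi ih =>
    simp only [Finset.prod_insert hi]
    exact (hf i (Finset.mem_insert_self i s)).fun_mul
      (ih fun j hj => hf j (Finset.mem_insert_of_mem hj))

theorem absolutelyContinuousOnInterval_det {R : ℝ → Mat n} {a b : ℝ}
    (hR : ∀ i j, AbsolutelyContinuousOnInterval (fun t => R t i j) a b) :
    AbsolutelyContinuousOnInterval (fun t => (R t).det) a b := by
  simp only [Matrix.det_apply']
  exact absolutelyContinuousOnInterval_sum _ fun σ _ =>
    (absolutelyContinuousOnInterval_prod _ fun i _ => hR _ _).const_mul _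

/-- Jacobi's formula. -/
theorem hasDerivAt_det {R : ℝ → Mat n} {R' : Mat n} {t : ℝ}
    (hR : ∀ i j, HasDerivAt (fun s => R s i j) (R' i j) t) :
    HasDerivAt (fun s => (R s).det) ((R t).adjugate * R').trace t := by
  have h : HasDerivAt (fun s => (R s).det)
      (∑ σ : Equiv.Perm (Fin n), ((Equiv.Perm.sign σ : ℤ) : ℝ) *
        ∑ i, (∏ j ∈ Finset.univ.erase i, R t (σ j) j) • R' (σ i) i) t := by
    simp only [Matrix.det_apply']
    refine HasDerivAt.fun_sum fun σ _ => HasDerivAt.const_mul _ ?_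
    exact HasDerivAt.fun_finsetProd fun i _ => hR _ _
  convert! h using 1
  have e : ∀ i, ((R t).adjugate * R') i i = ((R t).updateCol i (fun k => R' k i)).det := by
    intro i
    rw [← Matrix.cramer_apply, Matrix.cramer_eq_adjugate_mulVec]
    rfl
  simp only [Matrix.trace, Matrix.diag_apply, e, Matrix.det_apply', Finset.mul_sum]
  rw [Finset.sum_comm]
  refine Finset.sum_congr rfl fun σ _ => Finset.sum_congr rfl fun i _ => ?_
  congr 1
  rw [← Finset.prod_erase_mul _ _ (Finset.mem_univ i), Matrix.updateCol_self, smul_eq_mul]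
  congr 1
  refine Finset.prod_congr rfl fun j hj => ?_
  rw [Matrix.updateCol_ne (Finset.ne_of_mem_erase hj)]

theorem minorReg_apply (Q : Mat n) (k : ℕ) (i j : Fin n) :
    minorReg Q k i j = (if i.val < k then 1 else 0) * (if j.val < k then 1 else 0) * Q i j
      + (1 - minorProj n k) i j := by
  rw [minorReg, Matrix.add_apply, minorProj, Matrix.mul_diagonal, Matrix.diagonal_mul]
  ring

theorem absolutelyContinuousOnInterval_minorReg {Q : ℝ → Mat n} {a b : ℝ}
    (hQ : ∀ i j, AbsolutelyContinuousOnInterval (fun t => Q t i j) a b) (k : ℕ) (i j : Fin n) :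
    AbsolutelyContinuousOnInterval (fun t => minorReg (Q t) k i j) a b := by
  simp only [minorReg_apply]
  exact ((hQ i j).const_mul _).fun_add (absolutelyContinuousOnInterval_const _ _ _)

theorem hasDerivAt_minorReg {Q : ℝ → Mat n} {W : Mat n} {t : ℝ}
    (hQ : ∀ i j, HasDerivAt (fun s => Q s i j) (W i j) t) (k : ℕ) (i j : Fin n) :
    HasDerivAt (fun s => minorReg (Q s) k i j)
      ((minorProj n k * W * minorProj n k) i j) t := by
  simp only [minorReg_apply]
  convert! ((hQ i j).const_mul _).add_const ((1 - minorProj n k : Mat n) i j) using 1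
  rw [minorProj, Matrix.mul_diagonal, Matrix.diagonal_mul]
  ring

/-- Jacobi's formula divided by the determinant gives the trace of the inverse times the derivative.
The derivative carries a coordinate projection on each side; cyclicity moves both onto the inverse
and forms `minorInv`. -/
theorem hasDerivAt_log_det_minorReg {Q : ℝ → Mat n} {W : Mat n} {t : ℝ} (hpos : (Q t).PosDef)
    (hQ : ∀ i j, HasDerivAt (fun s => Q s i j) (W i j) t) (k : ℕ) :
    HasDerivAt (fun s => Real.log (minorReg (Q s) k).det) (minorInv (Q t) k * W).trace t := by
  have hdet := (minorReg_posDef hpos k).det_pos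
  convert! (hasDerivAt_det (hasDerivAt_minorReg hQ k)).log hdet.ne' using 1
  rw [minorInv, Matrix.inv_def, Ring.inverse_eq_inv']
  simp only [Matrix.mul_smul, Matrix.smul_mul, Matrix.trace_smul, smul_eq_mul]
  rw [div_eq_inv_mul]
  congr 1
  simp only [Matrix.mul_assoc]
  rw [Matrix.trace_mul_comm]
  simp only [Matrix.mul_assoc]

/-- On a compact interval the function stays above a positive minimum, and the logarithm is
Lipschitz there. -/
theorem absolutelyContinuousOnInterval_log {f : ℝ → ℝ} {a b : ℝ}
    (hf : AbsolutelyContinuousOnInterval f a b) (hpos : ∀ t ∈ uIcc a b, 0 < f t) :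
    AbsolutelyContinuousOnInterval (fun t => Real.log (f t)) a b := by
  obtain ⟨t₀, ht₀, hmin⟩ := isCompact_uIcc.exists_isMinOn nonempty_uIcc hf.continuousOn
  have hc := hpos t₀ ht₀
  refine hf.lipschitzOnWith_comp (K := (f t₀)⁻¹.toNNReal) ?_
  refine LipschitzOnWith.mono (α := ℝ) (β := ℝ) (t := Ici (f t₀)) ?_ ?_
  · refine Convex.lipschitzOnWith_of_nnnorm_deriv_le (fun x hx => ?_) (fun x hx => ?_)
      (convex_Ici _)
    · exact Real.differentiableAt_log (hc.trans_le hx).ne'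
    · rw [Real.deriv_log]
      have hx0 : 0 < x := hc.trans_le hx
      rw [← NNReal.coe_le_coe, coe_nnnorm, Real.norm_of_nonneg (by positivity),
        Real.coe_toNNReal _ (by positivity)]
      exact inv_anti₀ hc hx
  · rintro _ ⟨t, ht, rfl⟩
    exact hmin ht

/-- The calibration `Q ↦ ∑ i, l i * log (d i)`, `d` the Cholesky diagonal of `Q`. -/
def cholFun (l : Fin n → ℝ) (Q : Mat n) : ℝ :=
  ∑ i : Fin n, l i * (Real.log (minorReg Q (i.val + 1)).det - Real.log (minorReg Q i.val).det)

/-- Leading minors of a diagonal matrix are partial products, so the difference of consecutive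
logarithms isolates one entry. The cases `m = 0` and `m = l` give the boundary values of the
calibration. -/
theorem cholFun_diagonal_exp (l m : Fin n → ℝ) :
    cholFun l (Matrix.diagonal fun i => Real.exp (m i)) = ∑ i, l i * m i := by
  have h : ∀ k : ℕ, Real.log (minorReg (Matrix.diagonal fun i => Real.exp (m i)) k).det
      = ∑ i : Fin n, if i.val < k then m i else 0 := by
    intro k
    rw [minorReg_diagonal, Matrix.det_diagonal, Real.log_prod]
    · refine Finset.sum_congr rfl fun i _ => ?_
      split_ifs <;> simp
    · intro i _
      split_ifs <;> simp
  refine Finset.sum_congr rfl fun i _ => ?_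
  rw [h, h, ← Finset.sum_sub_distrib, Finset.sum_eq_single i]
  · simp
  · intro j _ hj
    have : j.val ≠ i.val := fun h => hj (Fin.ext h)
    have e : (j.val < i.val + 1) ↔ j.val < i.val := by omega
    simp [e]
  · simp

theorem hasDerivAt_cholFun {Q : ℝ → Mat n} {W : Mat n} {t : ℝ} (l : Fin n → ℝ)
    (hpos : (Q t).PosDef) (hQ : ∀ i j, HasDerivAt (fun s => Q s i j) (W i j) t) :
    HasDerivAt (fun s => cholFun l (Q s)) (cholGrad l (Q t) * W).trace t := by
  have : (cholGrad l (Q t) * W).trace = ∑ i : Fin n, l i *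
      ((minorInv (Q t) (i.val + 1) * W).trace - (minorInv (Q t) i.val * W).trace) := by
    simp [cholGrad, Finset.sum_mul, Matrix.trace_sum, Matrix.sub_mul, Matrix.trace_sub]
  rw [this]
  exact HasDerivAt.fun_sum fun i _ => ((hasDerivAt_log_det_minorReg hpos hQ _).sub
    (hasDerivAt_log_det_minorReg hpos hQ _)).const_mul _

theorem absolutelyContinuousOnInterval_cholFun {Q : ℝ → Mat n} {a b : ℝ} (l : Fin n → ℝ)
    (hpos : ∀ t ∈ uIcc a b, (Q t).PosDef)
    (hQ : ∀ i j, AbsolutelyContinuousOnInterval (fun t => Q t i j) a b) :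
    AbsolutelyContinuousOnInterval (fun t => cholFun l (Q t)) a b := by
  have h : ∀ k : ℕ,
      AbsolutelyContinuousOnInterval (fun t => Real.log (minorReg (Q t) k).det) a b := fun k =>
    absolutelyContinuousOnInterval_log
      (absolutelyContinuousOnInterval_det (absolutelyContinuousOnInterval_minorReg hQ k))
      fun t ht => (minorReg_posDef (hpos t ht) k).det_pos
  exact absolutelyContinuousOnInterval_sum _ fun i _ => ((h _).fun_sub (h _)).const_mul _

/-- Integral of the calibration along an absolutely continuous path. -/
theorem integral_cholGrad {Q W : ℝ → Mat n} (l : Fin n → ℝ)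
    (hpos : ∀ t ∈ Icc (0 : ℝ) 1, (Q t).PosDef)
    (hac : ∀ i j, AbsolutelyContinuousOnInterval (fun t => Q t i j) 0 1)
    (hd : ∀ᵐ t, t ∈ Icc (0 : ℝ) 1 → ∀ i j, HasDerivAt (fun s => Q s i j) (W t i j) t) :
    IntervalIntegrable (fun t => (cholGrad l (Q t) * W t).trace) volume 0 1 ∧
      ∫ t in (0 : ℝ)..1, (cholGrad l (Q t) * W t).trace = cholFun l (Q 1) - cholFun l (Q 0) := by
  have h := absolutelyContinuousOnInterval_cholFun l (by rwa [uIcc_of_le zero_le_one]) hac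
  have e : ∀ᵐ t, t ∈ Icc (0 : ℝ) 1 →
      deriv (fun s => cholFun l (Q s)) t = (cholGrad l (Q t) * W t).trace := by
    filter_upwards [hd] with t ht hmem
    exact (hasDerivAt_cholFun l (hpos t hmem) (ht hmem)).deriv
  have hsub : Set.uIoc (0 : ℝ) 1 ⊆ Icc 0 1 := by
    rw [uIoc_of_le zero_le_one]; exact Ioc_subset_Icc_self
  constructor
  · refine h.intervalIntegrable_deriv.congr_ae ?_
    rw [Filter.EventuallyEq, ae_restrict_iff' measurableSet_uIoc]
    filter_upwards [e] with t ht hmem using ht (hsub hmem)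
  · rw [← h.integral_deriv_eq_sub]
    refine intervalIntegral.integral_congr_ae ?_
    filter_upwards [e] with t ht hmem using (ht (hsub hmem)).symm

/-! ### Rigidity of the calibration -/

theorem hasDerivAt_inv_apply {R : ℝ → Mat n} {R' : Mat n} {t : ℝ} (hu : IsUnit (R t))
    (hR : ∀ i j, HasDerivAt (fun s => R s i j) (R' i j) t) (i j : Fin n) :
    HasDerivAt (fun s => (R s)⁻¹ i j) ((-((R t)⁻¹ * R' * (R t)⁻¹)) i j) t := by
  -- Any submultiplicative norm serves, since the conclusion is entrywise.
  let _ : NormedRing (Mat n) := Matrix.linftyOpNormedRing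
  let _ : NormedAlgebra ℝ (Mat n) := Matrix.linftyOpNormedAlgebra
  have h1 : HasDerivAt R R' t := hasDerivAt_pi.2 fun i => hasDerivAt_pi.2 fun j => hR i j
  obtain ⟨u, hu⟩ := hu
  have h2 := hasFDerivAt_ringInverse (𝕜 := ℝ) u
  rw [hu] at h2
  have h3 := h2.comp_hasDerivAt t h1
  have hinv : (↑u⁻¹ : Mat n) = (R t)⁻¹ := by rw [← hu, Matrix.coe_units_inv]
  have h4 := hasDerivAt_pi.1 (hasDerivAt_pi.1 h3 i) j
  convert! h4 using 1
  · ext s; simp [Matrix.nonsing_inv_eq_ringInverse]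
  · simp [hinv]

theorem hasDerivAt_mul_apply {X Y : ℝ → Mat n} {X' Y' : Mat n} {t : ℝ}
    (hX : ∀ i j, HasDerivAt (fun s => X s i j) (X' i j) t)
    (hY : ∀ i j, HasDerivAt (fun s => Y s i j) (Y' i j) t) (i j : Fin n) :
    HasDerivAt (fun s => (X s * Y s) i j) ((X' * Y t + X t * Y') i j) t := by
  simp only [Matrix.mul_apply, Matrix.add_apply, ← Finset.sum_add_distrib]
  exact HasDerivAt.fun_sum fun k _ => (hX i k).mul (hY k j)

theorem hasDerivAt_minorInv {Q : ℝ → Mat n} {W : Mat n} {t : ℝ} (hpos : (Q t).PosDef)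
    (hQ : ∀ i j, HasDerivAt (fun s => Q s i j) (W i j) t) (k : ℕ) (i j : Fin n) :
    HasDerivAt (fun s => minorInv (Q s) k i j)
      ((-(minorInv (Q t) k * W * minorInv (Q t) k)) i j) t := by
  have h := hasDerivAt_inv_apply (minorReg_posDef hpos k).isUnit (hasDerivAt_minorReg hQ k)
  have hc : ∀ i j, HasDerivAt (fun _ : ℝ => minorProj n k i j) ((0 : Mat n) i j) t :=
    fun i j => hasDerivAt_const _ _
  convert! hasDerivAt_mul_apply (hasDerivAt_mul_apply hc h) hc i j using 1
  simp only [minorInv, Matrix.zero_mul, zero_add, Matrix.mul_zero, add_zero, Matrix.mul_neg,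
    Matrix.neg_mul, Matrix.mul_assoc]

/-- By Cramer's rule the inverse is the adjugate, polynomial in the entries, divided by a
determinant that is bounded away from zero. -/
theorem absolutelyContinuousOnInterval_inv_det {R : ℝ → Mat n} {a b : ℝ}
    (hpos : ∀ t ∈ uIcc a b, (R t).PosDef)
    (hR : ∀ i j, AbsolutelyContinuousOnInterval (fun t => R t i j) a b) (i j : Fin n) :
    AbsolutelyContinuousOnInterval (fun t => (R t)⁻¹ i j) a b := by
  have hdet := absolutelyContinuousOnInterval_det hR
  obtain ⟨t₀, ht₀, hmin⟩ := isCompact_uIcc.exists_isMinOn nonempty_uIcc hdet.continuousOn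
  have hc := (hpos t₀ ht₀).det_pos
  have hinv : AbsolutelyContinuousOnInterval (fun t => ((R t).det)⁻¹) a b := by
    refine hdet.lipschitzOnWith_comp (g := fun x => x⁻¹)
      (K := (((R t₀).det)⁻¹ ^ 2).toNNReal) ?_
    refine LipschitzOnWith.mono (α := ℝ) (β := ℝ) (t := Ici (R t₀).det) ?_ ?_
    · refine Convex.lipschitzOnWith_of_nnnorm_deriv_le (fun x hx => ?_) (fun x hx => ?_)
        (convex_Ici _)
      · exact differentiableAt_inv (hc.trans_le hx).ne'
      · have hx0 : 0 < x := hc.trans_le hx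
        rw [← NNReal.coe_le_coe, coe_nnnorm, deriv_inv, norm_neg,
          Real.norm_of_nonneg (by positivity), Real.coe_toNNReal _ (by positivity), ← inv_pow]
        gcongr
        exact hx
    · rintro _ ⟨t, ht, rfl⟩
      exact hmin ht
  have hadj : AbsolutelyContinuousOnInterval (fun t => (R t).adjugate i j) a b := by
    simp only [Matrix.adjugate_apply]
    refine absolutelyContinuousOnInterval_det fun k m => ?_
    simp only [Matrix.updateRow_apply]
    split_ifs
    · exact absolutelyContinuousOnInterval_const _ _ _
    · exact hR _ _
  simpa [Matrix.inv_def, Ring.inverse_eq_inv'] using hinv.fun_mul hadj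

theorem absolutelyContinuousOnInterval_mul_apply {X Y : ℝ → Mat n} {a b : ℝ}
    (hX : ∀ i j, AbsolutelyContinuousOnInterval (fun t => X t i j) a b)
    (hY : ∀ i j, AbsolutelyContinuousOnInterval (fun t => Y t i j) a b) (i j : Fin n) :
    AbsolutelyContinuousOnInterval (fun t => (X t * Y t) i j) a b := by
  simp only [Matrix.mul_apply]
  exact absolutelyContinuousOnInterval_sum _ fun k _ => (hX i k).fun_mul (hY k j)

/-- Along the calibrated flow `Q' = Q * G(Q) * Q` started at the identity, `G(Q) * Q` is
constant. -/
theorem cholGrad_mul_eq_diagonal {Q : ℝ → Mat n} (l : Fin n → ℝ)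
    (hpos : ∀ t ∈ Icc (0 : ℝ) 1, (Q t).PosDef)
    (hac : ∀ i j, AbsolutelyContinuousOnInterval (fun t => Q t i j) 0 1)
    (hd : ∀ᵐ t, t ∈ Icc (0 : ℝ) 1 →
      ∀ i j, HasDerivAt (fun s => Q s i j) ((Q t * cholGrad l (Q t) * Q t) i j) t)
    (h0 : Q 0 = 1) {t : ℝ} (ht : t ∈ Icc (0 : ℝ) 1) :
    cholGrad l (Q t) * Q t = Matrix.diagonal l := by
  have hI : uIcc (0 : ℝ) 1 = Icc 0 1 := uIcc_of_le zero_le_one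
  -- The derivative `-minorInv Q' minorInv Q + minorInv Q'` vanishes almost everywhere by
  -- `minorInv_mul_cholGrad`. An absolutely continuous function with this property is constant, here
  -- equal to its value at `Q 0 = 1`.
  have key : ∀ k, minorInv (Q t) k * Q t = minorProj n k := by
    intro k
    ext i j
    have hproj : ∀ i j, AbsolutelyContinuousOnInterval (fun _ : ℝ => minorProj n k i j) 0 1 :=
      fun i j => absolutelyContinuousOnInterval_const _ _ _
    have hA : AbsolutelyContinuousOnInterval (fun s => (minorInv (Q s) k * Q s) i j) 0 1 :=
      absolutelyContinuousOnInterval_mul_apply (absolutelyContinuousOnInterval_mul_apply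
        (absolutelyContinuousOnInterval_mul_apply hproj
          (absolutelyContinuousOnInterval_inv_det
            (fun s hs => minorReg_posDef (hpos s (hI ▸ hs)) k)
            (absolutelyContinuousOnInterval_minorReg hac k))) hproj) hac i j
    obtain ⟨C, hC⟩ := hA.const_of_ae_hasDerivAt_zero (by
      filter_upwards [hd] with s hs hmem
      rw [hI] at hmem
      convert! hasDerivAt_mul_apply (hasDerivAt_minorInv (hpos s hmem) (hs hmem) k)
        (hs hmem) i j using 1
      rw [Matrix.neg_mul, minorInv_mul_cholGrad (hpos s hmem), neg_add_cancel]
      rfl)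
    rw [hI] at hC
    have e0 := hC 0 (by simp)
    rw [hC t ht, ← e0, h0, minorInv_one, Matrix.mul_one]
  rw [cholGrad, Finset.sum_mul, ← sum_smul_minorProj l]
  refine Finset.sum_congr rfl fun i _ => ?_
  rw [Matrix.smul_mul, Matrix.sub_mul, key, key]

/-! ### The lemma of du Bois-Reymond -/

/-- The primitive from `0` vanishes to the left of `K`, where the integrand does, and to the right
of `K` because the total integral is zero. -/
theorem exists_smooth_primitive {χ : ℝ → ℝ} (hχ : ContDiff ℝ ∞ χ) {K : Set ℝ} (hK : IsCompact K)
    (hKI : K ⊆ Ioo 0 1) (hne : K.Nonempty) (hsupp : Function.support χ ⊆ K)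
    (hint : ∫ t, χ t = 0) :
    ∃ η : ℝ → ℝ, ContDiff ℝ ∞ η ∧ HasCompactSupport η ∧ tsupport η ⊆ Ioo 0 1 ∧
      deriv η = χ := by
  obtain ⟨a, haK, ha⟩ := hK.exists_isLeast hne
  obtain ⟨b, hbK, hb⟩ := hK.exists_isGreatest hne
  have hd : deriv (fun t => ∫ s in (0 : ℝ)..t, χ s) = χ := by
    ext t; exact hχ.continuous.deriv_integral _ _ _
  have hz : ∀ t, t ∉ Icc a b → ∫ s in (0 : ℝ)..t, χ s = 0 := by
    intro t ht
    have h0 := (hKI haK).1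
    rw [mem_Icc, not_and_or, not_le, not_le] at ht
    rcases ht with h | h
    · rw [intervalIntegral.integral_congr (g := fun _ => 0), intervalIntegral.integral_zero]
      intro s hs
      by_contra hne
      have hsa := ha (hsupp hne)
      have : s ≤ max 0 t := hs.2
      have : max 0 t < a := max_lt h0 h
      linarith
    · have h1 := hb haK
      rw [intervalIntegral.integral_eq_integral_of_support_subset, hint]
      intro s hs
      exact ⟨(hKI (hsupp hs)).1, (hb (hsupp hs)).trans h.le⟩
  have hts : tsupport (fun t => ∫ s in (0 : ℝ)..t, χ s) ⊆ Icc a b :=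
    closure_minimal (fun t ht => by_contra fun hn => ht (hz t hn)) isClosed_Icc
  refine ⟨_, ?_, ?_, ?_, hd⟩
  · rw [contDiff_infty_iff_deriv, hd]
    exact ⟨fun t => (hχ.continuous.integral_hasStrictDerivAt 0 t).hasDerivAt.differentiableAt, hχ⟩
  · exact HasCompactSupport.of_support_subset_isCompact isCompact_Icc
      ((subset_tsupport _).trans hts)
  · exact hts.trans (Icc_subset_Ioo (hKI haK).1 (hKI hbK).2)

/-- Subtracting a primitive of `b` leaves a continuous function with zero weak derivative, which
must be constant. Continuity on the closed interval carries the identity to the endpoints, although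
the tests only see the open one. -/
theorem sub_eq_integral_of_weak {F b : ℝ → ℝ} (hF : ContinuousOn F (Icc 0 1))
    (hb : IntegrableOn b (Icc 0 1))
    (h : ∀ η : ℝ → ℝ, ContDiff ℝ ∞ η → HasCompactSupport η → tsupport η ⊆ Ioo 0 1 →
      ∫ t in Icc (0 : ℝ) 1, (deriv η t * F t + η t * b t) = 0)
    {t : ℝ} (ht : t ∈ Icc (0 : ℝ) 1) : F t - F 0 = ∫ s in (0 : ℝ)..t, b s := by
  have hI : uIcc (0 : ℝ) 1 = Icc 0 1 := uIcc_of_le zero_le_one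
  have hbi : IntervalIntegrable b volume 0 1 :=
    (intervalIntegrable_iff_integrableOn_Icc_of_le zero_le_one).2 hb
  set B : ℝ → ℝ := fun t => ∫ s in (0 : ℝ)..t, b s with hB
  have hBac : AbsolutelyContinuousOnInterval B 0 1 :=
    hbi.absolutelyContinuousOnInterval_intervalIntegral (by simp)
  have hc : ContinuousOn (fun t => F t - B t) (Icc 0 1) :=
    hF.sub (hI ▸ hBac.continuousOn)
  have h1 : ∀ η : ℝ → ℝ, ContDiff ℝ ∞ η → HasCompactSupport η → tsupport η ⊆ Ioo 0 1 →
      ∫ t in Icc (0 : ℝ) 1, deriv η t * (F t - B t) = 0 := by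
    intro η hη hηc hηs
    have hη0 : η 0 = 0 := image_eq_zero_of_notMem_tsupport fun hm => lt_irrefl _ (hηs hm).1
    have hη1 : η 1 = 0 := image_eq_zero_of_notMem_tsupport fun hm => lt_irrefl _ (hηs hm).2
    have hηac : AbsolutelyContinuousOnInterval η 0 1 :=
      ContDiffOn.absolutelyContinuousOnInterval (hη.contDiffOn.of_le (by norm_num))
    have hp := hηac.integral_mul_deriv_eq_deriv_mul hBac
    rw [hη0, hη1] at hp
    have hdb : ∫ t in (0 : ℝ)..1, η t * deriv B t = ∫ t in (0 : ℝ)..1, η t * b t := by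
      refine intervalIntegral.integral_congr_ae ?_
      filter_upwards [hbi.ae_hasDerivAt_integral] with s hs hmem
      rw [(hs (uIoc_subset_uIcc hmem) 0 (by simp)).deriv]
    rw [hdb] at hp
    have hw := h η hη hηc hηs
    have hdη : Continuous (deriv η) := hη.continuous_deriv (by norm_num)
    have i1 : IntegrableOn (fun t => deriv η t * F t) (Icc 0 1) :=
      (hdη.continuousOn.mul hF).integrableOn_Icc
    have i2 : IntegrableOn (fun t => η t * b t) (Icc 0 1) :=
      hb.continuousOn_mul hη.continuous.continuousOn isCompact_Icc
    have i3 : IntegrableOn (fun t => deriv η t * B t) (Icc 0 1) :=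
      (hdη.continuousOn.mul (hI ▸ hBac.continuousOn)).integrableOn_Icc
    rw [integral_add i1 i2] at hw
    simp only [mul_sub]
    rw [integral_sub i1 i3]
    rw [intervalIntegral.integral_of_le zero_le_one, intervalIntegral.integral_of_le zero_le_one,
      ← integral_Icc_eq_integral_Ioc, ← integral_Icc_eq_integral_Ioc] at hp
    linarith
  -- A reference bump of unit mass; the outer radius `1/4` keeps its support in `[1/4, 3/4]`.
  let θb : ContDiffBump (1 / 2 : ℝ) := ⟨1 / 8, 1 / 4, by norm_num, by norm_num⟩
  set θ := θb.normed volume with hθ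
  have hθd : ContDiff ℝ ∞ θ := θb.contDiff_normed
  have hθs : tsupport θ = Metric.closedBall (1 / 2) (1 / 4) := θb.tsupport_normed_eq
  have hθI : tsupport θ ⊆ Ioo 0 1 := by
    rw [hθs, Real.closedBall_eq_Icc]
    exact Icc_subset_Ioo (by norm_num) (by norm_num)
  have hθc : HasCompactSupport θ := θb.hasCompactSupport_normed
  have hθ1 : ∫ t, θ t = 1 := θb.integral_normed
  set κ := ∫ t in Icc (0 : ℝ) 1, θ t * (F t - B t) with hκ
  have h2 : ∀ᵐ x : ℝ, x ∈ Ioo (0 : ℝ) 1 → F x - B x - κ = 0 := by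
    refine isOpen_Ioo.ae_eq_zero_of_integral_contDiff_smul_eq_zero ?_ ?_
    · exact ((hc.sub continuousOn_const).mono Ioo_subset_Icc_self).locallyIntegrableOn
        measurableSet_Ioo
    · intro g hg hgc hgs
      -- An arbitrary test `g` need not be a derivative of an admissible one, but `g - M * θ` has
      -- zero integral and therefore is.
      set M := ∫ t, g t with hM
      have hχi : ∫ t, (g t - M * θ t) = 0 := by
        rw [integral_sub (hg.continuous.integrable_of_hasCompactSupport hgc)
          ((hθd.continuous.integrable_of_hasCompactSupport hθc).const_mul M),
          integral_const_mul, hθ1, mul_one, sub_self]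
      obtain ⟨η, e1, e2, e3, e4⟩ := exists_smooth_primitive
        (hg.sub (contDiff_const.mul hθd)) (hgc.isCompact.union hθc.isCompact)
        (union_subset hgs hθI) ⟨1 / 2, Or.inr (by rw [hθs]; simp)⟩
        (by
          intro t ht
          by_contra hn
          rw [mem_union, not_or] at hn
          refine ht ?_
          simp only [image_eq_zero_of_notMem_tsupport hn.1,
            image_eq_zero_of_notMem_tsupport hn.2, mul_zero, sub_zero]) hχi
      have hw := h1 η e1 e2 e3
      rw [e4] at hw
      have j1 : IntegrableOn (fun t => g t * (F t - B t)) (Icc 0 1) :=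
        (hg.continuous.continuousOn.mul hc).integrableOn_Icc
      have j2 : IntegrableOn (fun t => θ t * (F t - B t)) (Icc 0 1) :=
        (hθd.continuous.continuousOn.mul hc).integrableOn_Icc
      have hsub : ∀ f : ℝ → ℝ, tsupport f ⊆ Ioo 0 1 →
          ∀ G : ℝ → ℝ, ∫ t, f t * G t = ∫ t in Icc (0 : ℝ) 1, f t * G t := by
        intro f hf G
        refine (setIntegral_eq_integral_of_forall_compl_eq_zero fun t ht => ?_).symm
        rw [image_eq_zero_of_notMem_tsupport fun hm => ht (Ioo_subset_Icc_self (hf hm)), zero_mul]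
      have hgM : ∫ t in Icc (0 : ℝ) 1, g t = M := by
        have := hsub g hgs fun _ => 1
        simpa using this.symm
      simp only [smul_eq_mul]
      rw [hsub g hgs]
      simp only [mul_sub, sub_mul] at hw j1 j2 ⊢
      have hgi : IntegrableOn g (Icc 0 1) := hg.continuous.integrableOn_Icc
      rw [integral_sub j1 (hgi.mul_const κ), integral_mul_const, hgM]
      have e : ∀ t, g t * F t - M * θ t * F t - (g t * B t - M * θ t * B t)
          = (g t * F t - g t * B t) - M * (θ t * F t - θ t * B t) := fun t => by ring
      simp only [e] at hw
      rw [integral_sub j1 (j2.const_mul M), integral_const_mul] at hw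
      simp only [mul_sub] at hκ
      rw [← hκ] at hw
      exact hw
  have h3 : EqOn (fun t => F t - B t) (fun _ => κ) (Icc 0 1) := by
    refine Measure.eqOn_Icc_of_ae_eq volume zero_ne_one ?_ hc continuousOn_const
    rw [← restrict_Ioo_eq_restrict_Icc, Filter.EventuallyEq, ae_restrict_iff' measurableSet_Ioo]
    filter_upwards [h2] with s hs hm using sub_eq_zero.1 (hs hm)
  have e1 := h3 ht
  have e0 := h3 (show (0 : ℝ) ∈ Icc 0 1 by simp)
  have hB0 : B 0 = 0 := by simp [hB]
  simp only [hB0] at e0 e1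
  have : B t = ∫ s in (0 : ℝ)..t, b s := rfl
  linarith

/-! ### Testing the continuity equation -/

theorem volume_restrict_slab : (volume : Measure (ℝ × Vec n)).restrict (Icc (0 : ℝ) 1 ×ˢ univ)
    = (volume.restrict (Icc (0 : ℝ) 1)).prod volume := by
  rw [Measure.volume_eq_prod, ← Measure.prod_restrict, Measure.restrict_univ]

theorem IsProbDensity.integrable_mul {f : Vec n → ℝ} (hf : IsProbDensity f) {g : Vec n → ℝ}
    (hg : Continuous g) {C : ℝ} (hC : ∀ x, ‖g x‖ ≤ C) : Integrable fun x => g x * f x :=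
  hf.integrable.bdd_mul hg.aestronglyMeasurable (Filter.Eventually.of_forall hC)

theorem IsProbDensity.abs_integral_mul_le {f : Vec n → ℝ} (hf : IsProbDensity f)
    {g : Vec n → ℝ} {C : ℝ} (hC : ∀ x, |g x| ≤ C) : |∫ x, g x * f x| ≤ C := by
  have := norm_integral_le_of_norm_le (f := fun x => g x * f x) (hf.integrable.const_mul C)
    (Filter.Eventually.of_forall fun x => by
      rw [norm_mul, Real.norm_of_nonneg (hf.nonneg x), Real.norm_eq_abs]
      exact mul_le_mul_of_nonneg_right (hC x) (hf.nonneg x))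
  rwa [integral_const_mul, hf.integral_eq_one, mul_one] at this

section

variable {P₀ P₁ : Mat n} {p : ℝ → Vec n → ℝ} {v : ℝ → Vec n → Vec n}

theorem Feasible.aestronglyMeasurable_density (h : Feasible P₀ P₁ p v) :
    AEStronglyMeasurable (fun z : ℝ × Vec n => p z.1 z.2)
      ((volume.restrict (Icc (0 : ℝ) 1)).prod volume) := by
  rw [← volume_restrict_slab]; exact h.aemeasurable_density.aestronglyMeasurable

theorem Feasible.aestronglyMeasurable_velocity (h : Feasible P₀ P₁ p v) :
    AEStronglyMeasurable (fun z : ℝ × Vec n => v z.1 z.2)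
      ((volume.restrict (Icc (0 : ℝ) 1)).prod volume) := by
  rw [← volume_restrict_slab]; exact h.aemeasurable_velocity.aestronglyMeasurable

theorem Feasible.integrable_density (h : Feasible P₀ P₁ p v) :
    Integrable (fun z : ℝ × Vec n => p z.1 z.2)
      ((volume.restrict (Icc (0 : ℝ) 1)).prod volume) := by
  rw [integrable_prod_iff h.aestronglyMeasurable_density]
  have hmem : ∀ᵐ t ∂(volume.restrict (Icc (0 : ℝ) 1)), t ∈ Icc (0 : ℝ) 1 :=
    ae_restrict_mem measurableSet_Icc
  constructor
  · filter_upwards [hmem] with t ht using (h.density t ht).integrable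
  · refine (integrable_const (1 : ℝ)).congr ?_
    filter_upwards [hmem] with t ht
    have := h.density t ht
    simp only [Real.norm_of_nonneg (this.nonneg _), this.integral_eq_one]

/-- A smooth function of time and space, supported in a fixed compact set of the space variable
for times near `[0,1]`. -/
structure IsTest (φ : ℝ × Vec n → ℝ) (K : Set (Vec n)) : Prop where
  smooth : ContDiff ℝ ∞ φ
  compact : IsCompact K
  eq_zero : ∀ t ∈ Ioo (-1 : ℝ) 2, ∀ x ∉ K, φ (t, x) = 0

variable {φ : ℝ × Vec n → ℝ} {K : Set (Vec n)}

/-- The time interval `(-1, 2)` in `IsTest` is open around `[0, 1]`, so the function vanishes near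
`(t, x)` at the endpoint times as well. -/
theorem IsTest.fderiv_eq_zero (hφ : IsTest φ K) {t : ℝ} (ht : t ∈ Icc (0 : ℝ) 1) {x : Vec n}
    (hx : x ∉ K) : fderiv ℝ φ (t, x) = 0 := by
  have : φ =ᶠ[nhds (t, x)] fun _ => 0 := by
    have ho : IsOpen (Ioo (-1 : ℝ) 2 ×ˢ Kᶜ) := isOpen_Ioo.prod hφ.compact.isClosed.isOpen_compl
    filter_upwards [ho.mem_nhds ⟨⟨by linarith [ht.1], by linarith [ht.2]⟩, hx⟩] with z hz
    exact hφ.eq_zero z.1 hz.1 z.2 hz.2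
  rw [this.fderiv_eq]
  simp

theorem IsTest.exists_bound (hφ : IsTest φ K) : ∃ N, 0 ≤ N ∧
    (∀ t ∈ Icc (0 : ℝ) 1, ∀ x, |φ (t, x)| ≤ N) ∧
    ∀ t ∈ Icc (0 : ℝ) 1, ∀ x, ‖fderiv ℝ φ (t, x)‖ ≤ N := by
  have hK : IsCompact (Icc (0 : ℝ) 1 ×ˢ K) := isCompact_Icc.prod hφ.compact
  obtain ⟨N₁, h1⟩ := hK.exists_bound_of_continuousOn hφ.smooth.continuous.continuousOn
  obtain ⟨N₂, h2⟩ := hK.exists_bound_of_continuousOn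
    (hφ.smooth.continuous_fderiv (by norm_num)).continuousOn
  refine ⟨max 0 (max N₁ N₂), le_max_left _ _, fun t ht x => ?_, fun t ht x => ?_⟩
  · by_cases hx : x ∈ K
    · exact (h1 (t, x) ⟨ht, hx⟩).trans ((le_max_left _ _).trans (le_max_right _ _))
    · rw [hφ.eq_zero t ⟨by linarith [ht.1], by linarith [ht.2]⟩ x hx, abs_zero]
      exact le_max_left _ _
  · by_cases hx : x ∈ K
    · exact (h2 (t, x) ⟨ht, hx⟩).trans ((le_max_right _ _).trans (le_max_right _ _))
    · rw [hφ.fderiv_eq_zero ht hx, norm_zero]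
      exact le_max_left _ _

theorem IsTest.continuous_slice (hφ : IsTest φ K) (t : ℝ) : Continuous fun x => φ (t, x) :=
  hφ.smooth.continuous.comp (by fun_prop)

/-- Narrow continuity treats the slice frozen at time `s`; replacing `φ (t, ·)` by `φ (s, ·)` costs
at most `N * |t - s|`, since each `p t` has unit mass. -/
theorem IsTest.continuousOn_integral (hφ : IsTest φ K)
    (hp : ∀ t ∈ Icc (0 : ℝ) 1, IsProbDensity (p t))
    (hn : ∀ f : Vec n →ᵇ ℝ, ContinuousOn (fun t => ∫ x, f x * p t x) (Icc 0 1)) :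
    ContinuousOn (fun t => ∫ x, φ (t, x) * p t x) (Icc 0 1) := by
  obtain ⟨N, hN, hb, hd⟩ := hφ.exists_bound
  intro s hs
  let f : Vec n →ᵇ ℝ := BoundedContinuousFunction.ofNormedAddCommGroup (fun x => φ (s, x))
    (hφ.continuous_slice s) N fun x => hb s hs x
  have hf : ContinuousWithinAt (fun t => ∫ x, φ (s, x) * p t x) (Icc 0 1) s := hn f s hs
  have hlip : ∀ t ∈ Icc (0 : ℝ) 1, ∀ x, |φ (t, x) - φ (s, x)| ≤ N * |t - s| := by
    intro t ht x
    have := (convex_Icc (0 : ℝ) 1).norm_image_sub_le_of_norm_fderiv_le (𝕜 := ℝ)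
      (f := fun t => φ (t, x)) (C := N) (x := s) (y := t)
      (fun r _ => ((hφ.smooth.differentiable (by norm_num)).comp
        (by fun_prop : Differentiable ℝ fun t : ℝ => (t, x))).differentiableAt)
      (fun r hr => by
        have h1 : HasFDerivAt (fun t : ℝ => (t, x)) (ContinuousLinearMap.inl ℝ ℝ (Vec n)) r :=
          (hasFDerivAt_id r).prodMk (hasFDerivAt_const x r)
        have h2 : HasFDerivAt (fun t => φ (t, x)) _ r :=
          ((hφ.smooth.differentiable (by norm_num)) (r, x)).hasFDerivAt.comp r h1
        rw [h2.fderiv]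
        calc _ ≤ ‖fderiv ℝ φ (r, x)‖ * ‖ContinuousLinearMap.inl ℝ ℝ (Vec n)‖ :=
              ContinuousLinearMap.opNorm_comp_le _ _
          _ ≤ N * 1 := by
              gcongr
              · exact hd r hr x
              · exact ContinuousLinearMap.norm_inl_le_one ℝ ℝ (Vec n)
          _ = N := mul_one N) hs ht
    simpa using this
  have h0 : Filter.Tendsto (fun t => ∫ x, (φ (t, x) - φ (s, x)) * p t x)
      (nhdsWithin s (Icc 0 1)) (nhds 0) := by
    refine squeeze_zero_norm' (a := fun t => N * |t - s|) ?_ ?_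
    · filter_upwards [self_mem_nhdsWithin] with t ht
      exact (hp t ht).abs_integral_mul_le (hlip t ht)
    · have : Continuous fun t => N * |t - s| := by fun_prop
      simpa using (this.tendsto s).mono_left nhdsWithin_le_nhds
  have := h0.add hf
  rw [zero_add] at this
  refine this.congr' ?_
  filter_upwards [self_mem_nhdsWithin] with t ht
  simp only [sub_mul]
  rw [integral_sub]
  · ring
  · exact (hp t ht).integrable_mul (hφ.continuous_slice t) (hb t ht)
  · exact (hp t ht).integrable_mul (hφ.continuous_slice s) (hb s hs)

/-- The derivative is at most `N * (1 + ‖v‖)` and lives over `K`, where `p` and `p ‖v‖` are both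
integrable. -/
theorem Feasible.integrable_test (h : Feasible P₀ P₁ p v) (hφ : IsTest φ K) :
    Integrable (fun z : ℝ × Vec n => p z.1 z.2 * fderiv ℝ φ z (1, v z.1 z.2))
      ((volume.restrict (Icc (0 : ℝ) 1)).prod volume) := by
  obtain ⟨N, hN, hb, hd⟩ := hφ.exists_bound
  have hm : AEStronglyMeasurable (fun z : ℝ × Vec n => p z.1 z.2 * fderiv ℝ φ z (1, v z.1 z.2))
      ((volume.restrict (Icc (0 : ℝ) 1)).prod volume) := by
    refine h.aestronglyMeasurable_density.mul ?_
    have hc : Continuous fun w : (ℝ × Vec n) × Vec n => fderiv ℝ φ w.1 (1, w.2) :=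
      ((hφ.smooth.continuous_fderiv (by norm_num)).comp continuous_fst).clm_apply (by fun_prop)
    exact hc.comp_aestronglyMeasurable
      (aestronglyMeasurable_id.prodMk h.aestronglyMeasurable_velocity)
  rw [← volume_restrict_slab] at hm ⊢
  have hKm : MeasurableSet (Icc (0 : ℝ) 1 ×ˢ K) :=
    measurableSet_Icc.prod hφ.compact.measurableSet
  have hsub : Icc (0 : ℝ) 1 ×ˢ K ⊆ Icc (0 : ℝ) 1 ×ˢ univ := prod_mono_right (subset_univ _)
  have hi : IntegrableOn (fun z : ℝ × Vec n => p z.1 z.2 * fderiv ℝ φ z (1, v z.1 z.2))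
      (Icc (0 : ℝ) 1 ×ˢ K) := by
    have hp1 : IntegrableOn (fun z : ℝ × Vec n => p z.1 z.2) (Icc (0 : ℝ) 1 ×ˢ univ) := by
      rw [IntegrableOn, volume_restrict_slab]; exact h.integrable_density
    have hp2 := h.continuity.locallyIntegrable _ (isCompact_Icc.prod hφ.compact) hsub
    refine Integrable.mono' (((hp1.mono_set hsub).add hp2).const_mul N)
      (hm.mono_measure (Measure.restrict_mono hsub le_rfl)) ?_
    filter_upwards [ae_restrict_mem hKm] with z hz
    have hz0 := (h.density z.1 hz.1).nonneg z.2
    have h1 : ‖fderiv ℝ φ z (1, v z.1 z.2)‖ ≤ N * (1 + ‖v z.1 z.2‖) := by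
      refine (ContinuousLinearMap.le_opNorm _ _).trans ?_
      gcongr
      · exact hd z.1 hz.1 z.2
      · rw [Prod.norm_mk]
        refine max_le ?_ ?_
        · rw [norm_one]; linarith [norm_nonneg (v z.1 z.2)]
        · linarith
    rw [norm_mul, Real.norm_of_nonneg hz0]
    calc _ ≤ p z.1 z.2 * (N * (1 + ‖v z.1 z.2‖)) := by gcongr
      _ = _ := by simp only [Pi.add_apply]; ring
  refine hi.of_forall_sdiff_eq_zero (measurableSet_Icc.prod MeasurableSet.univ) ?_
  rintro z ⟨hz, hzK⟩
  have : z.2 ∉ K := fun hk => hzK ⟨hz.1, hk⟩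
  rw [show z = (z.1, z.2) from rfl, hφ.fderiv_eq_zero hz.1 this]
  simp

theorem fderiv_time_mul {η : ℝ → ℝ} (hη : ContDiff ℝ ∞ η) (hφ : ContDiff ℝ ∞ φ)
    (z : ℝ × Vec n) (w : Vec n) :
    fderiv ℝ (fun z : ℝ × Vec n => η z.1 * φ z) z (1, w)
      = deriv η z.1 * φ z + η z.1 * fderiv ℝ φ z (1, w) := by
  have h1 : HasFDerivAt (fun z : ℝ × Vec n => η z.1)
      (deriv η z.1 • ContinuousLinearMap.fst ℝ ℝ (Vec n)) z :=
    (((hη.differentiable (by norm_num)) z.1).hasDerivAt).comp_hasFDerivAt z hasFDerivAt_fst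
  have h2 := h1.fun_mul ((hφ.differentiable (by norm_num)) z).hasFDerivAt
  rw [h2.fderiv]
  simp
  ring

/-- The continuity equation tested with a function that need not vanish at the initial and final
times. -/
theorem Feasible.integral_test_sub (h : Feasible P₀ P₁ p v) (hφ : IsTest φ K) {t : ℝ}
    (ht : t ∈ Icc (0 : ℝ) 1) :
    (∫ x, φ (t, x) * p t x) - ∫ x, φ (0, x) * p 0 x
      = ∫ s in (0 : ℝ)..t, ∫ x, p s x * fderiv ℝ φ (s, x) (1, v s x) := by
  obtain ⟨N, hN, hb, hd⟩ := hφ.exists_bound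
  have hint := h.integrable_test hφ
  refine sub_eq_integral_of_weak (F := fun t => ∫ x, φ (t, x) * p t x)
    (hφ.continuousOn_integral h.density h.narrow) hint.integral_prod_left ?_ ht
  intro η hη hηc hηs
  have hvan : ∀ z : ℝ × Vec n, z ∉ tsupport η ×ˢ K → η z.1 * φ z = 0 := by
    intro z hz
    by_cases h1 : z.1 ∈ tsupport η
    · have hI := hηs h1
      have := hφ.eq_zero z.1 ⟨by linarith [hI.1], by linarith [hI.2]⟩ z.2 fun hk => hz ⟨h1, hk⟩
      rw [show φ z = 0 from this, mul_zero]
    · rw [image_eq_zero_of_notMem_tsupport h1, zero_mul]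
  -- Multiplication by `η` gives a compact support inside the open time slab. The weak equation for
  -- `η φ` then says that `∫ φ p` has the stated weak time derivative.
  have hw := h.continuity.weak (fun z => η z.1 * φ z)
    ((hη.comp contDiff_fst).mul hφ.smooth)
    (HasCompactSupport.intro (hηc.isCompact.prod hφ.compact) fun z hz => hvan z hz)
    ((closure_minimal (Function.support_subset_iff'.2 hvan)
      (hηc.isCompact.prod hφ.compact).isClosed).trans (prod_mono hηs (subset_univ _)))
  rw [volume_restrict_slab] at hw
  simp only [fderiv_time_mul hη hφ.smooth] at hw
  have hηd : Continuous (deriv η) := hη.continuous_deriv (by norm_num)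
  obtain ⟨M₁, hM₁⟩ := isCompact_Icc.exists_bound_of_continuousOn (s := Icc (0 : ℝ) 1)
    hηd.continuousOn
  obtain ⟨M₂, hM₂⟩ := isCompact_Icc.exists_bound_of_continuousOn (s := Icc (0 : ℝ) 1)
    hη.continuous.continuousOn
  have hmem : ∀ᵐ z ∂((volume.restrict (Icc (0 : ℝ) 1)).prod (volume : Measure (Vec n))),
      z.1 ∈ Icc (0 : ℝ) 1 :=
    Measure.quasiMeasurePreserving_fst.ae (ae_restrict_mem measurableSet_Icc)
  have i1 : Integrable (fun z : ℝ × Vec n => deriv η z.1 * φ z * p z.1 z.2)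
      ((volume.restrict (Icc (0 : ℝ) 1)).prod volume) := by
    refine h.integrable_density.bdd_mul (c := M₁ * N)
      ((hηd.comp continuous_fst).mul hφ.smooth.continuous).aestronglyMeasurable ?_
    filter_upwards [hmem] with z hz
    rw [norm_mul]
    have := hM₁ z.1 hz
    have h2 := hb z.1 hz z.2
    gcongr
    · exact (norm_nonneg _).trans this
    · exact h2
  have i2 : Integrable (fun z : ℝ × Vec n =>
      η z.1 * (p z.1 z.2 * fderiv ℝ φ z (1, v z.1 z.2)))
      ((volume.restrict (Icc (0 : ℝ) 1)).prod volume) := by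
    refine hint.bdd_mul (c := M₂) (hη.continuous.comp continuous_fst).aestronglyMeasurable ?_
    filter_upwards [hmem] with z hz using hM₂ z.1 hz
  have e : ∀ z : ℝ × Vec n, p z.1 z.2 * (deriv η z.1 * φ z + η z.1 * fderiv ℝ φ z (1, v z.1 z.2))
      = deriv η z.1 * φ z * p z.1 z.2
        + η z.1 * (p z.1 z.2 * fderiv ℝ φ z (1, v z.1 z.2)) := fun z => by ring
  simp only [e] at hw
  have i3 : Integrable (fun z : ℝ × Vec n => deriv η z.1 * φ z * p z.1 z.2
      + η z.1 * (p z.1 z.2 * fderiv ℝ φ z (1, v z.1 z.2)))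
      ((volume.restrict (Icc (0 : ℝ) 1)).prod volume) := i1.add i2
  rw [integral_prod _ i3] at hw
  refine Eq.trans ?_ hw
  refine integral_congr_ae ?_
  filter_upwards [i1.prod_right_ae, i2.prod_right_ae] with s hs1 hs2
  rw [integral_add hs1 hs2]
  simp only [mul_assoc]
  rw [integral_const_mul, integral_const_mul]

end

/-! ### Second moments of a density -/

/-- Every eigenvalue of `P` is at most its trace, so `P⁻¹` dominates the identity divided by the
trace. This converts the weighted energy into control of the unweighted one. -/
theorem trace_mul_weightedSq_inv_ge {P : Mat n} (hP : P.PosDef) (y : Vec n) :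
    ‖y‖ ^ 2 ≤ P.trace * weightedSq P⁻¹ y := by
  obtain ⟨U, d, hU, hU', hd, hf⟩ := exists_spectral hP
  have hPd : P = U * Matrix.diagonal d * Uᵀ := (cfc_id' ℝ _ hP.isHermitian).symm.trans (hf _)
  have hinv : P⁻¹ = U * Matrix.diagonal (fun i => (d i)⁻¹) * Uᵀ := by
    refine Matrix.inv_eq_right_inv ?_
    rw [hPd, conj_diagonal_mul hU']
    simp [(hd _).ne', hU]
  set z := Uᵀ *ᵥ y.ofLp with hz
  have h1 : weightedSq P⁻¹ y = ∑ i, (d i)⁻¹ * z i ^ 2 := by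
    rw [weightedSq, hinv, Matrix.mul_assoc, ← Matrix.mulVec_mulVec, Matrix.dotProduct_mulVec,
      ← Matrix.mulVec_transpose, ← Matrix.mulVec_mulVec, ← hz, dotProduct]
    refine Finset.sum_congr rfl fun i _ => ?_
    rw [Matrix.mulVec_diagonal]; ring
  have h2 : ‖y‖ ^ 2 = ∑ i, z i ^ 2 := by
    have : z ⬝ᵥ z = y.ofLp ⬝ᵥ y.ofLp := by
      rw [hz, Matrix.dotProduct_mulVec, Matrix.vecMul_transpose, Matrix.mulVec_mulVec, hU,
        Matrix.one_mulVec]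
    rw [EuclideanSpace.norm_sq_eq]
    simp only [dotProduct, Real.norm_eq_abs, sq_abs] at this ⊢
    simpa [sq] using this.symm
  have h3 : P.trace = ∑ i, d i := by
    rw [hPd, Matrix.mul_assoc, Matrix.trace_mul_comm, Matrix.mul_assoc, hU', Matrix.mul_one,
      Matrix.trace_diagonal]
  rw [h1, h2, h3, Finset.mul_sum]
  refine Finset.sum_le_sum fun i _ => ?_
  have : d i ≤ ∑ j, d j := Finset.single_le_sum (fun j _ => (hd j).le) (Finset.mem_univ i)
  calc z i ^ 2 = d i * ((d i)⁻¹ * z i ^ 2) := by rw [mul_inv_cancel_left₀ (hd i).ne']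
    _ ≤ _ := by
      gcongr
      have := hd i
      positivity

theorem abs_apply_mul_apply_le (x y : Vec n) (i j : Fin n) : |x i * y j| ≤ ‖x‖ * ‖y‖ := by
  rw [abs_mul]
  exact mul_le_mul (PiLp.norm_apply_le x i) (PiLp.norm_apply_le y j) (abs_nonneg _) (norm_nonneg _)

theorem integrable_apply_mul_apply {f : Vec n → ℝ} (hf : IsProbDensity f)
    (h2 : Integrable fun x : Vec n => ‖x‖ ^ 2 * f x) (i j : Fin n) :
    Integrable fun x : Vec n => x i * x j * f x := by
  refine h2.mono ((by fun_prop : Continuous fun x : Vec n => x i * x j).aestronglyMeasurable.mul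
    hf.integrable.aestronglyMeasurable) (Filter.Eventually.of_forall fun x => ?_)
  rw [norm_mul, norm_mul (‖x‖ ^ 2)]
  refine mul_le_mul_of_nonneg_right ?_ (norm_nonneg (f x))
  rw [Real.norm_eq_abs, Real.norm_of_nonneg (by positivity), sq]
  exact abs_apply_mul_apply_le x x i j

theorem trace_secondMoment {f : Vec n → ℝ} (hf : IsProbDensity f)
    (h2 : Integrable fun x : Vec n => ‖x‖ ^ 2 * f x) :
    (secondMoment f).trace = ∫ x, ‖x‖ ^ 2 * f x := by
  simp only [Matrix.trace, Matrix.diag_apply, secondMoment, Matrix.of_apply]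
  rw [← integral_finsetSum _ fun i _ => integrable_apply_mul_apply hf h2 i i]
  refine integral_congr_ae (Filter.Eventually.of_forall fun x => ?_)
  simp only [EuclideanSpace.norm_sq_eq, Finset.sum_mul, Real.norm_eq_abs, sq_abs]
  simp [sq]

theorem secondMoment_transpose (f : Vec n → ℝ) : (secondMoment f)ᵀ = secondMoment f := by
  ext i j
  simp only [secondMoment, Matrix.transpose_apply, Matrix.of_apply, mul_comm]

theorem sq_dotProduct_mul (y : Fin n → ℝ) (x : Vec n) (c : ℝ) :
    (y ⬝ᵥ x.ofLp) ^ 2 * c = ∑ i, ∑ j, y i * y j * (x i * x j * c) := by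
  rw [sq, dotProduct, Finset.sum_mul_sum, Finset.sum_mul]
  refine Finset.sum_congr rfl fun i _ => ?_
  rw [Finset.sum_mul]
  exact Finset.sum_congr rfl fun j _ => by ring

theorem dotProduct_secondMoment_mulVec {f : Vec n → ℝ} (hf : IsProbDensity f)
    (h2 : Integrable fun x : Vec n => ‖x‖ ^ 2 * f x) (y : Fin n → ℝ) :
    y ⬝ᵥ secondMoment f *ᵥ y = ∫ x : Vec n, (y ⬝ᵥ x.ofLp) ^ 2 * f x := by
  have h := integrable_apply_mul_apply hf h2
  simp only [sq_dotProduct_mul]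
  rw [integral_finsetSum _ fun i _ => integrable_finsetSum _ fun j _ => (h i j).const_mul _]
  simp only [dotProduct, Matrix.mulVec, Finset.mul_sum, secondMoment, Matrix.of_apply]
  refine Finset.sum_congr rfl fun i _ => ?_
  rw [integral_finsetSum _ fun j _ => (h i j).const_mul _]
  refine Finset.sum_congr rfl fun j _ => ?_
  rw [integral_const_mul]
  ring

/-- A direction of zero variance would confine the mass to a hyperplane through the origin, which is
Lebesgue null. -/
theorem secondMoment_posDef {f : Vec n → ℝ} (hf : IsProbDensity f)
    (h2 : Integrable fun x : Vec n => ‖x‖ ^ 2 * f x) : (secondMoment f).PosDef := by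
  refine Matrix.PosDef.of_dotProduct_mulVec_pos ?_ fun y hy => ?_
  · rw [Matrix.IsHermitian, Matrix.conjTranspose_eq_transpose_of_trivial, secondMoment_transpose]
  rw [star_trivial, dotProduct_secondMoment_mulVec hf h2]
  have hnn : ∀ x : Vec n, 0 ≤ (y ⬝ᵥ x.ofLp) ^ 2 * f x := fun x =>
    mul_nonneg (sq_nonneg _) (hf.nonneg x)
  have hint : Integrable fun x : Vec n => (y ⬝ᵥ x.ofLp) ^ 2 * f x := by
    simp only [sq_dotProduct_mul]
    exact integrable_finsetSum _ fun i _ => integrable_finsetSum _ fun j _ =>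
      (integrable_apply_mul_apply hf h2 i j).const_mul _
  refine lt_of_le_of_ne (integral_nonneg hnn) fun h0 => ?_
  have hz := (integral_eq_zero_iff_of_nonneg hnn hint).1 h0.symm
  let L : Vec n →ₗ[ℝ] ℝ :=
    { toFun := fun x => y ⬝ᵥ x.ofLp
      map_add' := fun a b => by simp [dotProduct_add]
      map_smul' := fun c a => by simp }
  have hker : volume (LinearMap.ker L : Set (Vec n)) = 0 := by
    refine Measure.addHaar_submodule _ _ fun htop => hy ?_
    have : L (WithLp.toLp 2 y) = 0 := by
      rw [← LinearMap.mem_ker, htop]; trivial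
    exact dotProduct_self_eq_zero.1 this
  have hf0 : f =ᵐ[volume] 0 := by
    filter_upwards [hz, measure_eq_zero_iff_ae_notMem.1 hker] with x hx hxk
    have : (y ⬝ᵥ x.ofLp) ≠ 0 := fun h => hxk h
    simpa [this] using hx
  have := hf.integral_eq_one
  rw [integral_congr_ae hf0] at this
  simp at this

theorem lintegral_law {f : Vec n → ℝ} (hf : IsProbDensity f) {F : Vec n → ℝ≥0∞}
    (hF : AEMeasurable F volume) :
    ∫⁻ x, F x ∂(law f) = ∫⁻ x, ENNReal.ofReal (f x) * F x := by
  rw [law, lintegral_withDensity_eq_lintegral_mul₀ hf.integrable.aemeasurable.ennreal_ofReal hF]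
  rfl

theorem law_absolutelyContinuous (f : Vec n → ℝ) : law f ≪ (volume : Measure (Vec n)) :=
  withDensity_absolutelyContinuous _ _

theorem integral_law {f : Vec n → ℝ} (hf : IsProbDensity f) (F : Vec n → ℝ) :
    ∫ x, F x ∂(law f) = ∫ x, F x * f x := by
  rw [law, integral_withDensity_eq_integral_toReal_smul₀
    hf.integrable.aemeasurable.ennreal_ofReal (Filter.Eventually.of_forall fun _ => by simp)]
  simp only [ENNReal.toReal_ofReal (hf.nonneg _), smul_eq_mul, mul_comm]

theorem integrable_law_iff {f : Vec n → ℝ} (hf : IsProbDensity f) (F : Vec n → ℝ) :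
    Integrable F (law f) ↔ Integrable fun x => F x * f x := by
  rw [law, integrable_withDensity_iff_integrable_smul₀'
    hf.integrable.aemeasurable.ennreal_ofReal (Filter.Eventually.of_forall fun _ => by simp)]
  simp only [ENNReal.toReal_ofReal (hf.nonneg _), smul_eq_mul, mul_comm]

/-! ### Cutoffs of the identity -/

/-- All `q k` are dilates of one truncation of the identity. Dilation `x ↦ r q₀ (x / r)` leaves the
bound on the derivative unchanged, so `C` is independent of `k`. -/
theorem exists_cutoff (n : ℕ) : ∃ (C : ℝ) (q : ℕ → Vec n → Vec n), 0 ≤ C ∧ ∀ k,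
    ContDiff ℝ ∞ (q k) ∧ HasCompactSupport (q k) ∧ (∀ x, ‖q k x‖ ≤ ‖x‖) ∧
    (∀ x, ‖fderiv ℝ (q k) x‖ ≤ C) ∧ ∀ x ∈ Metric.ball (0 : Vec n) (k + 1), q k x = x := by
  let χ : ContDiffBump (0 : Vec n) := ⟨1, 2, by norm_num, by norm_num⟩
  obtain ⟨q₀, hq⟩ : ∃ q₀ : Vec n → Vec n, q₀ = fun x => χ x • x := ⟨_, rfl⟩
  have hq₀ : ContDiff ℝ ∞ q₀ := hq ▸ χ.contDiff.smul contDiff_id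
  have hc₀ : HasCompactSupport q₀ := hq ▸ χ.hasCompactSupport.smul_right
  obtain ⟨C, hC⟩ := (hq₀.continuous_fderiv (by norm_num)).bounded_above_of_compact_support
    (hc₀.fderiv (𝕜 := ℝ))
  refine ⟨C, fun k x => ((k : ℝ) + 1) • q₀ (((k : ℝ) + 1)⁻¹ • x),
    (norm_nonneg _).trans (hC 0), fun k => ?_⟩
  have hk : (0 : ℝ) < k + 1 := by positivity
  refine ⟨?_, ?_, ?_, ?_, ?_⟩
  · exact (hq₀.comp (contDiff_id.const_smul _)).const_smul _
  · exact (hc₀.comp_smul (inv_ne_zero hk.ne')).smul_left (f := fun _ => (k : ℝ) + 1)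
  · intro x
    simp only [hq]
    rw [smul_smul, smul_smul, norm_smul]
    have : (k + 1 : ℝ) * χ (((k : ℝ) + 1)⁻¹ • x) * ((k : ℝ) + 1)⁻¹
        = χ (((k : ℝ) + 1)⁻¹ • x) := by field_simp
    rw [this, Real.norm_of_nonneg χ.nonneg]
    exact mul_le_of_le_one_left (norm_nonneg _) χ.le_one
  · intro x
    have h1 : HasFDerivAt (fun x : Vec n => ((k : ℝ) + 1)⁻¹ • x)
        (((k : ℝ) + 1)⁻¹ • ContinuousLinearMap.id ℝ (Vec n)) x :=
      (hasFDerivAt_id x).fun_const_smul _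
    have h2 : HasFDerivAt (fun x : Vec n => ((k : ℝ) + 1) • q₀ (((k : ℝ) + 1)⁻¹ • x)) _ x :=
      (((hq₀.differentiable (by norm_num)) _).hasFDerivAt.comp x h1).fun_const_smul _
    rw [h2.fderiv, ContinuousLinearMap.comp_smul, smul_smul, mul_inv_cancel₀ hk.ne', one_smul,
      ContinuousLinearMap.comp_id]
    exact hC _
  · intro x hx
    have : χ (((k : ℝ) + 1)⁻¹ • x) = 1 := by
      refine χ.one_of_mem_closedBall ?_
      rw [mem_closedBall_zero_iff, norm_smul, norm_inv, Real.norm_of_nonneg hk.le]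
      rw [mem_ball_zero_iff] at hx
      change ((k : ℝ) + 1)⁻¹ * ‖x‖ ≤ 1
      rw [inv_mul_le_one₀ hk]
      exact hx.le
    simp only [hq, this, one_smul]
    rw [smul_smul, mul_inv_cancel₀ hk.ne', one_smul]

theorem isTest_of_hasCompactSupport {ψ : Vec n → ℝ} (hψ : ContDiff ℝ ∞ ψ)
    (hc : HasCompactSupport ψ) : IsTest (fun z : ℝ × Vec n => ψ z.2) (tsupport ψ) :=
  ⟨hψ.comp contDiff_snd, hc.isCompact, fun _ _ _ hx => image_eq_zero_of_notMem_tsupport hx⟩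

theorem fderiv_comp_snd {ψ : Vec n → ℝ} (hψ : ContDiff ℝ ∞ ψ) (t : ℝ) (x w : Vec n) :
    fderiv ℝ (fun z : ℝ × Vec n => ψ z.2) (t, x) (1, w) = fderiv ℝ ψ x w := by
  have h : HasFDerivAt (fun z : ℝ × Vec n => ψ z.2)
      ((fderiv ℝ ψ x).comp (ContinuousLinearMap.snd ℝ ℝ (Vec n))) (t, x) :=
    ((hψ.differentiable (by norm_num)) x).hasFDerivAt.comp (t, x) hasFDerivAt_snd
  rw [h.fderiv]
  rfl

/-! ### Time regularity of the second moments -/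

section

variable {P₀ P₁ : Mat n} {p : ℝ → Vec n → ℝ} {v : ℝ → Vec n → Vec n}

/-- The regularity that holds at almost every time. -/
structure RegularAt (p : ℝ → Vec n → ℝ) (v : ℝ → Vec n → Vec n) (t : ℝ) : Prop where
  mem : t ∈ Icc (0 : ℝ) 1
  density : IsProbDensity (p t)
  moment : Integrable fun x : Vec n => ‖x‖ ^ 2 * p t x
  velocity : AEStronglyMeasurable (v t) volume

theorem Feasible.ae_regularAt (h : Feasible P₀ P₁ p v) :
    ∀ᵐ t ∂(volume.restrict (Icc (0 : ℝ) 1)), RegularAt p v t := by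
  have h2 := h.secondMoment_integrable
  rw [IntegrableOn, volume_restrict_slab] at h2
  filter_upwards [ae_restrict_mem measurableSet_Icc, h2.prod_right_ae,
    h.aestronglyMeasurable_velocity.prodMk_left] with t h1 h2 h3
  exact ⟨h1, h.density t h1, h2, h3⟩

/-- The kinetic energy of the velocity at time `t`. -/
def kinetic (p : ℝ → Vec n → ℝ) (v : ℝ → Vec n → Vec n) (t : ℝ) : ℝ≥0∞ :=
  ∫⁻ x, ‖v t x‖ₑ ^ 2 ∂(law (p t))

/-- The weighted energy of the velocity at time `t`. -/
def weightedKinetic (p : ℝ → Vec n → ℝ) (v : ℝ → Vec n → Vec n) (t : ℝ) : ℝ≥0∞ :=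
  ∫⁻ x, ENNReal.ofReal (weightedSq (secondMoment (p t))⁻¹ (v t x)) ∂(law (p t))

theorem RegularAt.kinetic_le {t : ℝ} (h : RegularAt p v t) :
    kinetic p v t ≤ ENNReal.ofReal (∫ x, ‖x‖ ^ 2 * p t x) * weightedKinetic p v t := by
  have hP := secondMoment_posDef h.density h.moment
  rw [kinetic, weightedKinetic, ← trace_secondMoment h.density h.moment,
    ← lintegral_const_mul' _ _ ENNReal.ofReal_ne_top]
  refine lintegral_mono fun x => ?_
  rw [← ENNReal.ofReal_mul hP.posSemidef.trace_nonneg, ← ofReal_norm,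
    ← ENNReal.ofReal_pow (norm_nonneg _)]
  exact ENNReal.ofReal_le_ofReal (trace_mul_weightedSq_inv_ge hP _)

/-- With `a` the total second moment and `b` the weighted energy, both integrable in time when the
cost is finite, this crude bound makes the square root of the kinetic energy integrable. -/
theorem sqrt_mul_le_add (a b : ℝ≥0∞) : (a * b) ^ (1 / 2 : ℝ) ≤ a + b := by
  have : a * b ≤ (a + b) ^ (2 : ℝ) := by
    rw [show (2 : ℝ) = ((2 : ℕ) : ℝ) by norm_num, ENNReal.rpow_natCast, sq]
    exact mul_le_mul' le_self_add le_add_self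
  calc (a * b) ^ (1 / 2 : ℝ) ≤ ((a + b) ^ (2 : ℝ)) ^ (1 / 2 : ℝ) :=
        ENNReal.rpow_le_rpow this (by norm_num)
    _ = a + b := by rw [← ENNReal.rpow_mul]; norm_num

theorem Feasible.lintegral_sqrt_kinetic_lt_top (h : Feasible P₀ P₁ p v) (hc : cost p v ≠ ⊤) :
    ∫⁻ t in Icc (0 : ℝ) 1, kinetic p v t ^ (1 / 2 : ℝ) ≠ ⊤ := by
  have hm : Integrable (fun t => ∫ x, ‖x‖ ^ 2 * p t x) (volume.restrict (Icc (0 : ℝ) 1)) := by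
    have h2 := h.secondMoment_integrable
    rw [IntegrableOn, volume_restrict_slab] at h2
    exact h2.integral_prod_left
  have hw : ∫⁻ t in Icc (0 : ℝ) 1, weightedKinetic p v t ≠ ⊤ := by
    intro htop
    exact hc (by rw [cost]; change 4 * ∫⁻ t in Icc (0 : ℝ) 1, weightedKinetic p v t = ⊤; rw [htop]; simp)
  refine ne_top_of_le_ne_top (ENNReal.add_ne_top.2 ⟨?_, hw⟩) ((lintegral_mono_ae ?_).trans_eq
    (lintegral_add_left' hm.aestronglyMeasurable.aemeasurable.ennreal_ofReal _))
  · exact hm.lintegral_lt_top.ne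
  · filter_upwards [h.ae_regularAt] with t ht
    exact (ENNReal.rpow_le_rpow ht.kinetic_le (by norm_num)).trans (sqrt_mul_le_add _ _)

/-- Cauchy-Schwarz in space at almost every time, followed by integration in time. -/
theorem Feasible.lintegral_flux_le (h : Feasible P₀ P₁ p v) {q : Vec n → Vec n}
    (hq : Continuous q) {Y : ℝ≥0∞} (hYtop : Y ≠ ⊤)
    (hY : ∀ t ∈ Icc (0 : ℝ) 1, ∫⁻ x, ‖q x‖ₑ ^ 2 ∂(law (p t)) ≤ Y) :
    ∫⁻ t in Icc (0 : ℝ) 1, ∫⁻ x, ‖q x‖ₑ * ‖v t x‖ₑ ∂(law (p t))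
      ≤ Y ^ (1 / 2 : ℝ) * ∫⁻ t in Icc (0 : ℝ) 1, kinetic p v t ^ (1 / 2 : ℝ) := by
  rw [← lintegral_const_mul' _ _ (ENNReal.rpow_ne_top_of_nonneg (by norm_num) hYtop)]
  refine lintegral_mono_ae ?_
  filter_upwards [h.ae_regularAt] with t ht
  have h1 := ENNReal.lintegral_mul_le_Lp_mul_Lq (law (p t)) Real.HolderConjugate.two_two
    (f := fun x => ‖q x‖ₑ) (g := fun x => ‖v t x‖ₑ) hq.enorm.aemeasurable
    (ht.velocity.mono_ac (law_absolutelyContinuous _)).enorm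
  refine h1.trans ?_
  simp only [ENNReal.rpow_two]
  gcongr
  · exact hY t ht.mem
  · exact le_rfl

theorem Feasible.enorm_integral_test_sub_le (h : Feasible P₀ P₁ p v) {ψ : Vec n → ℝ}
    (hψ : ContDiff ℝ ∞ ψ) (hc : HasCompactSupport ψ) {q : Vec n → Vec n} (hq : Continuous q)
    {c : ℝ} (hd : ∀ x w, |fderiv ℝ ψ x w| ≤ c * (‖q x‖ * ‖w‖)) (hc0 : 0 ≤ c)
    {t : ℝ} (ht : t ∈ Icc (0 : ℝ) 1) :
    ‖(∫ x, ψ x * p t x) - ∫ x, ψ x * p 0 x‖ₑ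
      ≤ ENNReal.ofReal c * ∫⁻ t in Icc (0 : ℝ) 1, ∫⁻ x, ‖q x‖ₑ * ‖v t x‖ₑ ∂(law (p t)) := by
  have h1 := h.integral_test_sub (isTest_of_hasCompactSupport hψ hc) ht
  simp only [fderiv_comp_snd hψ] at h1
  rw [h1, intervalIntegral.integral_of_le ht.1, ← lintegral_const_mul' _ _ ENNReal.ofReal_ne_top]
  refine (enorm_integral_le_lintegral_enorm _).trans ?_
  refine (lintegral_mono_set (t := Icc 0 1)
    (Ioc_subset_Icc_self.trans (Icc_subset_Icc_right ht.2))).trans ?_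
  refine lintegral_mono_ae ?_
  filter_upwards [h.ae_regularAt] with s hs
  refine (enorm_integral_le_lintegral_enorm _).trans ?_
  rw [lintegral_law hs.density (F := fun x => ‖q x‖ₑ * ‖v s x‖ₑ) (hq.enorm.aemeasurable.mul hs.velocity.enorm),
    ← lintegral_const_mul' _ _ ENNReal.ofReal_ne_top]
  refine lintegral_mono fun x => ?_
  simp only [← ofReal_norm]
  rw [← ENNReal.ofReal_mul (norm_nonneg _), ← ENNReal.ofReal_mul (hs.density.nonneg x),
    ← ENNReal.ofReal_mul hc0]
  refine ENNReal.ofReal_le_ofReal ?_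
  rw [norm_mul, Real.norm_of_nonneg (hs.density.nonneg x), Real.norm_eq_abs]
  calc _ ≤ p s x * (c * (‖q x‖ * ‖v s x‖)) :=
        mul_le_mul_of_nonneg_left (hd x (v s x)) (hs.density.nonneg x)
    _ = _ := by ring

/-- Keeping the factor `‖q x‖` on the right lets the flux be estimated by the truncated second
moment itself, which closes the bootstrap in `Feasible.exists_moment_bound`. -/
theorem abs_fderiv_norm_sq_le {q : Vec n → Vec n} (hq : ContDiff ℝ ∞ q) {C : ℝ}
    (hC : ∀ x, ‖fderiv ℝ q x‖ ≤ C) (x w : Vec n) :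
    |fderiv ℝ (fun x => ‖q x‖ ^ 2) x w| ≤ 2 * C * (‖q x‖ * ‖w‖) := by
  have h := ((hq.differentiable (by norm_num)) x).hasFDerivAt.norm_sq
  rw [h.fderiv]
  simp only [smul_apply, ContinuousLinearMap.comp_apply, innerSL_apply_apply, nsmul_eq_mul]
  rw [abs_mul]
  have h1 := abs_real_inner_le_norm (q x) (fderiv ℝ q x w)
  have h2 : ‖fderiv ℝ q x w‖ ≤ C * ‖w‖ := (fderiv ℝ q x).le_of_opNorm_le (hC x) w
  have h3 : |((2 : ℕ) : ℝ)| = 2 := by norm_num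
  rw [h3]
  calc _ ≤ 2 * (‖q x‖ * (C * ‖w‖)) := by gcongr; exact h1.trans (by gcongr)
    _ = _ := by ring

theorem lintegral_enorm_sq_law {f : Vec n → ℝ} (hf : IsProbDensity f) {q : Vec n → Vec n}
    (hq : Continuous q) (hi : Integrable fun x => ‖q x‖ ^ 2 * f x) :
    ∫⁻ x, ‖q x‖ₑ ^ 2 ∂(law f) = ENNReal.ofReal (∫ x, ‖q x‖ ^ 2 * f x) := by
  rw [lintegral_law hf (hq.enorm.measurable.pow_const 2).aemeasurable, ofReal_integral_eq_lintegral_ofReal hi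
    (Filter.Eventually.of_forall fun x => mul_nonneg (sq_nonneg _) (hf.nonneg x))]
  refine lintegral_congr fun x => ?_
  rw [← ofReal_norm, ← ENNReal.ofReal_pow (norm_nonneg _), ← ENNReal.ofReal_mul (hf.nonneg x),
    mul_comm]

/-- A bootstrap on truncated moments. Their maximum `Y` over time is finite, and their variation is
at most a multiple of `√Y` times the time integral of the root kinetic energy. This bounds `Y`
independently of the truncation, and Fatou's lemma removes the cutoff. -/
theorem Feasible.exists_moment_bound (h : Feasible P₀ P₁ p v) (hc : cost p v ≠ ⊤) :
    ∃ K : ℝ, 0 ≤ K ∧ ∀ t ∈ Icc (0 : ℝ) 1, ∫⁻ x, ‖x‖ₑ ^ 2 ∂(law (p t)) ≤ ENNReal.ofReal K := by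
  obtain ⟨C, q, hC, hq⟩ := exists_cutoff n
  have : (ae (volume.restrict (Icc (0 : ℝ) 1))).NeBot := by
    rw [ae_neBot, Ne, Measure.restrict_eq_zero]; simp
  -- The second moment is known to be finite only at almost every time; one such time anchors the
  -- estimate.
  obtain ⟨t₀, ht₀⟩ := h.ae_regularAt.exists
  set m₀ := ∫ x, ‖x‖ ^ 2 * p t₀ x with hm₀
  set I := (∫⁻ t in Icc (0 : ℝ) 1, kinetic p v t ^ (1 / 2 : ℝ)).toReal with hI
  have hIe : ∫⁻ t in Icc (0 : ℝ) 1, kinetic p v t ^ (1 / 2 : ℝ) = ENNReal.ofReal I :=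
    (ENNReal.ofReal_toReal (h.lintegral_sqrt_kinetic_lt_top hc)).symm
  have hI0 : 0 ≤ I := ENNReal.toReal_nonneg
  have hm0 : 0 ≤ m₀ := integral_nonneg fun x => mul_nonneg (sq_nonneg _) (ht₀.density.nonneg x)
  refine ⟨2 * m₀ + 16 * C ^ 2 * I ^ 2, by positivity, ?_⟩
  have key : ∀ k, ∀ t ∈ Icc (0 : ℝ) 1, ∫⁻ x, ‖q k x‖ₑ ^ 2 ∂(law (p t))
      ≤ ENNReal.ofReal (2 * m₀ + 16 * C ^ 2 * I ^ 2) := by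
    intro k
    obtain ⟨q1, q2, q3, q4, -⟩ := hq k
    have hψ : ContDiff ℝ ∞ fun x => ‖q k x‖ ^ 2 := q1.norm_sq ℝ
    have hψc : HasCompactSupport fun x => ‖q k x‖ ^ 2 :=
      q2.comp_left (g := fun y : Vec n => ‖y‖ ^ 2) (by simp)
    have hT := isTest_of_hasCompactSupport hψ hψc
    obtain ⟨N, -, hN, -⟩ := hT.exists_bound
    have hi : ∀ t ∈ Icc (0 : ℝ) 1, Integrable fun x => ‖q k x‖ ^ 2 * p t x := fun t ht =>
      (h.density t ht).integrable_mul hψ.continuous (hN t ht)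
    obtain ⟨ts, hts, hmax⟩ := isCompact_Icc.exists_isMaxOn (nonempty_Icc.2 zero_le_one)
      (hT.continuousOn_integral h.density h.narrow)
    set Y := ∫ x, ‖q k x‖ ^ 2 * p ts x with hY
    have hY0 : 0 ≤ Y := integral_nonneg fun x =>
      mul_nonneg (sq_nonneg _) ((h.density ts hts).nonneg x)
    have hle : ∀ t ∈ Icc (0 : ℝ) 1, ∫⁻ x, ‖q k x‖ₑ ^ 2 ∂(law (p t)) ≤ ENNReal.ofReal Y := by
      intro t ht
      rw [lintegral_enorm_sq_law (h.density t ht) q1.continuous (hi t ht)]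
      exact ENNReal.ofReal_le_ofReal (hmax ht)
    have hflux := h.lintegral_flux_le q1.continuous ENNReal.ofReal_ne_top hle
    rw [hIe, ENNReal.ofReal_rpow_of_nonneg hY0 (by norm_num), ← Real.sqrt_eq_rpow,
      ← ENNReal.ofReal_mul (Real.sqrt_nonneg _)] at hflux
    have hdiff : ∀ t ∈ Icc (0 : ℝ) 1,
        |(∫ x, ‖q k x‖ ^ 2 * p t x) - ∫ x, ‖q k x‖ ^ 2 * p 0 x| ≤ 2 * C * (√Y * I) := by
      intro t ht
      have h1 := (h.enorm_integral_test_sub_le hψ hψc q1.continuous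
        (abs_fderiv_norm_sq_le q1 q4) (by positivity) ht).trans (mul_le_mul_right hflux _)
      rw [← ENNReal.ofReal_mul (by positivity), ← ofReal_norm,
        ENNReal.ofReal_le_ofReal_iff (by positivity)] at h1
      exact h1
    have hq0 : ∫ x, ‖q k x‖ ^ 2 * p t₀ x ≤ m₀ := by
      refine integral_mono (hi t₀ ht₀.mem) ht₀.moment fun x => ?_
      have := ht₀.density.nonneg x
      have := q3 x
      dsimp only
      gcongr
    have a1 := abs_le.1 (hdiff ts hts)
    have a2 := abs_le.1 (hdiff t₀ ht₀.mem)
    have hs := Real.sq_sqrt hY0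
    -- Comparing `ts` and `t₀` through time `0` gives `Y ≤ m₀ + 4 * C * I * √Y`; the square absorbs
    -- half of `Y`.
    have hYle : Y ≤ 2 * m₀ + 16 * C ^ 2 * I ^ 2 := by
      nlinarith [sq_nonneg (√Y - 4 * C * I)]
    intro t ht
    exact (hle t ht).trans (ENNReal.ofReal_le_ofReal hYle)
  intro t ht
  have hlim : ∀ x : Vec n, Filter.liminf (fun k => ‖q k x‖ₑ ^ 2) Filter.atTop = ‖x‖ₑ ^ 2 := by
    intro x
    refine Filter.Tendsto.liminf_eq (tendsto_const_nhds.congr' ?_)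
    obtain ⟨k₀, hk₀⟩ := exists_nat_gt ‖x‖
    filter_upwards [Filter.eventually_ge_atTop k₀] with k hk
    rw [(hq k).2.2.2.2 x]
    rw [mem_ball_zero_iff]
    have : (k₀ : ℝ) ≤ k := by exact_mod_cast hk
    linarith
  calc ∫⁻ x, ‖x‖ₑ ^ 2 ∂(law (p t))
      = ∫⁻ x, Filter.liminf (fun k => ‖q k x‖ₑ ^ 2) Filter.atTop ∂(law (p t)) := by
        simp only [hlim]
    _ ≤ Filter.liminf (fun k => ∫⁻ x, ‖q k x‖ₑ ^ 2 ∂(law (p t))) Filter.atTop :=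
        lintegral_liminf_le fun k => (hq k).1.continuous.enorm.measurable.pow_const 2
    _ ≤ _ := by
        refine Filter.liminf_le_of_le (by isBoundedDefault) fun b hb => ?_
        obtain ⟨k, hk⟩ := hb.exists
        exact hk.trans (key k t ht)

theorem Feasible.integrable_moment (h : Feasible P₀ P₁ p v) (hc : cost p v ≠ ⊤) {t : ℝ}
    (ht : t ∈ Icc (0 : ℝ) 1) : Integrable fun x : Vec n => ‖x‖ ^ 2 * p t x := by
  obtain ⟨K, -, hK⟩ := h.exists_moment_bound hc
  have hp := h.density t ht
  refine ⟨(by fun_prop : Continuous fun x : Vec n => ‖x‖ ^ 2).aestronglyMeasurable.mul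
    hp.integrable.aestronglyMeasurable, ?_⟩
  refine lt_of_le_of_lt ?_ ((hK t ht).trans_lt ENNReal.ofReal_lt_top)
  rw [lintegral_law hp (continuous_enorm.measurable.pow_const 2).aemeasurable]
  refine lintegral_mono fun x => ?_
  rw [enorm_mul, enorm_pow, enorm_norm, mul_comm, Real.enorm_of_nonneg (hp.nonneg x)]

theorem Feasible.integrable_flux (h : Feasible P₀ P₁ p v) (hc : cost p v ≠ ⊤) :
    Integrable (fun z : ℝ × Vec n => p z.1 z.2 * (‖z.2‖ * ‖v z.1 z.2‖))
      ((volume.restrict (Icc (0 : ℝ) 1)).prod volume) := by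
  obtain ⟨K, -, hK⟩ := h.exists_moment_bound hc
  have hm : AEStronglyMeasurable (fun z : ℝ × Vec n => p z.1 z.2 * (‖z.2‖ * ‖v z.1 z.2‖))
      ((volume.restrict (Icc (0 : ℝ) 1)).prod volume) :=
    h.aestronglyMeasurable_density.mul
      ((by fun_prop : Continuous fun z : ℝ × Vec n => ‖z.2‖).aestronglyMeasurable.mul
        h.aestronglyMeasurable_velocity.norm)
  refine ⟨hm, ?_⟩
  rw [HasFiniteIntegral, lintegral_prod _ hm.enorm]
  have hfin := h.lintegral_flux_le continuous_id ENNReal.ofReal_ne_top hK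
  refine lt_of_le_of_lt ?_ (hfin.trans_lt (ENNReal.mul_lt_top
    (ENNReal.rpow_lt_top_of_nonneg (by norm_num) ENNReal.ofReal_ne_top)
    (h.lintegral_sqrt_kinetic_lt_top hc).lt_top))
  refine lintegral_mono_ae ?_
  filter_upwards [h.ae_regularAt] with t ht
  rw [lintegral_law ht.density (F := fun x => ‖id x‖ₑ * ‖v t x‖ₑ) (continuous_id.enorm.aemeasurable.mul ht.velocity.enorm)]
  refine lintegral_mono fun x => ?_
  simp only [enorm_mul, enorm_norm, Real.enorm_of_nonneg (ht.density.nonneg x), id]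
  exact le_rfl

/-- The time derivative of the matrix of second moments. -/
def momentRate (p : ℝ → Vec n → ℝ) (v : ℝ → Vec n → Vec n) (t : ℝ) : Mat n :=
  Matrix.of fun i j => ∫ x, p t x * (v t x i * x j + x i * v t x j)

theorem Feasible.integrable_momentRate (h : Feasible P₀ P₁ p v) (hc : cost p v ≠ ⊤)
    (i j : Fin n) :
    Integrable (fun z : ℝ × Vec n => p z.1 z.2 * (v z.1 z.2 i * z.2 j + z.2 i * v z.1 z.2 j))
      ((volume.restrict (Icc (0 : ℝ) 1)).prod volume) := by
  have hcoord : ∀ i : Fin n, AEStronglyMeasurable (fun z : ℝ × Vec n => v z.1 z.2 i)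
      ((volume.restrict (Icc (0 : ℝ) 1)).prod volume) := fun i =>
    (EuclideanSpace.proj i : Vec n →L[ℝ] ℝ).continuous.comp_aestronglyMeasurable
      h.aestronglyMeasurable_velocity
  have hx : ∀ i : Fin n, AEStronglyMeasurable (fun z : ℝ × Vec n => z.2 i)
      ((volume.restrict (Icc (0 : ℝ) 1)).prod volume) := fun i =>
    (by fun_prop : Continuous fun z : ℝ × Vec n => z.2 i).aestronglyMeasurable
  refine ((h.integrable_flux hc).const_mul 2).mono' (h.aestronglyMeasurable_density.mul
    (((hcoord i).mul (hx j)).add ((hx i).mul (hcoord j)))) ?_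
  have hmem : ∀ᵐ z ∂((volume.restrict (Icc (0 : ℝ) 1)).prod (volume : Measure (Vec n))),
      z.1 ∈ Icc (0 : ℝ) 1 :=
    Measure.quasiMeasurePreserving_fst.ae (ae_restrict_mem measurableSet_Icc)
  filter_upwards [hmem] with z hz
  have h0 := (h.density z.1 hz).nonneg z.2
  have h1 := abs_apply_mul_apply_le (v z.1 z.2) z.2 i j
  have h2 := abs_apply_mul_apply_le z.2 (v z.1 z.2) i j
  rw [norm_mul, Real.norm_of_nonneg h0, Real.norm_eq_abs]
  calc _ ≤ p z.1 z.2 * (2 * (‖z.2‖ * ‖v z.1 z.2‖)) := by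
        refine mul_le_mul_of_nonneg_left ((abs_add_le _ _).trans ?_) h0
        rw [mul_comm ‖v z.1 z.2‖] at h1
        linarith
    _ = _ := by ring

/-- The identity holds for the truncated coordinates `q k`. The limit in `k` is dominated by `‖x‖ ^
2 * p` on the left and by the integrable flux `p ‖x‖ ‖v‖` on the right. -/
theorem Feasible.secondMoment_sub (h : Feasible P₀ P₁ p v) (hc : cost p v ≠ ⊤) {t : ℝ}
    (ht : t ∈ Icc (0 : ℝ) 1) (i j : Fin n) :
    secondMoment (p t) i j - secondMoment (p 0) i j
      = ∫ s in (0 : ℝ)..t, momentRate p v s i j := by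
  obtain ⟨C, q, hC, hq⟩ := exists_cutoff n
  have hev : ∀ x : Vec n, ∀ᶠ k in Filter.atTop, x ∈ Metric.ball (0 : Vec n) ((k : ℕ) + 1) := by
    intro x
    obtain ⟨k₀, hk₀⟩ := exists_nat_gt ‖x‖
    filter_upwards [Filter.eventually_ge_atTop k₀] with k hk
    rw [mem_ball_zero_iff]
    have : (k₀ : ℝ) ≤ k := by exact_mod_cast hk
    linarith
  have hψ : ∀ k, ContDiff ℝ ∞ fun x => q k x i * q k x j := fun k =>
    ((EuclideanSpace.proj i : Vec n →L[ℝ] ℝ).contDiff.comp (hq k).1).mul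
      ((EuclideanSpace.proj j : Vec n →L[ℝ] ℝ).contDiff.comp (hq k).1)
  have hψc : ∀ k, HasCompactSupport fun x => q k x i * q k x j := fun k =>
    (hq k).2.1.comp_left (g := fun y : Vec n => y i * y j) (by simp)
  have hder : ∀ k x w, fderiv ℝ (fun x => q k x i * q k x j) x w
      = fderiv ℝ (q k) x w i * q k x j + q k x i * fderiv ℝ (q k) x w j := by
    intro k x w
    have hd := (((hq k).1.differentiable (by norm_num)) x).hasFDerivAt
    have h1 : ∀ i : Fin n, HasFDerivAt (fun x => q k x i) _ x := fun i =>
      (EuclideanSpace.proj i : Vec n →L[ℝ] ℝ).hasFDerivAt.comp x hd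
    rw [((h1 i).fun_mul (h1 j)).fderiv]
    simp
    ring
  have hbound : ∀ k x w, |fderiv ℝ (fun x => q k x i * q k x j) x w|
      ≤ 2 * C * (‖x‖ * ‖w‖) := by
    intro k x w
    have h1 := abs_apply_mul_apply_le (fderiv ℝ (q k) x w) (q k x) i j
    have h2 := abs_apply_mul_apply_le (q k x) (fderiv ℝ (q k) x w) i j
    have h3 : ‖fderiv ℝ (q k) x w‖ ≤ C * ‖w‖ :=
      (fderiv ℝ (q k) x).le_of_opNorm_le ((hq k).2.2.2.1 x) w
    have h4 := mul_le_mul ((hq k).2.2.1 x) h3 (norm_nonneg _) (norm_nonneg _)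
    rw [hder]
    rw [mul_comm ‖fderiv ℝ (q k) x w‖] at h1
    refine (abs_add_le _ _).trans ?_
    linarith
  have hlhs : ∀ s ∈ Icc (0 : ℝ) 1, Filter.Tendsto (fun k => ∫ x, q k x i * q k x j * p s x)
      Filter.atTop (nhds (secondMoment (p s) i j)) := by
    intro s hs
    have hp := h.density s hs
    refine tendsto_integral_of_dominated_convergence (fun x => ‖x‖ ^ 2 * p s x) ?_
      (h.integrable_moment hc hs) ?_ ?_
    · exact fun k => (hψ k).continuous.aestronglyMeasurable.mul hp.integrable.aestronglyMeasurable
    · refine fun k => Filter.Eventually.of_forall fun x => ?_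
      rw [norm_mul, Real.norm_of_nonneg (hp.nonneg x), Real.norm_eq_abs]
      refine mul_le_mul_of_nonneg_right ((abs_apply_mul_apply_le _ _ _ _).trans ?_) (hp.nonneg x)
      rw [sq]
      exact mul_le_mul ((hq k).2.2.1 x) ((hq k).2.2.1 x) (norm_nonneg _) (norm_nonneg _)
    · refine Filter.Eventually.of_forall fun x => tendsto_const_nhds.congr' ?_
      filter_upwards [hev x] with k hk
      rw [(hq k).2.2.2.2 x hk]
  have h0 : (0 : ℝ) ∈ Icc (0 : ℝ) 1 := by simp
  have hflux := h.integrable_flux hc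
  have hsub : Ioc 0 t ⊆ Icc (0 : ℝ) 1 := Ioc_subset_Icc_self.trans (Icc_subset_Icc_right ht.2)
  have hae : ∀ {Q : ℝ → Prop}, (∀ᵐ s ∂(volume.restrict (Icc (0 : ℝ) 1)), Q s) →
      ∀ᵐ s ∂(volume : Measure ℝ), s ∈ Set.uIoc 0 t → Q s := by
    intro Q hQ
    rw [uIoc_of_le ht.1, ← ae_restrict_iff' measurableSet_Ioc]
    exact ae_restrict_of_ae_restrict_of_subset hsub hQ
  refine tendsto_nhds_unique ((hlhs t ht).sub (hlhs 0 h0)) ?_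
  have hid : ∀ k, (∫ x, q k x i * q k x j * p t x) - ∫ x, q k x i * q k x j * p 0 x
      = ∫ s in (0 : ℝ)..t, ∫ x, p s x * fderiv ℝ (fun x => q k x i * q k x j) x (v s x) := by
    intro k
    have := h.integral_test_sub (isTest_of_hasCompactSupport (hψ k) (hψc k)) ht
    simpa only [fderiv_comp_snd (hψ k)] using this
  simp only [hid]
  refine intervalIntegral.tendsto_integral_filter_of_dominated_convergence
    (fun s => 2 * C * ∫ x, p s x * (‖x‖ * ‖v s x‖)) ?_ ?_ ?_ ?_
  · refine Filter.Eventually.of_forall fun k => ?_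
    have := (h.integrable_test (isTest_of_hasCompactSupport (hψ k) (hψc k))).integral_prod_left
    simp only [fderiv_comp_snd (hψ k)] at this
    rw [uIoc_of_le ht.1]
    exact this.aestronglyMeasurable.mono_measure (Measure.restrict_mono hsub le_rfl)
  · refine Filter.Eventually.of_forall fun k => hae ?_
    filter_upwards [h.ae_regularAt, hflux.prod_right_ae] with s hs hs2
    rw [← integral_const_mul]
    refine norm_integral_le_of_norm_le (hs2.const_mul (2 * C))
      (Filter.Eventually.of_forall fun x => ?_)
    rw [norm_mul, Real.norm_of_nonneg (hs.density.nonneg x), Real.norm_eq_abs]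
    calc _ ≤ p s x * (2 * C * (‖x‖ * ‖v s x‖)) :=
          mul_le_mul_of_nonneg_left (hbound k x _) (hs.density.nonneg x)
      _ = _ := by ring
  · rw [intervalIntegrable_iff_integrableOn_Ioc_of_le ht.1]
    exact (hflux.integral_prod_left.const_mul (2 * C)).mono_measure
      (Measure.restrict_mono hsub le_rfl)
  · refine hae ?_
    filter_upwards [h.ae_regularAt, hflux.prod_right_ae] with s hs hs2
    refine tendsto_integral_of_dominated_convergence
      (fun x => 2 * C * (p s x * (‖x‖ * ‖v s x‖))) ?_ (hs2.const_mul (2 * C)) ?_ ?_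
    · intro k
      refine hs.density.integrable.aestronglyMeasurable.mul ?_
      have hcc : Continuous fun w : Vec n × Vec n =>
          fderiv ℝ (fun x => q k x i * q k x j) w.1 w.2 :=
        (((hψ k).continuous_fderiv (by norm_num)).comp continuous_fst).clm_apply continuous_snd
      exact hcc.comp_aestronglyMeasurable (aestronglyMeasurable_id.prodMk hs.velocity)
    · refine fun k => Filter.Eventually.of_forall fun x => ?_
      rw [norm_mul, Real.norm_of_nonneg (hs.density.nonneg x), Real.norm_eq_abs]
      calc _ ≤ p s x * (2 * C * (‖x‖ * ‖v s x‖)) :=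
            mul_le_mul_of_nonneg_left (hbound k x _) (hs.density.nonneg x)
        _ = _ := by ring
    · refine Filter.Eventually.of_forall fun x => tendsto_const_nhds.congr' ?_
      filter_upwards [hev x] with k hk
      -- Convergence of the derivative requires equality with the identity near `x`, which the open
      -- ball supplies.
      have hqid : q k =ᶠ[nhds x] fun y => y := by
        filter_upwards [Metric.isOpen_ball.mem_nhds hk] with y hy using (hq k).2.2.2.2 y hy
      rw [hder, hqid.fderiv_eq, hqid.eq_of_nhds]
      simp

end

/-! ### The calibration inequality -/

theorem weightedSq_eq_sum (W : Mat n) (y : Vec n) :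
    weightedSq W y = ∑ i, ∑ j, W i j * (y i * y j) := by
  simp only [weightedSq, dotProduct, Matrix.mulVec, Finset.mul_sum]
  exact Finset.sum_congr rfl fun i _ => Finset.sum_congr rfl fun j _ => by ring

/-- Completing the square; in the cross term `P⁻¹` cancels the factor `P`, leaving a form linear in
`G`. -/
theorem weightedSq_sub {P G : Mat n} (hP : P.PosDef) (hG : Gᵀ = G) (x w : Vec n) :
    weightedSq P⁻¹ (w - linField ((1 / 2 : ℝ) • (P * G)) x)
      = weightedSq P⁻¹ w - w.ofLp ⬝ᵥ G *ᵥ x.ofLp + (1 / 4) * weightedSq (G * P * G) x := by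
  have hdet := (Matrix.isUnit_iff_isUnit_det _).1 hP.isUnit
  have hPt : Pᵀ = P := by
    have := hP.isHermitian.eq
    rwa [Matrix.conjTranspose_eq_transpose_of_trivial] at this
  have hPit : P⁻¹ᵀ = P⁻¹ := by rw [Matrix.transpose_nonsing_inv, hPt]
  have h1 : P⁻¹ *ᵥ ((1 / 2 : ℝ) • (P * G)) *ᵥ x.ofLp = (1 / 2 : ℝ) • (G *ᵥ x.ofLp) := by
    rw [Matrix.mulVec_mulVec, Matrix.mul_smul, ← Matrix.mul_assoc, Matrix.nonsing_inv_mul _ hdet,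
      Matrix.one_mul, Matrix.smul_mulVec]
  have h2 : ((1 / 2 : ℝ) • (P * G)) *ᵥ x.ofLp ⬝ᵥ P⁻¹ *ᵥ w.ofLp
      = (1 / 2 : ℝ) * (w.ofLp ⬝ᵥ G *ᵥ x.ofLp) := by
    rw [Matrix.dotProduct_mulVec, ← Matrix.mulVec_transpose, hPit, h1, smul_dotProduct,
      dotProduct_comm, smul_eq_mul]
  have h3 : ((1 / 2 : ℝ) • (P * G)) *ᵥ x.ofLp ⬝ᵥ G *ᵥ x.ofLp
      = (1 / 2 : ℝ) * weightedSq (G * P * G) x := by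
    rw [Matrix.smul_mulVec, smul_dotProduct, weightedSq, dotProduct_comm,
      ← Matrix.vecMul_transpose G, hG, ← Matrix.dotProduct_mulVec, Matrix.mulVec_mulVec,
      Matrix.mul_assoc, smul_eq_mul]
  simp only [weightedSq, linField, WithLp.ofLp_sub, Matrix.mulVec_sub, sub_dotProduct,
    dotProduct_sub, h1, h2, dotProduct_smul, h3, smul_eq_mul]
  ring

section

variable {P₀ P₁ : Mat n} {p : ℝ → Vec n → ℝ} {v : ℝ → Vec n → Vec n}

theorem RegularAt.integrable_apply_mul {t : ℝ} (h : RegularAt p v t)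
    (hk : kinetic p v t ≠ ⊤) (i j : Fin n) :
    Integrable fun x => v t x i * v t x j * p t x := by
  have hcoord : ∀ i : Fin n, AEStronglyMeasurable (fun x => v t x i) volume := fun i =>
    (EuclideanSpace.proj i : Vec n →L[ℝ] ℝ).continuous.comp_aestronglyMeasurable h.velocity
  refine ⟨((hcoord i).mul (hcoord j)).mul h.density.integrable.aestronglyMeasurable, ?_⟩
  refine lt_of_le_of_lt ?_ hk.lt_top
  rw [kinetic, lintegral_law h.density (h.velocity.enorm.pow_const 2)]
  refine lintegral_mono fun x => ?_
  simp only [← ofReal_norm]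
  rw [← ENNReal.ofReal_pow (norm_nonneg _), ← ENNReal.ofReal_mul (h.density.nonneg x), norm_mul,
    Real.norm_of_nonneg (h.density.nonneg x), mul_comm, Real.norm_eq_abs, sq]
  exact ENNReal.ofReal_le_ofReal
    (mul_le_mul_of_nonneg_left (abs_apply_mul_apply_le _ _ i j) (h.density.nonneg x))

theorem RegularAt.kinetic_ne_top {t : ℝ} (h : RegularAt p v t)
    (hw : weightedKinetic p v t ≠ ⊤) : kinetic p v t ≠ ⊤ :=
  ne_top_of_le_ne_top (ENNReal.mul_ne_top ENNReal.ofReal_ne_top hw) h.kinetic_le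

theorem RegularAt.integrable_weightedSq {t : ℝ} (h : RegularAt p v t)
    (hk : kinetic p v t ≠ ⊤) (W : Mat n) :
    Integrable fun x => weightedSq W (v t x) * p t x := by
  simp only [weightedSq_eq_sum, Finset.sum_mul, mul_assoc]
  refine integrable_finsetSum _ fun i _ => integrable_finsetSum _ fun j _ => ?_
  simpa only [mul_assoc] using (h.integrable_apply_mul hk i j).const_mul (W i j)

theorem integral_weightedSq_id {f : Vec n → ℝ} (hf : IsProbDensity f)
    (h2 : Integrable fun x : Vec n => ‖x‖ ^ 2 * f x) (W : Mat n) :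
    Integrable (fun x => weightedSq W x * f x) ∧
      ∫ x, weightedSq W x * f x = (W * secondMoment f).trace := by
  have hi : ∀ i j, Integrable fun x : Vec n => W i j * (x i * x j) * f x := fun i j => by
    simpa only [mul_assoc] using (integrable_apply_mul_apply hf h2 i j).const_mul (W i j)
  simp only [weightedSq_eq_sum, Finset.sum_mul]
  refine ⟨integrable_finsetSum _ fun i _ => integrable_finsetSum _ fun j _ => hi i j, ?_⟩
  rw [integral_finsetSum _ fun i _ => integrable_finsetSum _ fun j _ => hi i j]
  simp only [Matrix.trace, Matrix.diag_apply, Matrix.mul_apply]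
  refine Finset.sum_congr rfl fun i _ => ?_
  rw [integral_finsetSum _ fun j _ => hi i j]
  refine Finset.sum_congr rfl fun j _ => ?_
  rw [secondMoment, Matrix.of_apply, ← integral_const_mul]
  refine integral_congr_ae (Filter.Eventually.of_forall fun x => ?_)
  simp only
  ring

/-- Symmetry of `G` allows `v x'` to be replaced by half of `v x' + x v'`, the integrand of the
moment rate. -/
theorem integral_cross {t : ℝ}
    (hi : ∀ i j, Integrable fun x => p t x * (v t x i * x j + x i * v t x j))
    {G : Mat n} (hG : Gᵀ = G) :
    Integrable (fun x => ((v t x).ofLp ⬝ᵥ G *ᵥ x.ofLp) * p t x) ∧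
      ∫ x, ((v t x).ofLp ⬝ᵥ G *ᵥ x.ofLp) * p t x = (1 / 2) * (G * momentRate p v t).trace := by
  have e : ∀ x, ((v t x).ofLp ⬝ᵥ G *ᵥ x.ofLp) * p t x
      = ∑ i, ∑ j, (1 / 2) * G i j * (p t x * (v t x j * x i + x j * v t x i)) := by
    intro x
    have h1 : (v t x).ofLp ⬝ᵥ G *ᵥ x.ofLp = ∑ i, ∑ j, G i j * (v t x i * x j) := by
      simp only [dotProduct, Matrix.mulVec, Finset.mul_sum]
      exact Finset.sum_congr rfl fun i _ => Finset.sum_congr rfl fun j _ => by ring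
    have h2 : (v t x).ofLp ⬝ᵥ G *ᵥ x.ofLp = ∑ i, ∑ j, G i j * (v t x j * x i) := by
      rw [h1, Finset.sum_comm]
      refine Finset.sum_congr rfl fun i _ => Finset.sum_congr rfl fun j _ => ?_
      rw [← Matrix.transpose_apply G, hG]
    have h3 : (v t x).ofLp ⬝ᵥ G *ᵥ x.ofLp
        = (1 / 2) * ∑ i, ∑ j, G i j * (v t x j * x i) + (1 / 2) * ∑ i, ∑ j, G i j * (v t x i * x j) := by
      linarith
    rw [h3]
    simp only [Finset.mul_sum, ← Finset.sum_add_distrib, Finset.sum_mul]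
    exact Finset.sum_congr rfl fun i _ => Finset.sum_congr rfl fun j _ => by ring
  simp only [e]
  have hi' : ∀ i j, Integrable fun x =>
      (1 / 2) * G i j * (p t x * (v t x j * x i + x j * v t x i)) :=
    fun i j => (hi j i).const_mul _
  refine ⟨integrable_finsetSum _ fun i _ => integrable_finsetSum _ fun j _ => hi' i j, ?_⟩
  rw [integral_finsetSum _ fun i _ => integrable_finsetSum _ fun j _ => hi' i j]
  simp only [Matrix.trace, Matrix.diag_apply, Matrix.mul_apply, Finset.mul_sum]
  refine Finset.sum_congr rfl fun i _ => ?_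
  rw [integral_finsetSum _ fun j _ => hi' i j]
  refine Finset.sum_congr rfl fun j _ => ?_
  rw [integral_const_mul, momentRate, Matrix.of_apply]
  ring

/-- The weighted energy at time `t`, as a real number. -/
def energy (p : ℝ → Vec n → ℝ) (v : ℝ → Vec n → Vec n) (t : ℝ) : ℝ :=
  ∫ x, weightedSq (secondMoment (p t))⁻¹ (v t x) * p t x

/-- The weighted energy of the difference between the velocity and the linear field
`x ↦ (1/2) P_t G x`. -/
def defect (p : ℝ → Vec n → ℝ) (v : ℝ → Vec n → Vec n) (G : Mat n) (t : ℝ) : ℝ :=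
  ∫ x, weightedSq (secondMoment (p t))⁻¹
    (v t x - linField ((1 / 2 : ℝ) • (secondMoment (p t) * G)) x) * p t x

theorem weightedSq_nonneg {W : Mat n} (hW : W.PosSemidef) (y : Vec n) : 0 ≤ weightedSq W y := by
  have := hW.dotProduct_mulVec_nonneg y.ofLp
  rwa [star_trivial] at this

theorem RegularAt.weightedKinetic_eq {t : ℝ} (h : RegularAt p v t)
    (hk : kinetic p v t ≠ ⊤) : weightedKinetic p v t = ENNReal.ofReal (energy p v t) := by
  have hP := (secondMoment_posDef h.density h.moment).inv.posSemidef
  have hi := h.integrable_weightedSq hk (secondMoment (p t))⁻¹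
  have hcoord : ∀ i : Fin n, AEMeasurable (fun x => v t x i) volume := fun i =>
    ((EuclideanSpace.proj i : Vec n →L[ℝ] ℝ).continuous.comp_aestronglyMeasurable
      h.velocity).aemeasurable
  have hm : AEMeasurable (fun x => weightedSq (secondMoment (p t))⁻¹ (v t x)) volume := by
    simp only [weightedSq_eq_sum]
    exact Finset.aemeasurable_fun_sum _ fun i _ => Finset.aemeasurable_fun_sum _ fun j _ =>
      ((hcoord i).mul (hcoord j)).const_mul _
  rw [weightedKinetic, energy, lintegral_law h.density hm.ennreal_ofReal,
    ofReal_integral_eq_lintegral_ofReal hi (Filter.Eventually.of_forall fun x =>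
      mul_nonneg (weightedSq_nonneg hP _) (h.density.nonneg x))]
  refine lintegral_congr fun x => ?_
  rw [mul_comm, ENNReal.ofReal_mul (weightedSq_nonneg hP _)]

/-- `weightedSq_sub` averaged over the density: the cross term becomes a derivative of the second
moments and the last term depends on them alone. -/
theorem RegularAt.energy_eq {t : ℝ} (h : RegularAt p v t) (hk : kinetic p v t ≠ ⊤)
    (hi : ∀ i j, Integrable fun x => p t x * (v t x i * x j + x i * v t x j))
    {G : Mat n} (hG : Gᵀ = G) :
    Integrable (fun x => weightedSq (secondMoment (p t))⁻¹
      (v t x - linField ((1 / 2 : ℝ) • (secondMoment (p t) * G)) x) * p t x) ∧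
    energy p v t = defect p v G t + (1 / 2) * (G * momentRate p v t).trace
      - (1 / 4) * (G * secondMoment (p t) * (G * secondMoment (p t))).trace := by
  have hP := secondMoment_posDef h.density h.moment
  obtain ⟨c1, c2⟩ := integral_cross hi hG
  obtain ⟨d1, d2⟩ := integral_weightedSq_id h.density h.moment (G * secondMoment (p t) * G)
  have hw := h.integrable_weightedSq hk (secondMoment (p t))⁻¹
  have e : ∀ x, weightedSq (secondMoment (p t))⁻¹
      (v t x - linField ((1 / 2 : ℝ) • (secondMoment (p t) * G)) x) * p t x
      = weightedSq (secondMoment (p t))⁻¹ (v t x) * p t x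
        - ((v t x).ofLp ⬝ᵥ G *ᵥ x.ofLp) * p t x
        + (1 / 4) * (weightedSq (G * secondMoment (p t) * G) x * p t x) := by
    intro x
    rw [weightedSq_sub hP hG]
    ring
  constructor
  · simp only [e]
    exact (hw.sub c1).add (d1.const_mul _)
  · have hwc : Integrable fun x => weightedSq (secondMoment (p t))⁻¹ (v t x) * p t x
        - ((v t x).ofLp ⬝ᵥ G *ᵥ x.ofLp) * p t x := hw.sub c1
    rw [defect]
    simp only [e]
    rw [integral_add hwc (d1.const_mul _), integral_sub hw c1, integral_const_mul, c2, d2,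
      energy]
    simp only [Matrix.mul_assoc]
    ring

theorem Feasible.ae_integrable_momentRate (h : Feasible P₀ P₁ p v) (hc : cost p v ≠ ⊤) :
    ∀ᵐ t ∂(volume.restrict (Icc (0 : ℝ) 1)), ∀ i j,
      Integrable fun x => p t x * (v t x i * x j + x i * v t x j) :=
  ae_all_iff.2 fun i => ae_all_iff.2 fun j => (h.integrable_momentRate hc i j).prod_right_ae

theorem Feasible.integrableOn_momentRate (h : Feasible P₀ P₁ p v) (hc : cost p v ≠ ⊤)
    (i j : Fin n) : IntegrableOn (fun t => momentRate p v t i j) (Icc 0 1) :=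
  (h.integrable_momentRate hc i j).integral_prod_left

/-- The second moments, extended to all times as an indefinite integral. -/
def momentPath (p : ℝ → Vec n → ℝ) (v : ℝ → Vec n → Vec n) (t : ℝ) : Mat n :=
  Matrix.of fun i j => secondMoment (p 0) i j + ∫ s in (0 : ℝ)..t, momentRate p v s i j

theorem Feasible.momentPath_eq (h : Feasible P₀ P₁ p v) (hc : cost p v ≠ ⊤) {t : ℝ}
    (ht : t ∈ Icc (0 : ℝ) 1) : momentPath p v t = secondMoment (p t) := by
  ext i j
  rw [momentPath, Matrix.of_apply, ← h.secondMoment_sub hc ht]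
  ring

theorem Feasible.momentPath_ac (h : Feasible P₀ P₁ p v) (hc : cost p v ≠ ⊤) (i j : Fin n) :
    AbsolutelyContinuousOnInterval (fun t => momentPath p v t i j) 0 1 := by
  have hi : IntervalIntegrable (fun t => momentRate p v t i j) volume 0 1 :=
    (intervalIntegrable_iff_integrableOn_Icc_of_le zero_le_one).2
      (h.integrableOn_momentRate hc i j)
  exact (absolutelyContinuousOnInterval_const _ _ _).fun_add
    (hi.absolutelyContinuousOnInterval_intervalIntegral (by simp))

theorem Feasible.momentPath_hasDerivAt (h : Feasible P₀ P₁ p v) (hc : cost p v ≠ ⊤) :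
    ∀ᵐ t, t ∈ Icc (0 : ℝ) 1 →
      ∀ i j, HasDerivAt (fun s => momentPath p v s i j) (momentRate p v t i j) t := by
  have hi : ∀ i j, IntervalIntegrable (fun t => momentRate p v t i j) volume 0 1 := fun i j =>
    (intervalIntegrable_iff_integrableOn_Icc_of_le zero_le_one).2
      (h.integrableOn_momentRate hc i j)
  have : ∀ᵐ t, ∀ i j, t ∈ uIcc (0 : ℝ) 1 → ∀ c ∈ uIcc (0 : ℝ) 1,
      HasDerivAt (fun x => ∫ s in c..x, momentRate p v s i j) (momentRate p v t i j) t :=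
    ae_all_iff.2 fun i => ae_all_iff.2 fun j => (hi i j).ae_hasDerivAt_integral
  filter_upwards [this] with t ht hmem i j
  have := ht i j (by rwa [uIcc_of_le zero_le_one]) 0 (by simp)
  exact this.const_add (secondMoment (p 0) i j)

theorem Feasible.secondMoment_posDef (h : Feasible P₀ P₁ p v) (hc : cost p v ≠ ⊤) {t : ℝ}
    (ht : t ∈ Icc (0 : ℝ) 1) : (secondMoment (p t)).PosDef :=
  InfoOMT.secondMoment_posDef (h.density t ht) (h.integrable_moment hc ht)

/-- On `[0, 1]` the second moments agree with the absolutely continuous `momentPath`, so their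
inverse is continuous in time and the integrand is jointly measurable. -/
theorem Feasible.aemeasurable_weightedKinetic (h : Feasible P₀ P₁ p v) (hc : cost p v ≠ ⊤) :
    AEMeasurable (weightedKinetic p v) (volume.restrict (Icc (0 : ℝ) 1)) := by
  have hinv : ∀ i j, AEMeasurable (fun t => (secondMoment (p t))⁻¹ i j)
      (volume.restrict (Icc (0 : ℝ) 1)) := by
    intro i j
    have hac := absolutelyContinuousOnInterval_inv_det (R := momentPath p v) (a := 0) (b := 1)
      (fun t ht => by
        rw [uIcc_of_le zero_le_one] at ht
        rw [h.momentPath_eq hc ht]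
        exact h.secondMoment_posDef hc ht) (h.momentPath_ac hc) i j
    have hco := hac.continuousOn
    rw [uIcc_of_le zero_le_one] at hco
    refine (hco.aemeasurable measurableSet_Icc).congr ?_
    filter_upwards [ae_restrict_mem measurableSet_Icc] with t ht
    rw [h.momentPath_eq hc ht]
  have hcoord : ∀ i : Fin n, AEMeasurable (fun z : ℝ × Vec n => v z.1 z.2 i)
      ((volume.restrict (Icc (0 : ℝ) 1)).prod volume) := fun i =>
    ((EuclideanSpace.proj i : Vec n →L[ℝ] ℝ).continuous.comp_aestronglyMeasurable
      h.aestronglyMeasurable_velocity).aemeasurable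
  have hj : AEMeasurable (fun z : ℝ × Vec n => ENNReal.ofReal (p z.1 z.2) *
      ENNReal.ofReal (weightedSq (secondMoment (p z.1))⁻¹ (v z.1 z.2)))
      ((volume.restrict (Icc (0 : ℝ) 1)).prod volume) := by
    refine h.aestronglyMeasurable_density.aemeasurable.ennreal_ofReal.mul
      (AEMeasurable.ennreal_ofReal ?_)
    simp only [weightedSq_eq_sum]
    exact Finset.aemeasurable_fun_sum _ fun i _ => Finset.aemeasurable_fun_sum _ fun j _ =>
      ((hinv i j).comp_fst).mul ((hcoord i).mul (hcoord j))
  refine hj.lintegral_prod_right'.congr ?_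
  filter_upwards [h.ae_regularAt] with t ht
  have hcoord : ∀ i : Fin n, AEMeasurable (fun x => v t x i) volume := fun i =>
    ((EuclideanSpace.proj i : Vec n →L[ℝ] ℝ).continuous.comp_aestronglyMeasurable
      ht.velocity).aemeasurable
  have hm : AEMeasurable (fun x => weightedSq (secondMoment (p t))⁻¹ (v t x)) volume := by
    simp only [weightedSq_eq_sum]
    exact Finset.aemeasurable_fun_sum _ fun i _ => Finset.aemeasurable_fun_sum _ fun j _ =>
      ((hcoord i).mul (hcoord j)).const_mul _
  rw [weightedKinetic, lintegral_law ht.density hm.ennreal_ofReal]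

theorem lintegral_weightedKinetic_ne_top (hc : cost p v ≠ ⊤) :
    ∫⁻ t in Icc (0 : ℝ) 1, weightedKinetic p v t ≠ ⊤ := by
  intro htop
  refine hc ?_
  rw [cost]
  change 4 * ∫⁻ t in Icc (0 : ℝ) 1, weightedKinetic p v t = ⊤
  rw [htop]
  simp

theorem Feasible.ae_kinetic_ne_top (h : Feasible P₀ P₁ p v) (hc : cost p v ≠ ⊤) :
    ∀ᵐ t ∂(volume.restrict (Icc (0 : ℝ) 1)), kinetic p v t ≠ ⊤ := by
  filter_upwards [ae_lt_top' (h.aemeasurable_weightedKinetic hc)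
    (lintegral_weightedKinetic_ne_top hc), h.ae_regularAt] with t h1 h2
  exact h2.kinetic_ne_top h1.ne

theorem Feasible.cost_eq_energy (h : Feasible P₀ P₁ p v) (hc : cost p v ≠ ⊤) :
    IntegrableOn (energy p v) (Icc 0 1) ∧
      cost p v = ENNReal.ofReal (4 * ∫ t in Icc (0 : ℝ) 1, energy p v t) := by
  have hm := h.aemeasurable_weightedKinetic hc
  have hf := lintegral_weightedKinetic_ne_top hc
  have hE0 : ∀ᵐ t ∂(volume.restrict (Icc (0 : ℝ) 1)), 0 ≤ energy p v t := by
    filter_upwards [h.ae_regularAt] with t ht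
    exact integral_nonneg fun x => mul_nonneg (weightedSq_nonneg
      (InfoOMT.secondMoment_posDef ht.density ht.moment).inv.posSemidef _) (ht.density.nonneg x)
  have hEe : ∀ᵐ t ∂(volume.restrict (Icc (0 : ℝ) 1)),
      weightedKinetic p v t = ENNReal.ofReal (energy p v t) := by
    filter_upwards [h.ae_regularAt, h.ae_kinetic_ne_top hc] with t h1 h2
    exact h1.weightedKinetic_eq h2
  have hi : IntegrableOn (energy p v) (Icc 0 1) := by
    refine (integrable_toReal_of_lintegral_ne_top hm hf).congr ?_
    filter_upwards [hEe, hE0] with t h1 h2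
    rw [h1, ENNReal.toReal_ofReal h2]
  refine ⟨hi, ?_⟩
  rw [cost]
  change 4 * ∫⁻ t in Icc (0 : ℝ) 1, weightedKinetic p v t = _
  rw [lintegral_congr_ae hEe, ← ofReal_integral_eq_lintegral_ofReal hi hE0,
    ENNReal.ofReal_mul (by norm_num)]
  norm_num

/-- The gradient of the calibration at time `t`, in the original coordinates. -/
def calibration (T : Mat n) (l : Fin n → ℝ) (p : ℝ → Vec n → ℝ) (t : ℝ) : Mat n :=
  Tᵀ * cholGrad l (T * secondMoment (p t) * Tᵀ) * T

theorem posDef_conj {T S P : Mat n} (hTS : T * S = 1) (hP : P.PosDef) : (T * P * Tᵀ).PosDef := by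
  have hu : IsUnit T := by
    rw [Matrix.isUnit_iff_isUnit_det]
    exact IsUnit.of_mul_eq_one S.det (by rw [← Matrix.det_mul, hTS, Matrix.det_one])
  have := (Matrix.IsUnit.posDef_star_right_conjugate_iff hu (x := P)).2 hP
  rwa [Matrix.star_eq_conjTranspose, Matrix.conjTranspose_eq_transpose_of_trivial] at this

variable {T S : Mat n} {l : Fin n → ℝ}

theorem conj_apply (T M : Mat n) (i j : Fin n) :
    (T * M * Tᵀ) i j = ∑ b, ∑ a, T i a * M a b * T j b := by
  simp only [Matrix.mul_apply, Matrix.transpose_apply, Finset.sum_mul]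

theorem Feasible.conj_momentPath_ac (h : Feasible P₀ P₁ p v) (hc : cost p v ≠ ⊤) (T : Mat n)
    (i j : Fin n) :
    AbsolutelyContinuousOnInterval (fun t => (T * momentPath p v t * Tᵀ) i j) 0 1 := by
  simp only [conj_apply, mul_comm _ (T j _)]
  exact absolutelyContinuousOnInterval_sum _ fun b _ => absolutelyContinuousOnInterval_sum _
    fun a _ => ((h.momentPath_ac hc a b).const_mul _).const_mul _

theorem Feasible.conj_momentPath_hasDerivAt (h : Feasible P₀ P₁ p v) (hc : cost p v ≠ ⊤)
    (T : Mat n) : ∀ᵐ t, t ∈ Icc (0 : ℝ) 1 → ∀ i j,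
      HasDerivAt (fun s => (T * momentPath p v s * Tᵀ) i j)
        ((T * momentRate p v t * Tᵀ) i j) t := by
  filter_upwards [h.momentPath_hasDerivAt hc] with t ht hmem i j
  simp only [conj_apply]
  exact HasDerivAt.fun_sum fun b _ => HasDerivAt.fun_sum fun a _ =>
    ((ht hmem a b).const_mul _).mul_const _

/-- The trace is the derivative of the calibration function along the path seen in the frame, so
only its end values matter: `0` at the identity and `∑ i, l i ^ 2` at `diag (exp l)`. -/
theorem Feasible.integral_calibration (h : Feasible P₀ P₁ p v) (hc : cost p v ≠ ⊤)
    (hF : GeodesicFrame P₀ P₁ T S l) (h0 : secondMoment (p 0) = P₀)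
    (h1 : secondMoment (p 1) = P₁) :
    IntegrableOn (fun t => (calibration T l p t * momentRate p v t).trace) (Icc 0 1) ∧
      ∫ t in Icc (0 : ℝ) 1, (calibration T l p t * momentRate p v t).trace = ∑ i, l i ^ 2 := by
  have hpos : ∀ t ∈ Icc (0 : ℝ) 1, (T * momentPath p v t * Tᵀ).PosDef := fun t ht => by
    rw [h.momentPath_eq hc ht]
    exact posDef_conj hF.mul_eq_one (h.secondMoment_posDef hc ht)
  obtain ⟨i1, i2⟩ := integral_cholGrad l hpos (h.conj_momentPath_ac hc T)
    (h.conj_momentPath_hasDerivAt hc T)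
  have m0 : (0 : ℝ) ∈ Icc (0 : ℝ) 1 := by simp
  have m1 : (1 : ℝ) ∈ Icc (0 : ℝ) 1 := by simp
  have e0 : cholFun l (T * momentPath p v 0 * Tᵀ) = 0 := by
    rw [h.momentPath_eq hc m0, h0, hF.left]
    have := cholFun_diagonal_exp l (fun _ => 0)
    simpa using this
  have e1 : cholFun l (T * momentPath p v 1 * Tᵀ) = ∑ i, l i ^ 2 := by
    rw [h.momentPath_eq hc m1, h1, hF.right, cholFun_diagonal_exp]
    simp only [sq]
  have e : ∀ t ∈ Icc (0 : ℝ) 1,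
      (cholGrad l (T * momentPath p v t * Tᵀ) * (T * momentRate p v t * Tᵀ)).trace
        = (calibration T l p t * momentRate p v t).trace := by
    intro t ht
    rw [calibration, h.momentPath_eq hc ht, ← Matrix.mul_assoc, Matrix.trace_mul_comm]
    simp only [Matrix.mul_assoc]
  rw [intervalIntegrable_iff_integrableOn_Icc_of_le zero_le_one] at i1
  rw [intervalIntegral.integral_of_le zero_le_one, ← integral_Icc_eq_integral_Ioc, e0, e1,
    sub_zero] at i2
  rw [← setIntegral_congr_fun measurableSet_Icc e]
  exact ⟨i1.congr_fun e measurableSet_Icc, i2⟩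

theorem calibration_transpose {t : ℝ} (hTS : T * S = 1) (hP : (secondMoment (p t)).PosDef) :
    (calibration T l p t)ᵀ = calibration T l p t := by
  rw [calibration, Matrix.transpose_mul, Matrix.transpose_mul, Matrix.transpose_transpose,
    cholGrad_transpose (posDef_conj hTS hP), ← Matrix.mul_assoc]

/-- Cyclicity of the trace makes the gradient norm invariant under the congruence by `T`. -/
theorem trace_calibration_sq {t : ℝ} (hTS : T * S = 1) (hP : (secondMoment (p t)).PosDef) :
    (calibration T l p t * secondMoment (p t) * (calibration T l p t * secondMoment (p t))).trace
      = ∑ i, l i ^ 2 := by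
  rw [← trace_cholGrad_sq (posDef_conj hTS hP) l, calibration]
  simp only [Matrix.mul_assoc]
  rw [Matrix.trace_mul_comm]
  simp only [Matrix.mul_assoc]

/-- The cost exceeds the squared distance by the time integral of the defect. -/
theorem Feasible.cost_eq (h : Feasible P₀ P₁ p v) (hc : cost p v ≠ ⊤)
    (hF : GeodesicFrame P₀ P₁ T S l) (h0 : secondMoment (p 0) = P₀)
    (h1 : secondMoment (p 1) = P₁) :
    (∀ᵐ t ∂(volume.restrict (Icc (0 : ℝ) 1)), 0 ≤ defect p v (calibration T l p t) t) ∧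
    IntegrableOn (fun t => defect p v (calibration T l p t) t) (Icc 0 1) ∧
    cost p v = ENNReal.ofReal ((∑ i, l i ^ 2)
      + 4 * ∫ t in Icc (0 : ℝ) 1, defect p v (calibration T l p t) t) := by
  obtain ⟨hE, hcost⟩ := h.cost_eq_energy hc
  obtain ⟨i1, i2⟩ := h.integral_calibration hc hF h0 h1
  -- Integrating, the energy is the defect plus `(1/2) L - (1/4) L` with `L = ∑ i, l i ^ 2`; the
  -- factor `4` in the cost turns `(1/4) L` into `L`.
  have hid : ∀ᵐ t ∂(volume.restrict (Icc (0 : ℝ) 1)),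
      energy p v t - (1 / 2) * (calibration T l p t * momentRate p v t).trace
        + (1 / 4) * ∑ i, l i ^ 2 = defect p v (calibration T l p t) t := by
    filter_upwards [h.ae_regularAt, h.ae_kinetic_ne_top hc, h.ae_integrable_momentRate hc]
      with t a1 a2 a3
    have hP := InfoOMT.secondMoment_posDef a1.density a1.moment
    rw [(a1.energy_eq a2 a3 (calibration_transpose (l := l) hF.mul_eq_one hP)).2,
      trace_calibration_sq hF.mul_eq_one hP]
    ring
  have hint : Integrable (fun t =>
      energy p v t - (1 / 2) * (calibration T l p t * momentRate p v t).trace)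
      (volume.restrict (Icc (0 : ℝ) 1)) := hE.sub (i1.const_mul _)
  have hcst : Integrable (fun _ : ℝ => (1 / 4) * ∑ i, l i ^ 2)
      (volume.restrict (Icc (0 : ℝ) 1)) := integrable_const _
  refine ⟨?_, (hint.add hcst).congr hid, ?_⟩
  · filter_upwards [h.ae_regularAt] with t ht
    exact integral_nonneg fun x => mul_nonneg (weightedSq_nonneg
      (InfoOMT.secondMoment_posDef ht.density ht.moment).inv.posSemidef _) (ht.density.nonneg x)
  · rw [← integral_congr_ae hid, integral_add hint hcst, integral_sub hE (i1.const_mul _),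
      integral_const_mul, i2, hcost]
    congr 1
    simp
    ring

theorem Feasible.le_cost (h : Feasible P₀ P₁ p v)
    (hF : GeodesicFrame P₀ P₁ T S l) (h0 : secondMoment (p 0) = P₀)
    (h1 : secondMoment (p 1) = P₁) : ENNReal.ofReal (∑ i, l i ^ 2) ≤ cost p v := by
  by_cases hc : cost p v = ⊤
  · rw [hc]; exact le_top
  obtain ⟨a, -, c⟩ := h.cost_eq hc hF h0 h1
  rw [c]
  exact ENNReal.ofReal_le_ofReal (by linarith [integral_nonneg_of_ae a])

theorem weightedSq_eq_zero_iff {W : Mat n} (hW : W.PosDef) {y : Vec n} (h : weightedSq W y = 0) :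
    y = 0 := by
  by_contra hy
  have := hW.dotProduct_mulVec_pos (x := y.ofLp) (by simpa using hy)
  rw [star_trivial] at this
  exact this.ne' h

/-- A velocity of minimal cost is given by the calibration. -/
theorem Feasible.velocity_eq_calibration (h : Feasible P₀ P₁ p v)
    (hF : GeodesicFrame P₀ P₁ T S l) (h0 : secondMoment (p 0) = P₀)
    (h1 : secondMoment (p 1) = P₁) (hle : cost p v ≤ ENNReal.ofReal (∑ i, l i ^ 2)) :
    ∀ᵐ t ∂(volume.restrict (Icc (0 : ℝ) 1)), ∀ᵐ x, p t x ≠ 0 →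
      v t x = linField ((1 / 2 : ℝ) • (secondMoment (p t) * calibration T l p t)) x := by
  have hc : cost p v ≠ ⊤ := ne_top_of_le_ne_top ENNReal.ofReal_ne_top hle
  obtain ⟨a, b, c⟩ := h.cost_eq hc hF h0 h1
  have hnn := integral_nonneg_of_ae a
  have hl0 : 0 ≤ ∑ i, l i ^ 2 := Finset.sum_nonneg fun i _ => sq_nonneg _
  rw [c, ENNReal.ofReal_le_ofReal_iff hl0] at hle
  -- A cost not exceeding `∑ i, l i ^ 2` leaves no room for a positive integral of the nonnegative
  -- defect.
  have hz := (integral_eq_zero_iff_of_nonneg_ae a b).1 (by linarith)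
  filter_upwards [hz, h.ae_regularAt, h.ae_kinetic_ne_top hc, h.ae_integrable_momentRate hc]
    with t a0 a1 a2 a3
  have hP := InfoOMT.secondMoment_posDef a1.density a1.moment
  have hint := (a1.energy_eq a2 a3 (calibration_transpose (l := l) hF.mul_eq_one hP)).1
  have hx := (integral_eq_zero_iff_of_nonneg (fun x => mul_nonneg
    (weightedSq_nonneg hP.inv.posSemidef _) (a1.density.nonneg x)) hint).1 a0
  filter_upwards [hx] with x hx hpx
  exact sub_eq_zero.1 (weightedSq_eq_zero_iff hP.inv ((mul_eq_zero.1 hx).resolve_right hpx))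

/-- The Lyapunov equation of a linear flow. The velocity matters only where the density is nonzero.
-/
theorem momentRate_of_linear {t : ℝ} (hf : IsProbDensity (p t))
    (h2 : Integrable fun x : Vec n => ‖x‖ ^ 2 * p t x) {A : Mat n}
    (hv : ∀ᵐ x, p t x ≠ 0 → v t x = linField A x) :
    momentRate p v t = A * secondMoment (p t) + secondMoment (p t) * Aᵀ := by
  ext i j
  have hi := integrable_apply_mul_apply hf h2
  have e : ∀ᵐ x : Vec n, p t x * (v t x i * x j + x i * v t x j)
      = ∑ k, A i k * (x k * x j * p t x) + ∑ k, A j k * (x i * x k * p t x) := by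
    filter_upwards [hv] with x hx
    by_cases hpx : p t x = 0
    · simp [hpx]
    · rw [hx hpx]
      simp only [linField, Matrix.mulVec, dotProduct, Finset.sum_mul, Finset.mul_sum, mul_add]
      congr 1 <;> exact Finset.sum_congr rfl fun k _ => by ring
  rw [momentRate, Matrix.of_apply, integral_congr_ae e,
    integral_add (integrable_finsetSum _ fun k _ => (hi k j).const_mul _)
      (integrable_finsetSum _ fun k _ => (hi i k).const_mul _),
    integral_finsetSum _ fun k _ => (hi k j).const_mul _,
    integral_finsetSum _ fun k _ => (hi i k).const_mul _]
  simp only [integral_const_mul, Matrix.add_apply, Matrix.mul_apply, Matrix.transpose_apply,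
    secondMoment, Matrix.of_apply]
  congr 1
  exact Finset.sum_congr rfl fun k _ => mul_comm _ _

/-- A velocity of minimal cost is the linear field of the geodesic. -/
theorem Feasible.velocity_eq (h : Feasible P₀ P₁ p v)
    (hF : GeodesicFrame P₀ P₁ T S l) (h0 : secondMoment (p 0) = P₀)
    (h1 : secondMoment (p 1) = P₁) (hle : cost p v ≤ ENNReal.ofReal (∑ i, l i ^ 2)) :
    ∀ᵐ t ∂(volume.restrict (Icc (0 : ℝ) 1)), ∀ᵐ x, p t x ≠ 0 →
      v t x = linField (matAInfo P₀ P₁) x := by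
  have hc : cost p v ≠ ⊤ := ne_top_of_le_ne_top ENNReal.ofReal_ne_top hle
  have hv := h.velocity_eq_calibration hF h0 h1 hle
  have hpos : ∀ t ∈ Icc (0 : ℝ) 1, (T * momentPath p v t * Tᵀ).PosDef := fun t ht => by
    rw [h.momentPath_eq hc ht]
    exact posDef_conj hF.mul_eq_one (h.secondMoment_posDef hc ht)
  -- For the field `(1/2) P G x` both halves of the Lyapunov equation equal `(1/2) P G P`, so `P' =
  -- P G P`; conjugation by `T` gives the calibrated flow.
  have hrate : ∀ᵐ t, t ∈ Icc (0 : ℝ) 1 → T * momentRate p v t * Tᵀ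
      = T * momentPath p v t * Tᵀ * cholGrad l (T * momentPath p v t * Tᵀ)
        * (T * momentPath p v t * Tᵀ) := by
    rw [← ae_restrict_iff' measurableSet_Icc]
    filter_upwards [hv, h.ae_regularAt] with t a0 a1
    rw [h.momentPath_eq hc a1.mem, momentRate_of_linear a1.density a1.moment a0,
      Matrix.transpose_smul, Matrix.transpose_mul, secondMoment_transpose,
      calibration_transpose hF.mul_eq_one (h.secondMoment_posDef hc a1.mem), Matrix.smul_mul,
      Matrix.mul_smul, ← Matrix.mul_assoc, ← add_smul]
    norm_num [calibration]
    simp only [Matrix.mul_assoc]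
  have hd : ∀ᵐ t, t ∈ Icc (0 : ℝ) 1 → ∀ i j,
      HasDerivAt (fun s => (T * momentPath p v s * Tᵀ) i j)
        ((T * momentPath p v t * Tᵀ * cholGrad l (T * momentPath p v t * Tᵀ)
        * (T * momentPath p v t * Tᵀ)) i j) t := by
    filter_upwards [h.conj_momentPath_hasDerivAt hc T, hrate] with t a0 a1 hmem i j
    rw [← a1 hmem]
    exact a0 hmem i j
  have hini : T * momentPath p v 0 * Tᵀ = 1 := by
    rw [h.momentPath_eq hc (by simp), h0, hF.left]
  filter_upwards [hv, h.ae_regularAt] with t a0 a1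
  have hdiag := cholGrad_mul_eq_diagonal l hpos (h.conj_momentPath_ac hc T) hd hini a1.mem
  rw [h.momentPath_eq hc a1.mem] at hdiag
  have hPd := h.secondMoment_posDef hc a1.mem
  -- Transposing exchanges the two symmetric factors, and `diag l` is its own transpose.
  have hdiag' : T * secondMoment (p t) * Tᵀ * cholGrad l (T * secondMoment (p t) * Tᵀ)
      = Matrix.diagonal l := by
    have := congrArg Matrix.transpose hdiag
    rw [Matrix.transpose_mul, cholGrad_transpose (posDef_conj hF.mul_eq_one hPd),
      Matrix.diagonal_transpose, Matrix.transpose_mul, Matrix.transpose_mul,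
      secondMoment_transpose, Matrix.transpose_transpose, ← Matrix.mul_assoc] at this
    exact this
  have hA : secondMoment (p t) * calibration T l p t = S * Matrix.diagonal l * T := by
    rw [← hdiag', calibration]
    simp only [← Matrix.mul_assoc]
    rw [hF.mul_eq_one', Matrix.one_mul]
  filter_upwards [a0] with x hx hpx
  rw [hx hpx, hA, hF.field]

end

/-! ### Gaussian densities -/

theorem continuous_linField (A : Mat n) : Continuous (linField A) :=
  (Matrix.toEuclideanLin A).continuous_of_finiteDimensional

theorem linField_linField (A B : Mat n) (x : Vec n) :
    linField A (linField B x) = linField (A * B) x := by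
  simp [linField, Matrix.mulVec_mulVec]

theorem linField_one (x : Vec n) : linField (1 : Mat n) x = x := by
  simp [linField]

theorem measurableEmbedding_linField {S T : Mat n} (hTS : T * S = 1) :
    MeasurableEmbedding (linField S) :=
  (continuous_linField S).measurableEmbedding fun x y hxy => by
    have := congrArg (linField T) hxy
    rwa [linField_linField, linField_linField, hTS, linField_one, linField_one] at this

theorem gaussianDensity_one (x : Vec n) :
    gaussianDensity (1 : Mat n) x
      = ((2 * Real.pi) ^ n) ^ (-(1 / 2) : ℝ) * Real.exp (-(1 / 2) * ‖x‖ ^ 2) := by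
  rw [gaussianDensity, Matrix.det_smul, Matrix.det_one, mul_one, Fintype.card_fin, weightedSq,
    inv_one, Matrix.one_mulVec, EuclideanSpace.norm_sq_eq]
  simp [dotProduct, sq]

theorem gaussianDensity_nonneg {P : Mat n} (hP : P.PosDef) (x : Vec n) :
    0 ≤ gaussianDensity P x := by
  have h : ((2 * Real.pi) • P).PosDef := hP.smul (by positivity)
  exact mul_nonneg (Real.rpow_nonneg h.det_pos.le _) (Real.exp_pos _).le

theorem continuous_gaussianDensity (P : Mat n) : Continuous (gaussianDensity P) := by
  have : Continuous fun x : Vec n => weightedSq P⁻¹ x := by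
    simp only [weightedSq_eq_sum]
    fun_prop
  exact continuous_const.mul (Real.continuous_exp.comp (continuous_const.mul this))

theorem integrable_gaussianDensity_one : Integrable (gaussianDensity (1 : Mat n)) := by
  have h := (GaussianFourier.integrable_cexp_neg_mul_sq_norm_add (V := Vec n) (b := 1 / 2)
    (by norm_num) 0 0).re
  refine (h.const_mul (((2 * Real.pi) ^ n) ^ (-(1 / 2) : ℝ))).congr
    (Filter.Eventually.of_forall fun x => ?_)
  rw [gaussianDensity_one]
  simp only [zero_mul, add_zero]
  congr 1
  have : (-(1 / 2) * (‖x‖ : ℂ) ^ 2) = ((-(1 / 2) * ‖x‖ ^ 2 : ℝ) : ℂ) := by push_cast; ring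
  rw [this, ← Complex.ofReal_exp]
  rfl

/-- Both measures are finite and have the same characteristic function, by the Gaussian Fourier
integral; the normalizing constant cancels exactly. Moments can then be computed under
`stdGaussian`. -/
theorem law_gaussianDensity_one :
    law (gaussianDensity (1 : Mat n)) = ProbabilityTheory.stdGaussian (Vec n) := by
  have hi := integrable_gaussianDensity_one (n := n)
  have : IsFiniteMeasure (law (gaussianDensity (1 : Mat n))) :=
    isFiniteMeasure_withDensity_ofReal hi.2
  refine Measure.ext_of_charFun ?_
  ext t
  rw [ProbabilityTheory.charFun_stdGaussian, charFun_apply, law,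
    integral_withDensity_eq_integral_toReal_smul₀ hi.aemeasurable.ennreal_ofReal
      (Filter.Eventually.of_forall fun _ => by simp)]
  have hn : ∀ x : Vec n, 0 ≤ gaussianDensity (1 : Mat n) x :=
    gaussianDensity_nonneg Matrix.PosDef.one
  have e : ∀ x : Vec n, (ENNReal.ofReal (gaussianDensity (1 : Mat n) x)).toReal •
      Complex.exp (inner ℝ x t * Complex.I)
      = (((2 * Real.pi) ^ n) ^ (-(1 / 2) : ℝ) : ℝ) *
        Complex.exp (-(1 / 2 : ℂ) * ‖x‖ ^ 2 + Complex.I * inner ℝ t x) := by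
    intro x
    rw [ENNReal.toReal_ofReal (hn x), gaussianDensity_one, Complex.exp_add, real_inner_comm,
      Complex.real_smul]
    push_cast
    rw [mul_comm (Complex.I)]
    ring
  simp only [e]
  rw [integral_const_mul, GaussianFourier.integral_cexp_neg_mul_sq_norm_add (by norm_num),
    ← mul_assoc]
  have h1 : (((((2 * Real.pi) ^ n) ^ (-(1 / 2) : ℝ) : ℝ) : ℂ) *
      ((Real.pi : ℂ) / (1 / 2)) ^ ((Module.finrank ℝ (Vec n) : ℂ) / 2)) = 1 := by
    have h2 : ((Real.pi : ℂ) / (1 / 2)) ^ ((Module.finrank ℝ (Vec n) : ℂ) / 2)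
        = (((2 * Real.pi) ^ ((n : ℝ) / 2) : ℝ) : ℂ) := by
      rw [Complex.ofReal_cpow (by positivity)]
      simp
      congr 1
      ring
    rw [h2, ← Complex.ofReal_mul, ← Real.rpow_natCast, ← Real.rpow_mul (by positivity),
      ← Real.rpow_add (by positivity)]
    have : (n : ℝ) * -(1 / 2) + (n : ℝ) / 2 = 0 := by ring
    rw [this, Real.rpow_zero, Complex.ofReal_one]
  rw [h1, one_mul]
  congr 1
  rw [Complex.I_sq]
  ring

theorem gaussianDensity_conj {S T : Mat n} (hTS : T * S = 1) (x : Vec n) :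
    gaussianDensity (S * Sᵀ) x = |T.det| * gaussianDensity (1 : Mat n) (linField T x) := by
  have hdet : T.det * S.det = 1 := by rw [← Matrix.det_mul, hTS, Matrix.det_one]
  have hS : S.det ≠ 0 := right_ne_zero_of_mul_eq_one hdet
  have hinv : (S * Sᵀ)⁻¹ = Tᵀ * T := by
    refine Matrix.inv_eq_left_inv ?_
    calc Tᵀ * T * (S * Sᵀ) = Tᵀ * (T * S) * Sᵀ := by simp only [Matrix.mul_assoc]
      _ = (S * T)ᵀ := by rw [hTS, Matrix.mul_one, Matrix.transpose_mul]
      _ = 1 := by rw [mul_eq_one_comm.1 hTS, Matrix.transpose_one]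
  have hw : weightedSq (S * Sᵀ)⁻¹ x = weightedSq (1 : Mat n)⁻¹ (linField T x) := by
    rw [hinv, weightedSq, weightedSq, inv_one, Matrix.one_mulVec, linField,
      ← Matrix.mulVec_mulVec, Matrix.dotProduct_mulVec, Matrix.vecMul_transpose]
  have hd : ((2 * Real.pi) • (S * Sᵀ)).det ^ (-(1 / 2) : ℝ)
      = |T.det| * ((2 * Real.pi) • (1 : Mat n)).det ^ (-(1 / 2) : ℝ) := by
    rw [Matrix.det_smul, Matrix.det_smul, Matrix.det_mul, Matrix.det_transpose, Matrix.det_one,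
      mul_one, Real.mul_rpow (by positivity) (mul_self_nonneg _), mul_comm]
    congr 1
    rw [eq_inv_of_mul_eq_one_left hdet, abs_inv, ← abs_mul_abs_self, Real.rpow_neg (by positivity),
      ← Real.sqrt_eq_rpow, Real.sqrt_mul_self (abs_nonneg _)]
  rw [gaussianDensity, gaussianDensity, hd, hw, mul_assoc]

/-- Linear change of variables: the Jacobian `|det T|` is the factor relating the two densities in
`gaussianDensity_conj`. -/
theorem law_gaussianDensity {S T : Mat n} (hTS : T * S = 1) :
    law (gaussianDensity (S * Sᵀ))
      = (ProbabilityTheory.stdGaussian (Vec n)).map (linField S) := by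
  have hdet : T.det * S.det = 1 := by rw [← Matrix.det_mul, hTS, Matrix.det_one]
  have hS : S.det ≠ 0 := right_ne_zero_of_mul_eq_one hdet
  have hmap : (volume : Measure (Vec n)).map (linField S) = ENNReal.ofReal |T.det| • volume := by
    have hl : LinearMap.det (Matrix.toEuclideanLin S) = S.det := LinearMap.det_toLpLin 2 S
    have := Measure.map_linearMap_addHaar_eq_smul_addHaar (volume : Measure (Vec n))
      (f := Matrix.toEuclideanLin S) (by rwa [hl])
    rw [hl, ← eq_inv_of_mul_eq_one_left hdet] at this
    exact this
  have hm := (continuous_linField S).measurable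
  have hg : Measurable fun x : Vec n => ENNReal.ofReal (gaussianDensity (1 : Mat n) x) :=
    (continuous_gaussianDensity _).measurable.ennreal_ofReal
  ext A hA
  rw [← law_gaussianDensity_one, Measure.map_apply hm hA, law, law, withDensity_apply _ hA,
    withDensity_apply _ (hm hA)]
  have e : ∀ y : Vec n, ENNReal.ofReal (gaussianDensity (1 : Mat n) y)
      = (fun x => ENNReal.ofReal (gaussianDensity (1 : Mat n) (linField T x))) (linField S y) := by
    intro y
    simp only [linField_linField, hTS, linField_one]
  have hgT : Measurable fun x : Vec n =>
      ENNReal.ofReal (gaussianDensity (1 : Mat n) (linField T x)) :=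
    hg.comp (continuous_linField T).measurable
  rw [setLIntegral_congr_fun (hm hA) fun y _ => e y, ← setLIntegral_map hA hgT hm, hmap,
    Measure.restrict_smul, lintegral_smul_measure, smul_eq_mul, ← lintegral_const_mul _ hgT]
  refine lintegral_congr fun x => ?_
  rw [gaussianDensity_conj hTS, ENNReal.ofReal_mul (abs_nonneg _)]

theorem posDef_mul_transpose {S T : Mat n} (hTS : T * S = 1) : (S * Sᵀ).PosDef := by
  have := posDef_conj (mul_eq_one_comm.1 hTS) (Matrix.PosDef.one (n := Fin n) (R := ℝ))
  rwa [Matrix.mul_one] at this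

theorem isProbDensity_gaussianDensity {S T : Mat n} (hTS : T * S = 1) :
    IsProbDensity (gaussianDensity (S * Sᵀ)) := by
  have hnn := gaussianDensity_nonneg (posDef_mul_transpose hTS)
  have hl : ∫⁻ x, ENNReal.ofReal (gaussianDensity (S * Sᵀ) x) = 1 := by
    have : (law (gaussianDensity (S * Sᵀ))) univ = 1 := by
      rw [law_gaussianDensity hTS,
        Measure.map_apply (continuous_linField S).measurable MeasurableSet.univ]
      simp
    rwa [law, withDensity_apply _ MeasurableSet.univ, Measure.restrict_univ] at this
  have hi : Integrable (gaussianDensity (S * Sᵀ)) := by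
    refine ⟨(continuous_gaussianDensity _).aestronglyMeasurable, ?_⟩
    rw [hasFiniteIntegral_iff_ofReal (Filter.Eventually.of_forall hnn), hl]
    exact ENNReal.one_lt_top
  refine ⟨hnn, hi, ?_⟩
  rw [integral_eq_lintegral_of_nonneg_ae (Filter.Eventually.of_forall hnn) hi.1, hl,
    ENNReal.toReal_one]

theorem integral_mul_gaussianDensity {S T : Mat n} (hTS : T * S = 1) (F : Vec n → ℝ) :
    ∫ x, F x * gaussianDensity (S * Sᵀ) x
      = ∫ y, F (linField S y) ∂(ProbabilityTheory.stdGaussian (Vec n)) := by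
  rw [← integral_law (isProbDensity_gaussianDensity hTS), law_gaussianDensity hTS,
    (measurableEmbedding_linField hTS).integral_map]

theorem integrable_mul_gaussianDensity_iff {S T : Mat n} (hTS : T * S = 1) (F : Vec n → ℝ) :
    Integrable (fun x => F x * gaussianDensity (S * Sᵀ) x) ↔
      Integrable (fun y => F (linField S y)) (ProbabilityTheory.stdGaussian (Vec n)) := by
  rw [← integrable_law_iff (isProbDensity_gaussianDensity hTS), law_gaussianDensity hTS,
    (measurableEmbedding_linField hTS).integrable_map_iff]
  rfl

theorem integrable_norm_sq_stdGaussian :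
    Integrable (fun y : Vec n => ‖y‖ ^ 2) (ProbabilityTheory.stdGaussian (Vec n)) :=
  (ProbabilityTheory.IsGaussian.memLp_two_id
    (μ := ProbabilityTheory.stdGaussian (Vec n))).integrable_norm_pow (by norm_num)

theorem exists_norm_linField_le (S : Mat n) : ∃ C, 0 ≤ C ∧ ∀ x, ‖linField S x‖ ≤ C * ‖x‖ :=
  ⟨‖(Matrix.toEuclideanLin S).toContinuousLinearMap‖, norm_nonneg _,
    fun x => (Matrix.toEuclideanLin S).toContinuousLinearMap.le_opNorm x⟩

theorem integral_apply_mul_apply_stdGaussian (i j : Fin n) :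
    ∫ y : Vec n, y i * y j ∂(ProbabilityTheory.stdGaussian (Vec n)) = if i = j then 1 else 0 := by
  have h := ProbabilityTheory.covarianceBilin_apply
    (ProbabilityTheory.IsGaussian.memLp_two_id (μ := ProbabilityTheory.stdGaussian (Vec n)))
    (EuclideanSpace.single i 1) (EuclideanSpace.single j 1)
  rw [ProbabilityTheory.covarianceBilin_stdGaussian] at h
  simp only [id, ProbabilityTheory.integral_id_stdGaussian, sub_zero, EuclideanSpace.inner_single_left, map_one, one_mul] at h
  rw [← h]
  change inner ℝ (EuclideanSpace.single i (1 : ℝ) : Vec n) (EuclideanSpace.single j 1) = _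
  rw [EuclideanSpace.inner_single_left]
  simp

theorem integrable_apply_mul_apply_stdGaussian (i j : Fin n) :
    Integrable (fun y : Vec n => y i * y j) (ProbabilityTheory.stdGaussian (Vec n)) := by
  refine integrable_norm_sq_stdGaussian.mono'
    (by fun_prop : Continuous fun y : Vec n => y i * y j).aestronglyMeasurable
    (Filter.Eventually.of_forall fun y => ?_)
  rw [Real.norm_eq_abs, sq]
  exact abs_apply_mul_apply_le y y i j

theorem integrable_norm_sq_gaussianDensity {S T : Mat n} (hTS : T * S = 1) :
    Integrable fun x : Vec n => ‖x‖ ^ 2 * gaussianDensity (S * Sᵀ) x := by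
  rw [integrable_mul_gaussianDensity_iff hTS]
  obtain ⟨C, hC, hle⟩ := exists_norm_linField_le S
  refine (integrable_norm_sq_stdGaussian.const_mul (C ^ 2)).mono'
    ((continuous_linField S).norm.pow 2).aestronglyMeasurable
    (Filter.Eventually.of_forall fun y => ?_)
  rw [Real.norm_of_nonneg (by positivity), ← mul_pow]
  exact pow_le_pow_left₀ (norm_nonneg _) (hle y) 2

theorem secondMoment_gaussianDensity {S T : Mat n} (hTS : T * S = 1) :
    secondMoment (gaussianDensity (S * Sᵀ)) = S * Sᵀ := by
  ext i j
  rw [secondMoment, Matrix.of_apply, integral_mul_gaussianDensity hTS fun x => x i * x j]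
  have e : ∀ y : Vec n, linField S y i * linField S y j
      = ∑ k, ∑ m, S i k * S j m * (y k * y m) := by
    intro y
    simp only [linField, Matrix.mulVec, dotProduct, Finset.sum_mul_sum]
    exact Finset.sum_congr rfl fun k _ => Finset.sum_congr rfl fun m _ => by ring
  simp only [e]
  have hi := integrable_apply_mul_apply_stdGaussian (n := n)
  rw [integral_finsetSum _ fun k _ => integrable_finsetSum _ fun m _ => (hi k m).const_mul _]
  rw [Matrix.mul_apply]
  refine Finset.sum_congr rfl fun k _ => ?_
  rw [integral_finsetSum _ fun m _ => (hi k m).const_mul _]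
  simp only [integral_const_mul, integral_apply_mul_apply_stdGaussian]
  simp

/-! ### The linear flow of the geodesic -/

/-- The matrix carrying the standard Gaussian to the Gaussian at time `t` of the geodesic. -/
def frameFlow (S : Mat n) (l : Fin n → ℝ) (t : ℝ) : Mat n :=
  S * Matrix.diagonal fun i => Real.exp (t * l i / 2)

/-- The inverse of `frameFlow`. -/
def frameFlowInv (T : Mat n) (l : Fin n → ℝ) (t : ℝ) : Mat n :=
  (Matrix.diagonal fun i => Real.exp (-(t * l i / 2))) * T

variable {P₀ P₁ T S : Mat n} {l : Fin n → ℝ}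

theorem frameFlowInv_mul (hTS : T * S = 1) (t : ℝ) : frameFlowInv T l t * frameFlow S l t = 1 := by
  rw [frameFlowInv, frameFlow, Matrix.mul_assoc, ← Matrix.mul_assoc T, hTS, Matrix.one_mul,
    Matrix.diagonal_mul_diagonal]
  simp [← Real.exp_add]

theorem frameFlow_mul (hTS : T * S = 1) (t : ℝ) : frameFlow S l t * frameFlowInv T l t = 1 :=
  mul_eq_one_comm.1 (frameFlowInv_mul hTS t)

theorem GeodesicFrame.path_eq (hF : GeodesicFrame P₀ P₁ T S l) (t : ℝ) :
    pathInfo P₀ P₁ t = frameFlow S l t * (frameFlow S l t)ᵀ := by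
  rw [hF.path, frameFlow, Matrix.transpose_mul, Matrix.diagonal_transpose, Matrix.mul_assoc,
    Matrix.mul_assoc, ← Matrix.mul_assoc (Matrix.diagonal _) (Matrix.diagonal _),
    Matrix.diagonal_mul_diagonal]
  simp only [← Real.exp_add, add_halves]

theorem GeodesicFrame.path_zero (hF : GeodesicFrame P₀ P₁ T S l) : pathInfo P₀ P₁ 0 = P₀ := by
  have hST := hF.mul_eq_one'
  rw [hF.path]
  simp only [zero_mul, Real.exp_zero, Matrix.diagonal_one, Matrix.mul_one]
  calc S * Sᵀ = S * (T * P₀ * Tᵀ) * Sᵀ := by rw [hF.left, Matrix.mul_one]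
    _ = (S * T) * P₀ * (S * T)ᵀ := by rw [Matrix.transpose_mul]; simp only [Matrix.mul_assoc]
    _ = P₀ := by rw [hST]; simp

theorem GeodesicFrame.path_one (hF : GeodesicFrame P₀ P₁ T S l) : pathInfo P₀ P₁ 1 = P₁ := by
  have hST := hF.mul_eq_one'
  rw [hF.path]
  simp only [one_mul, ← hF.right]
  calc S * (T * P₁ * Tᵀ) * Sᵀ = (S * T) * P₁ * (S * T)ᵀ := by
        rw [Matrix.transpose_mul]; simp only [Matrix.mul_assoc]
    _ = P₁ := by rw [hST]; simp

theorem GeodesicFrame.field_mul_frameFlow (hF : GeodesicFrame P₀ P₁ T S l) (t : ℝ) :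
    matAInfo P₀ P₁ * frameFlow S l t
      = S * Matrix.diagonal fun i => Real.exp (t * l i / 2) * (l i / 2) := by
  rw [hF.field, frameFlow, Matrix.smul_mul, Matrix.mul_assoc _ T, ← Matrix.mul_assoc T,
    hF.mul_eq_one, Matrix.one_mul, Matrix.mul_assoc, Matrix.diagonal_mul_diagonal,
    ← Matrix.mul_smul, ← Matrix.diagonal_smul]
  congr 2
  ext i
  simp only [Pi.smul_apply, smul_eq_mul]
  ring

theorem linField_mul_diagonal (S : Mat n) (d : Fin n → ℝ) (y : Vec n) :
    linField (S * Matrix.diagonal d) y = linField S (WithLp.toLp 2 fun i => d i * y i) := by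
  rw [linField, ← Matrix.mulVec_mulVec, linField]
  congr 2
  ext i
  rw [Matrix.mulVec_diagonal]

/-- In the frame the flow is diagonal with rates `l i / 2`, and these are the rates of the linear
field. -/
theorem GeodesicFrame.hasDerivAt_flow (hF : GeodesicFrame P₀ P₁ T S l) (y : Vec n) (t : ℝ) :
    HasDerivAt (fun s => linField (frameFlow S l s) y)
      (linField (matAInfo P₀ P₁) (linField (frameFlow S l t) y)) t := by
  rw [linField_linField, hF.field_mul_frameFlow]
  simp only [frameFlow, linField_mul_diagonal]
  have h1 : HasDerivAt (fun s : ℝ => fun i : Fin n => Real.exp (s * l i / 2) * y i)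
      (fun i => Real.exp (t * l i / 2) * (l i / 2) * y i) t := by
    refine hasDerivAt_pi.2 fun i => ?_
    have h2 : HasDerivAt (fun s : ℝ => s * l i / 2) (l i / 2) t := by
      simpa using ((hasDerivAt_id t).mul_const (l i)).div_const 2
    exact h2.exp.mul_const _
  have h2 := ((PiLp.continuousLinearEquiv 2 ℝ (fun _ : Fin n => ℝ)).symm : (Fin n → ℝ) →L[ℝ] Vec n)
    |>.hasFDerivAt.comp_hasDerivAt t h1
  exact ((Matrix.toEuclideanLin S).toContinuousLinearMap).hasFDerivAt.comp_hasDerivAt t h2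

theorem contDiff_frameFlow (S : Mat n) (l : Fin n → ℝ) :
    ContDiff ℝ ∞ fun z : ℝ × Vec n => linField (frameFlow S l z.1) z.2 := by
  simp only [frameFlow, linField_mul_diagonal]
  refine ((Matrix.toEuclideanLin S).toContinuousLinearMap).contDiff.comp (?_ : ContDiff ℝ ∞
    fun z : ℝ × Vec n => (WithLp.toLp 2 fun i => Real.exp (z.1 * l i / 2) * z.2 i : Vec n))
  refine contDiff_euclidean.2 fun i => ?_
  have : ContDiff ℝ ∞ fun z : ℝ × Vec n => z.2 i :=
    (EuclideanSpace.proj i : Vec n →L[ℝ] ℝ).contDiff.comp contDiff_snd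
  exact (((contDiff_fst.mul contDiff_const).div_const _).exp).mul this

theorem contDiff_frameFlowInv (T : Mat n) (l : Fin n → ℝ) :
    ContDiff ℝ ∞ fun z : ℝ × Vec n => linField (frameFlowInv T l z.1) z.2 := by
  have e : ∀ z : ℝ × Vec n, linField (frameFlowInv T l z.1) z.2
      = WithLp.toLp 2 fun i => Real.exp (-(z.1 * l i / 2)) * linField T z.2 i := by
    intro z
    rw [frameFlowInv, ← linField_linField, linField]
    congr 1
    ext i
    rw [Matrix.mulVec_diagonal]
  simp only [e]
  refine contDiff_euclidean.2 fun i => ?_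
  have : ContDiff ℝ ∞ fun z : ℝ × Vec n => linField T z.2 i :=
    (EuclideanSpace.proj i : Vec n →L[ℝ] ℝ).contDiff.comp
      ((Matrix.toEuclideanLin T).toContinuousLinearMap.contDiff.comp contDiff_snd)
  exact (((contDiff_fst.mul contDiff_const).div_const _).neg.exp).mul this

theorem GeodesicFrame.hasDerivAt_along (hF : GeodesicFrame P₀ P₁ T S l)
    {φ : ℝ × Vec n → ℝ} (hφ : ContDiff ℝ ∞ φ) (y : Vec n) (t : ℝ) :
    HasDerivAt (fun s => φ (s, linField (frameFlow S l s) y))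
      (fderiv ℝ φ (t, linField (frameFlow S l t) y)
        (1, linField (matAInfo P₀ P₁) (linField (frameFlow S l t) y))) t :=
  ((hφ.differentiable (by norm_num)) _).hasFDerivAt.comp_hasDerivAt t
    ((hasDerivAt_id t).prodMk (hF.hasDerivAt_flow y t))

/-- A function transported by the flow has no derivative along the flow. -/
theorem GeodesicFrame.fderiv_transported (hF : GeodesicFrame P₀ P₁ T S l) {ψ : Vec n → ℝ}
    (hψ : ContDiff ℝ ∞ ψ) (t : ℝ) (x : Vec n) :
    fderiv ℝ (fun z : ℝ × Vec n => ψ (linField (frameFlowInv T l z.1) z.2)) (t, x)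
      (1, linField (matAInfo P₀ P₁) x) = 0 := by
  have h := hF.hasDerivAt_along (hψ.comp (contDiff_frameFlowInv T l))
    (linField (frameFlowInv T l t) x) t
  simp only [Function.comp_def, linField_linField, ← Matrix.mul_assoc, frameFlowInv_mul hF.mul_eq_one] at h
  rw [Matrix.mul_assoc, frameFlow_mul hF.mul_eq_one, Matrix.mul_one, linField_one] at h
  exact h.unique (by simpa only [Matrix.one_mul] using hasDerivAt_const t _)

/-- The support at time `t` is the image of the support of `ψ` under the flow; the images over `[-1,
2]` sweep out one compact set. -/
theorem exists_isTest_transported (hTS : T * S = 1) (l : Fin n → ℝ) {ψ : Vec n → ℝ}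
    (hψ : ContDiff ℝ ∞ ψ) (hc : HasCompactSupport ψ) :
    ∃ K, IsTest (fun z : ℝ × Vec n => ψ (linField (frameFlowInv T l z.1) z.2)) K := by
  refine ⟨(fun z : ℝ × Vec n => linField (frameFlow S l z.1) z.2) ''
    (Icc (-1 : ℝ) 2 ×ˢ tsupport ψ), hψ.comp (contDiff_frameFlowInv T l),
    (isCompact_Icc.prod hc.isCompact).image (contDiff_frameFlow S l).continuous, ?_⟩
  intro t ht x hx
  refine image_eq_zero_of_notMem_tsupport fun hm => hx ?_
  refine ⟨(t, linField (frameFlowInv T l t) x), ⟨Ioo_subset_Icc_self ht, hm⟩, ?_⟩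
  simp only [linField_linField, frameFlow_mul hTS, linField_one]

/-- The density transported by the linear field of the geodesic is Gaussian. -/
theorem Feasible.density_eq {p : ℝ → Vec n → ℝ} {v : ℝ → Vec n → Vec n}
    (h : Feasible P₀ P₁ p v) (hF : GeodesicFrame P₀ P₁ T S l)
    (hv : ∀ᵐ t ∂(volume.restrict (Icc (0 : ℝ) 1)), ∀ᵐ x, p t x ≠ 0 →
      v t x = linField (matAInfo P₀ P₁) x) {t : ℝ} (ht : t ∈ Icc (0 : ℝ) 1) :
    p t =ᵐ[volume] gaussianDensity (pathInfo P₀ P₁ t) := by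
  have hg : ∀ s, IsProbDensity (gaussianDensity (pathInfo P₀ P₁ s)) := fun s => by
    rw [hF.path_eq]
    exact isProbDensity_gaussianDensity (frameFlowInv_mul (l := l) hF.mul_eq_one s)
  have hgi : ∀ s, ∀ ψ : Vec n → ℝ,
      ∫ x, ψ (linField (frameFlowInv T l s) x) * gaussianDensity (pathInfo P₀ P₁ s) x
        = ∫ y, ψ y ∂(ProbabilityTheory.stdGaussian (Vec n)) := by
    intro s ψ
    rw [hF.path_eq, integral_mul_gaussianDensity (frameFlowInv_mul (l := l) hF.mul_eq_one s)
      fun x => ψ (linField (frameFlowInv T l s) x)]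
    simp only [linField_linField, frameFlowInv_mul hF.mul_eq_one, linField_one]
  -- Functions transported by the flow have zero derivative along the velocity wherever `p` is
  -- nonzero, so their integral against `p` keeps its initial Gaussian value.
  have key : ∀ ψ : Vec n → ℝ, ContDiff ℝ ∞ ψ → HasCompactSupport ψ →
      ∫ x, ψ (linField (frameFlowInv T l t) x) * p t x
        = ∫ y, ψ y ∂(ProbabilityTheory.stdGaussian (Vec n)) := by
    intro ψ hψ hc
    obtain ⟨K, hK⟩ := exists_isTest_transported (T := T) (S := S) hF.mul_eq_one l hψ hc
    have h1 := h.integral_test_sub hK ht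
    have h2 : ∫ s in (0 : ℝ)..t, ∫ x, p s x *
        fderiv ℝ (fun z : ℝ × Vec n => ψ (linField (frameFlowInv T l z.1) z.2)) (s, x)
          (1, v s x) = 0 := by
      refine intervalIntegral.integral_zero_ae ?_
      rw [uIoc_of_le ht.1, ← ae_restrict_iff' measurableSet_Ioc]
      refine ae_restrict_of_ae_restrict_of_subset
        (Ioc_subset_Icc_self.trans (Icc_subset_Icc_right ht.2)) ?_
      filter_upwards [hv] with s hs
      refine integral_eq_zero_of_ae ?_
      filter_upwards [hs] with x hx
      simp only [Pi.zero_apply]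
      by_cases hpx : p s x = 0
      · rw [hpx, zero_mul]
      · rw [hx hpx, hF.fderiv_transported hψ, mul_zero]
    rw [h2, sub_eq_zero] at h1
    rw [h1, ← hgi 0 ψ]
    refine integral_congr_ae ?_
    filter_upwards [h.initial] with x hx
    simp only [hx, hF.path_zero]
  have hsub : Integrable fun x => p t x - gaussianDensity (pathInfo P₀ P₁ t) x :=
    (h.density t ht).integrable.sub (hg t).integrable
  -- At a fixed time every test `χ` arises from transport, by starting from `χ` composed with the
  -- flow.
  have hz := ae_eq_zero_of_integral_contDiff_smul_eq_zero hsub.locallyIntegrable fun χ hχ hχc => by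
    have hflow : ContDiff ℝ ∞ (linField (frameFlow S l t)) :=
      ((Matrix.toEuclideanLin (frameFlow S l t)).toContinuousLinearMap).contDiff
    have hcs : HasCompactSupport fun y : Vec n => χ (linField (frameFlow S l t) y) := by
      refine HasCompactSupport.intro (hχc.isCompact.image
        (continuous_linField (frameFlowInv T l t))) fun y hy => ?_
      refine image_eq_zero_of_notMem_tsupport fun hm => hy ⟨_, hm, ?_⟩
      rw [linField_linField, frameFlowInv_mul hF.mul_eq_one, linField_one]
    have e1 := key _ (hχ.comp hflow) hcs
    have e2 := hgi t fun y => χ (linField (frameFlow S l t) y)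
    simp only [Function.comp_def, linField_linField, frameFlow_mul hF.mul_eq_one,
      linField_one] at e1 e2
    obtain ⟨M, hM⟩ := hχ.continuous.bounded_above_of_compact_support hχc
    simp only [smul_eq_mul, mul_sub]
    rw [integral_sub ((h.density t ht).integrable_mul hχ.continuous hM)
      ((hg t).integrable_mul hχ.continuous hM), e1, e2, sub_self]
  filter_upwards [hz] with x hx using sub_eq_zero.1 hx

/-! ### Feasibility and cost of the geodesic -/

theorem GeodesicFrame.continuous_density (hF : GeodesicFrame P₀ P₁ T S l) :
    Continuous fun z : ℝ × Vec n => gaussianDensity (pathInfo P₀ P₁ z.1) z.2 := by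
  have e : ∀ z : ℝ × Vec n, gaussianDensity (pathInfo P₀ P₁ z.1) z.2
      = |(frameFlowInv T l z.1).det| *
        gaussianDensity (1 : Mat n) (linField (frameFlowInv T l z.1) z.2) := fun z => by
    rw [hF.path_eq, gaussianDensity_conj (frameFlowInv_mul (l := l) hF.mul_eq_one z.1)]
  simp only [e]
  refine Continuous.mul ?_ ((continuous_gaussianDensity 1).comp
    (contDiff_frameFlowInv T l).continuous)
  simp only [frameFlowInv, Matrix.det_mul, Matrix.det_diagonal]
  fun_prop

theorem GeodesicFrame.isProbDensity (hF : GeodesicFrame P₀ P₁ T S l) (t : ℝ) :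
    IsProbDensity (gaussianDensity (pathInfo P₀ P₁ t)) := by
  rw [hF.path_eq]
  exact isProbDensity_gaussianDensity (frameFlowInv_mul (l := l) hF.mul_eq_one t)

theorem GeodesicFrame.integral_density (hF : GeodesicFrame P₀ P₁ T S l) (t : ℝ) (F : Vec n → ℝ) :
    ∫ x, F x * gaussianDensity (pathInfo P₀ P₁ t) x
      = ∫ y, F (linField (frameFlow S l t) y) ∂(ProbabilityTheory.stdGaussian (Vec n)) := by
  rw [hF.path_eq, integral_mul_gaussianDensity (frameFlowInv_mul (l := l) hF.mul_eq_one t)]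

theorem GeodesicFrame.secondMoment_density (hF : GeodesicFrame P₀ P₁ T S l) (t : ℝ) :
    secondMoment (gaussianDensity (pathInfo P₀ P₁ t)) = pathInfo P₀ P₁ t := by
  rw [hF.path_eq, secondMoment_gaussianDensity (frameFlowInv_mul (l := l) hF.mul_eq_one t)]

theorem GeodesicFrame.integrable_moment_density (hF : GeodesicFrame P₀ P₁ T S l) (t : ℝ) :
    Integrable fun x : Vec n => ‖x‖ ^ 2 * gaussianDensity (pathInfo P₀ P₁ t) x := by
  rw [hF.path_eq]
  exact integrable_norm_sq_gaussianDensity (frameFlowInv_mul (l := l) hF.mul_eq_one t)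

theorem GeodesicFrame.integrableOn_moment (hF : GeodesicFrame P₀ P₁ T S l) :
    Integrable (fun z : ℝ × Vec n => ‖z.2‖ ^ 2 * gaussianDensity (pathInfo P₀ P₁ z.1) z.2)
      ((volume.restrict (Icc (0 : ℝ) 1)).prod volume) := by
  have hc : Continuous fun z : ℝ × Vec n =>
      ‖z.2‖ ^ 2 * gaussianDensity (pathInfo P₀ P₁ z.1) z.2 :=
    (continuous_snd.norm.pow 2).mul hF.continuous_density
  rw [integrable_prod_iff hc.aestronglyMeasurable]
  refine ⟨Filter.Eventually.of_forall fun t => hF.integrable_moment_density t, ?_⟩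
  have e : ∀ t, ∫ x : Vec n, ‖‖x‖ ^ 2 * gaussianDensity (pathInfo P₀ P₁ t) x‖
      = (pathInfo P₀ P₁ t).trace := by
    intro t
    rw [← hF.secondMoment_density t, trace_secondMoment (hF.isProbDensity t)
      (hF.integrable_moment_density t), hF.secondMoment_density t]
    refine integral_congr_ae (Filter.Eventually.of_forall fun x => ?_)
    exact Real.norm_of_nonneg (mul_nonneg (sq_nonneg _) ((hF.isProbDensity t).nonneg x))
  simp only [e]
  have hct : Continuous fun t => (pathInfo P₀ P₁ t).trace := by
    simp only [hF.path, Matrix.trace, Matrix.diag_apply, Matrix.mul_apply, Matrix.diagonal_apply]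
    refine continuous_finsetSum _ fun i _ => continuous_finsetSum _ fun j _ =>
      Continuous.mul (continuous_finsetSum _ fun k _ => ?_) continuous_const
    split_ifs
    · fun_prop
    · fun_prop
  exact hct.integrableOn_Icc

/-- After changing variables to the standard Gaussian, the integrand is the time derivative of `φ`
along a trajectory of the flow. Fubini puts the time integral inside, and `φ` vanishes at both ends.
-/
theorem GeodesicFrame.continuityEquation (hF : GeodesicFrame P₀ P₁ T S l) :
    ContinuityEquation (fun t => gaussianDensity (pathInfo P₀ P₁ t))
      (fun _ => linField (matAInfo P₀ P₁)) := by
  refine ⟨fun K hK _ => ?_, fun φ hφ hφc hφs => ?_⟩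
  · exact (hF.continuous_density.mul ((continuous_linField _).comp
      continuous_snd).norm).continuousOn.integrableOn_compact hK
  set H : ℝ × Vec n → ℝ := fun z => fderiv ℝ φ z (1, linField (matAInfo P₀ P₁) z.2) with hH
  have hHc : Continuous H := (hφ.continuous_fderiv (by norm_num)).clm_apply
    (continuous_const.prodMk ((continuous_linField _).comp continuous_snd))
  have hHs : HasCompactSupport H := (hφc.fderiv (𝕜 := ℝ)).mono fun z hz => by
    rw [Function.mem_support] at hz ⊢
    intro h0
    exact hz (by simp only [hH, h0, zero_apply])
  obtain ⟨M, hM⟩ := hHc.bounded_above_of_compact_support hHs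
  rw [volume_restrict_slab]
  have hdi : Integrable (fun z : ℝ × Vec n => gaussianDensity (pathInfo P₀ P₁ z.1) z.2)
      ((volume.restrict (Icc (0 : ℝ) 1)).prod volume) := by
    rw [integrable_prod_iff hF.continuous_density.aestronglyMeasurable]
    refine ⟨Filter.Eventually.of_forall fun t => (hF.isProbDensity t).integrable, ?_⟩
    simp only [Real.norm_of_nonneg ((hF.isProbDensity _).nonneg _),
      (hF.isProbDensity _).integral_eq_one]
    exact integrable_const _
  have hi : Integrable (fun z : ℝ × Vec n => gaussianDensity (pathInfo P₀ P₁ z.1) z.2 * H z)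
      ((volume.restrict (Icc (0 : ℝ) 1)).prod volume) :=
    hdi.mul_bdd hHc.aestronglyMeasurable (Filter.Eventually.of_forall hM)
  change ∫ z : ℝ × Vec n, gaussianDensity (pathInfo P₀ P₁ z.1) z.2 * H z
    ∂((volume.restrict (Icc (0 : ℝ) 1)).prod volume) = 0
  rw [integral_prod _ hi]
  have e : ∀ t : ℝ, ∫ x, gaussianDensity (pathInfo P₀ P₁ t) x * H (t, x)
      = ∫ y, H (t, linField (frameFlow S l t) y)
        ∂(ProbabilityTheory.stdGaussian (Vec n)) := by
    intro t
    rw [← hF.integral_density t fun x => H (t, x)]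
    simp only [mul_comm]
  simp only [e]
  have hcH : Continuous fun z : ℝ × Vec n => H (z.1, linField (frameFlow S l z.1) z.2) :=
    hHc.comp (continuous_fst.prodMk (contDiff_frameFlow S l).continuous)
  rw [integral_integral_swap]
  · refine integral_eq_zero_of_ae (Filter.Eventually.of_forall fun y => ?_)
    have hzero : ∀ t, t ∉ Ioo (0 : ℝ) 1 → ∀ x, φ (t, x) = 0 := fun t ht x =>
      image_eq_zero_of_notMem_tsupport fun hm => ht (hφs hm).1
    have hd : ∀ t, HasDerivAt (fun s => φ (s, linField (frameFlow S l s) y))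
        (H (t, linField (frameFlow S l t) y)) t := fun t => hF.hasDerivAt_along hφ y t
    have hcy : Continuous fun t => H (t, linField (frameFlow S l t) y) :=
      hcH.comp (by fun_prop : Continuous fun t : ℝ => (t, y))
    have := intervalIntegral.integral_eq_sub_of_hasDerivAt (a := 0) (b := 1)
      (fun t _ => hd t) (hcy.intervalIntegrable 0 1)
    rw [hzero 0 (by simp), hzero 1 (by simp), sub_self,
      intervalIntegral.integral_of_le zero_le_one, ← integral_Icc_eq_integral_Ioc] at this
    exact this
  · exact Integrable.of_bound hcH.aestronglyMeasurable M
      (Filter.Eventually.of_forall fun z => hM _)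

/-- Pulled back to a fixed Gaussian measure, only the bounded integrand depends on time, and
dominated convergence applies. -/
theorem GeodesicFrame.continuous_integral (hF : GeodesicFrame P₀ P₁ T S l) (f : Vec n →ᵇ ℝ) :
    Continuous fun t => ∫ x, f x * gaussianDensity (pathInfo P₀ P₁ t) x := by
  simp only [hF.integral_density]
  refine continuous_of_dominated (bound := fun _ => ‖f‖) (fun t => ?_)
    (fun t => Filter.Eventually.of_forall fun y => f.norm_coe_le_norm _)
    (integrable_const _) (Filter.Eventually.of_forall fun y => ?_)
  · exact (f.continuous.comp (continuous_linField _)).aestronglyMeasurable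
  · have hy : Continuous fun t : ℝ => linField (frameFlow S l t) y :=
      continuous_iff_continuousAt.2 fun t => (hF.hasDerivAt_flow y t).continuousAt
    exact f.continuous.comp hy

theorem GeodesicFrame.feasible (hF : GeodesicFrame P₀ P₁ T S l) :
    Feasible P₀ P₁ (fun t => gaussianDensity (pathInfo P₀ P₁ t))
      (fun _ => linField (matAInfo P₀ P₁)) where
  density t _ := hF.isProbDensity t
  aemeasurable_density := hF.continuous_density.measurable.aemeasurable
  aemeasurable_velocity :=
    ((continuous_linField _).comp continuous_snd).measurable.aemeasurable
  narrow f := (hF.continuous_integral f).continuousOn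
  secondMoment_integrable := by
    rw [IntegrableOn, volume_restrict_slab]; exact hF.integrableOn_moment
  initial := by simp only [hF.path_zero]; rfl
  final := by simp only [hF.path_one]; rfl
  continuity := hF.continuityEquation

/-- In coordinates that whiten the covariance at time `t`, the field multiplies the `i`-th
coordinate by `l i / 2`. The dependence on `t` disappears, so the geodesic has constant speed. -/
theorem GeodesicFrame.weightedSq_field (hF : GeodesicFrame P₀ P₁ T S l) (t : ℝ) (y : Vec n) :
    weightedSq (pathInfo P₀ P₁ t)⁻¹ (linField (matAInfo P₀ P₁) (linField (frameFlow S l t) y))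
      = ∑ i, (1 / 4) * l i ^ 2 * (y i * y i) := by
  have hinv : (pathInfo P₀ P₁ t)⁻¹ = (frameFlowInv T l t)ᵀ * frameFlowInv T l t := by
    refine Matrix.inv_eq_left_inv ?_
    rw [hF.path_eq]
    calc _ = (frameFlowInv T l t)ᵀ * (frameFlowInv T l t * frameFlow S l t)
          * (frameFlow S l t)ᵀ := by simp only [Matrix.mul_assoc]
      _ = (frameFlow S l t * frameFlowInv T l t)ᵀ := by
          rw [frameFlowInv_mul hF.mul_eq_one, Matrix.mul_one, Matrix.transpose_mul]
      _ = 1 := by rw [frameFlow_mul hF.mul_eq_one, Matrix.transpose_one]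
  have hM : frameFlowInv T l t * (matAInfo P₀ P₁ * frameFlow S l t)
      = Matrix.diagonal fun i => l i / 2 := by
    rw [hF.field_mul_frameFlow, frameFlowInv, Matrix.mul_assoc, ← Matrix.mul_assoc T,
      hF.mul_eq_one, Matrix.one_mul, Matrix.diagonal_mul_diagonal]
    congr 1
    ext i
    rw [← mul_assoc, ← Real.exp_add, neg_add_cancel, Real.exp_zero, one_mul]
  rw [linField_linField, weightedSq, hinv, ← Matrix.mulVec_mulVec, Matrix.dotProduct_mulVec,
    Matrix.vecMul_transpose]
  simp only [linField]
  rw [Matrix.mulVec_mulVec, hM, dotProduct]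
  refine Finset.sum_congr rfl fun i _ => ?_
  rw [Matrix.mulVec_diagonal]
  ring

theorem GeodesicFrame.cost_eq (hF : GeodesicFrame P₀ P₁ T S l) :
    cost (fun t => gaussianDensity (pathInfo P₀ P₁ t)) (fun _ => linField (matAInfo P₀ P₁))
      = ENNReal.ofReal (∑ i, l i ^ 2) := by
  have hl0 : 0 ≤ ∑ i, l i ^ 2 := Finset.sum_nonneg fun i _ => sq_nonneg _
  have e : ∀ t : ℝ, ∫⁻ x, ENNReal.ofReal
      (weightedSq (secondMoment (gaussianDensity (pathInfo P₀ P₁ t)))⁻¹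
        (linField (matAInfo P₀ P₁) x)) ∂(law (gaussianDensity (pathInfo P₀ P₁ t)))
      = ENNReal.ofReal ((1 / 4) * ∑ i, l i ^ 2) := by
    intro t
    have hTS := frameFlowInv_mul (l := l) hF.mul_eq_one t
    rw [hF.secondMoment_density]
    have hlaw : law (gaussianDensity (pathInfo P₀ P₁ t))
        = (ProbabilityTheory.stdGaussian (Vec n)).map (linField (frameFlow S l t)) := by
      rw [hF.path_eq, law_gaussianDensity hTS]
    have hi : Integrable (fun y : Vec n => ∑ i, (1 / 4) * l i ^ 2 * (y i * y i))
        (ProbabilityTheory.stdGaussian (Vec n)) :=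
      integrable_finsetSum _ fun i _ => (integrable_apply_mul_apply_stdGaussian i i).const_mul _
    rw [hlaw, (measurableEmbedding_linField hTS).lintegral_map]
    simp only [hF.weightedSq_field]
    rw [← ofReal_integral_eq_lintegral_ofReal hi (Filter.Eventually.of_forall fun y =>
      Finset.sum_nonneg fun i _ => mul_nonneg (by positivity) (mul_self_nonneg _)),
      integral_finsetSum _ fun i _ => (integrable_apply_mul_apply_stdGaussian i i).const_mul _]
    simp only [integral_const_mul, integral_apply_mul_apply_stdGaussian, Finset.mul_sum]
    simp
  rw [cost]
  simp only [e]
  rw [setLIntegral_const, Real.volume_Icc, sub_zero, ENNReal.ofReal_one, mul_one,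
    ENNReal.ofReal_mul (by norm_num), ← mul_assoc]
  have : (4 : ℝ≥0∞) = ENNReal.ofReal 4 := by norm_num
  rw [this, ← ENNReal.ofReal_mul (by norm_num)]
  norm_num

theorem secondMoment_congr {f g : Vec n → ℝ} (h : f =ᵐ[volume] g) :
    secondMoment f = secondMoment g := by
  ext i j
  rw [secondMoment, secondMoment, Matrix.of_apply, Matrix.of_apply]
  refine integral_congr_ae ?_
  filter_upwards [h] with x hx
  rw [hx]

theorem Feasible.secondMoment_initial {p : ℝ → Vec n → ℝ} {v : ℝ → Vec n → Vec n}
    (h : Feasible P₀ P₁ p v) (hF : GeodesicFrame P₀ P₁ T S l) : secondMoment (p 0) = P₀ := by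
  have := hF.secondMoment_density 0
  rw [hF.path_zero] at this
  rw [secondMoment_congr h.initial, this]

theorem Feasible.secondMoment_final {p : ℝ → Vec n → ℝ} {v : ℝ → Vec n → Vec n}
    (h : Feasible P₀ P₁ p v) (hF : GeodesicFrame P₀ P₁ T S l) : secondMoment (p 1) = P₁ := by
  have := hF.secondMoment_density 1
  rw [hF.path_one] at this
  rw [secondMoment_congr h.final, this]

theorem ae_law_iff {f : Vec n → ℝ} (hf : IsProbDensity f) {Q : Vec n → Prop} :
    (∀ᵐ x ∂(law f), Q x) ↔ ∀ᵐ x, f x ≠ 0 → Q x := by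
  rw [law, ae_withDensity_iff' hf.integrable.aemeasurable.ennreal_ofReal]
  have : ∀ x, ENNReal.ofReal (f x) ≠ 0 ↔ f x ≠ 0 := fun x => by
    rw [Ne, ENNReal.ofReal_eq_zero, not_le, lt_iff_le_and_ne]
    exact ⟨fun h => h.2.symm, fun h => ⟨hf.nonneg x, h.symm⟩⟩
  simp only [this]

end InfoOMT

end

/-! ### Minimality, uniqueness and the optimal value -/

theorem mainTheorem2 (n : ℕ) (P₀ P₁ : Matrix (Fin n) (Fin n) ℝ)
    (hP₀ : P₀.PosDef) (hP₁ : P₁.PosDef) :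
    InfoOMT.IsMinimizer P₀ P₁
        (fun t => InfoOMT.gaussianDensity (InfoOMT.pathInfo P₀ P₁ t))
        (fun _ => InfoOMT.linField (InfoOMT.matAInfo P₀ P₁)) ∧
      (∀ (p : ℝ → EuclideanSpace ℝ (Fin n) → ℝ)
          (v : ℝ → EuclideanSpace ℝ (Fin n) → EuclideanSpace ℝ (Fin n)),
        InfoOMT.IsMinimizer P₀ P₁ p v →
          (∀ t ∈ Set.Icc (0 : ℝ) 1,
            p t =ᵐ[volume] InfoOMT.gaussianDensity (InfoOMT.pathInfo P₀ P₁ t)) ∧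
          (∀ᵐ t ∂(volume.restrict (Set.Icc (0 : ℝ) 1)), ∀ᵐ x ∂(InfoOMT.law (p t)),
            v t x = InfoOMT.linField (InfoOMT.matAInfo P₀ P₁) x)) ∧
      InfoOMT.optimalValue P₀ P₁ = ENNReal.ofReal (InfoOMT.distInfo P₀ P₁ ^ 2) := by
  obtain ⟨T, S, l, hF⟩ := InfoOMT.exists_geodesicFrame hP₀ hP₁
  have hlow : ∀ q w, InfoOMT.Feasible P₀ P₁ q w →
      ENNReal.ofReal (∑ i, l i ^ 2) ≤ InfoOMT.cost q w := fun q w h =>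
    h.le_cost hF (h.secondMoment_initial hF) (h.secondMoment_final hF)
  refine ⟨⟨hF.feasible, fun q w h => ?_⟩, fun p v hmin => ?_, ?_⟩
  · rw [hF.cost_eq]
    exact hlow q w h
  · have h := hmin.1
    -- Comparison with the geodesic gives a minimizer the upper bound `∑ i, l i ^ 2`, the equality
    -- case of the calibration.
    have hle := hmin.2 _ _ hF.feasible
    rw [hF.cost_eq] at hle
    have hv := h.velocity_eq hF (h.secondMoment_initial hF) (h.secondMoment_final hF) hle
    refine ⟨fun t ht => h.density_eq hF hv ht, ?_⟩
    filter_upwards [hv, ae_restrict_mem measurableSet_Icc] with t ht hmem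
    exact (InfoOMT.ae_law_iff (h.density t hmem)).2 ht
  · rw [hF.dist]
    refine le_antisymm (sInf_le ⟨_, _, hF.feasible, hF.cost_eq⟩) (le_sInf ?_)
    rintro c ⟨p, v, h, rfl⟩
    exact hlow p v h
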